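/- Let $S$ be a triangulated closed surface (a finite simplicial complex in which the link of every vertex is a circle) with totally ordered vertex set $V$, and let $\varphi$ be a combinatorial automorphism of $S$. The *twisted product triangulation* of $S$ over $S^1$ with gluing automorphism $\varphi$ is obtained from the staircase product triangulation of $S\times I$, where $I$ is an interval triangulated as a path with four vertices $0,1,2,3$, by identifying $(v,3)$ with $(\varphi(v),0)$ for all $v\in V$; it has $3|V|$ vertices. A *product triangulation* of $S\times S^1$ is the staircase triangulation of the product of $S$ with a triangulated circle with totally ordered vertices. Let ${}^2 8_{20}$ be the simplicial complex with vertices $1,\dots,8$ and the sixteen triangles $123, 124, 135, 146, 157, 168, 178, 236, 245, 258, 267, 278, 345, 346, 567, 568$. Let ${\cal B}_1,\dots,{\cal B}_4$ be the four closed non-orientable flat $3$-manifolds, ${\cal B}_i=\mathbb R^3/\Gamma_i$, where $\Gamma_i$ is the group of Euclidean motions generated by * $i=1$: $(x,y,z)\mapsto(x+\tfrac12,y,-z)$ and the translations by $(0,1,0)$ and $(0,0,1)$ (so ${\cal B}_1$ is homeomorphic to the product of the Klein bottle with $S^1$); * $i=2$: $(x,y,z)\mapsto(x+\tfrac12,y,-z)$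 and the translations by $(0,1,0)$ and $(\tfrac12,\tfrac12,1)$; * $i=3$: $(x,y,z)\mapsto(x+\tfrac12,-y,-z)$, $(x,y,z)\mapsto(x,y+\tfrac12,-z)$ and the translation by $(0,0,1)$; * $i=4$: $(x,y,z)\mapsto(x+\tfrac12,-y,-z)$, $(x,y,z)\mapsto(x,y+\tfrac12,-z+\tfrac12)$ and the translation by $(0,0,1)$. **Theorem.** The complex ${}^2 8_{20}$ is a triangulation of the Klein bottle, and every triangulation of the Klein bottle has at least $8$ vertices. For each $i\in\{1,2,3,4\}$: 1. there is an automorphism $\varphi_i$ of ${}^2 8_{20}$, with $\varphi_1=\mathrm{id}$, such that the twisted product triangulation of ${}^2 8_{20}$ over $S^1$ with gluing automorphism $\varphi_i$ is a triangulation of ${\cal B}_i$ with $24$ vertices; 2. this is minimal: every twisted product triangulation of a triangulated closed surface over $S^1$, and every product triangulation of a triangulated closed surface and a circle, that is homeomorphic to ${\cal B}_i$ has at least $24$ vertices. -/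

import Mathlib

open Finset

/-! ### Simplicial complexes -/

/-- The geometric realization of an abstract simplicial complex on a finite vertex set, with the
topology induced from `V → ℝ`. -/
def geomRealization {V : Type*} [Fintype V] (K : AbstractSimplicialComplex V) : Set (V → ℝ) :=
  {x | (∀ v, 0 ≤ x v) ∧ ∑ v, x v = 1 ∧ ∃ s ∈ K.faces, ∀ v, v ∉ s → x v = 0}

/-- The number of vertices of a complex: every element of `V` is a vertex, because an
`AbstractSimplicialComplex` contains all singletons. -/
def numVertices {V : Type*} [Fintype V] (_K : AbstractSimplicialComplex V) : ℕ :=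
  Fintype.card V

/-- The group of combinatorial automorphisms of a complex. -/
def complexAut {V : Type*} [DecidableEq V] (K : AbstractSimplicialComplex V) :
    Subgroup (Equiv.Perm V) where
  carrier := {φ | ∀ s : Finset V, s.image φ ∈ K.faces ↔ s ∈ K.faces}
  mul_mem' := by
    intro a b ha hb s
    have h : s.image (a * b : Equiv.Perm V) = (s.image b).image a := by
      rw [Finset.image_image]; rfl
    rw [h, ha, hb]
  one_mem' := by
    intro s
    have h : s.image (1 : Equiv.Perm V) = s := by
      simp
    rw [h]
  inv_mem' := by
    intro a ha s
    have h : (s.image (a⁻¹ : Equiv.Perm V)).image a = s := by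
      rw [Finset.image_image]
      have : (a ∘ (a⁻¹ : Equiv.Perm V)) = id := by
        funext x; simp
      rw [this, Finset.image_id]
    rw [← ha, h]

/-- The link of a vertex. -/
def vertexLink {V : Type*} [DecidableEq V] (K : AbstractSimplicialComplex V) (v : V) :
    PreAbstractSimplicialComplex V where
  faces := {s | s.Nonempty ∧ v ∉ s ∧ insert v s ∈ K.faces}
  isRelLowerSet_faces := by
    rintro s ⟨hs, hv, hK⟩
    refine ⟨hs, fun t hts ht => ⟨ht, fun h => hv (hts h), ?_⟩⟩
    exact (K.isRelLowerSet_faces hK).2 (Finset.insert_subset_insert v hts)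
      (Finset.insert_nonempty v t)

/-- A triangulated circle: a nonempty connected graph (no faces of dimension at least `2`) in which
every vertex has exactly two neighbours. -/
structure IsTriangulatedCircle {V : Type*} [DecidableEq V]
    (L : PreAbstractSimplicialComplex V) : Prop where
  nonempty : ∃ v, {v} ∈ L.faces
  card_le : ∀ s ∈ L.faces, s.card ≤ 2
  degree : ∀ v, {v} ∈ L.faces → {w | w ≠ v ∧ ({v, w} : Finset V) ∈ L.faces}.ncard = 2
  connected : ∀ v w, {v} ∈ L.faces → {w} ∈ L.faces →
    Relation.ReflTransGen (fun a b => ({a, b} : Finset V) ∈ L.faces) v w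

/-- A triangulated closed surface: the link of every vertex is a circle.  (Surfaces are not
required to be connected.) -/
def IsTriangulatedSurface {V : Type*} [DecidableEq V] (K : AbstractSimplicialComplex V) : Prop :=
  ∀ v, IsTriangulatedCircle (vertexLink K v)

/-! ### Product and twisted product triangulations -/

/-- The product triangulation of two complexes with totally ordered vertex sets: each product
`Δ × Δ'` of faces receives its staircase triangulation, whose faces are the sets of vertices
contained in a monotone lattice path, i.e. the chains of the product order. -/
def productComplex {V W : Type*} [LinearOrder V] [LinearOrder W]
    (K : AbstractSimplicialComplex V) (L : AbstractSimplicialComplex W) :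
    AbstractSimplicialComplex (V × W) where
  faces := {s | s.Nonempty ∧ IsChain (· ≤ ·) (s : Set (V × W)) ∧
    s.image Prod.fst ∈ K.faces ∧ s.image Prod.snd ∈ L.faces}
  isRelLowerSet_faces := by
    rintro s ⟨hs, hc, h1, h2⟩
    refine ⟨hs, fun t hts ht => ⟨ht, hc.mono (by exact_mod_cast hts), ?_, ?_⟩⟩
    · exact (K.isRelLowerSet_faces h1).2 (Finset.image_subset_image hts) (ht.image _)
    · exact (L.isRelLowerSet_faces h2).2 (Finset.image_subset_image hts) (ht.image _)
  singleton_mem := by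
    rintro ⟨v, w⟩
    exact ⟨Finset.singleton_nonempty _, by simp, by simpa using K.singleton_mem v,
      by simpa using L.singleton_mem w⟩

/-- The interval, triangulated as the path with the four vertices `0, 1, 2, 3`. -/
def intervalComplex : AbstractSimplicialComplex (Fin 4) where
  faces := {s | s.Nonempty ∧ ∃ i : Fin 3, s ⊆ {i.castSucc, i.succ}}
  isRelLowerSet_faces := by
    rintro s ⟨hs, i, hi⟩
    exact ⟨hs, fun t hts ht => ⟨ht, i, hts.trans hi⟩⟩
  singleton_mem := by
    intro v
    refine ⟨Finset.singleton_nonempty _, ?_⟩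
    fin_cases v
    · exact ⟨0, by decide⟩
    · exact ⟨1, by decide⟩
    · exact ⟨2, by decide⟩
    · exact ⟨2, by decide⟩

/-- The vertex identification `(v, 3) ∼ (φ v, 0)`. -/
def gluingMap {V : Type*} (φ : Equiv.Perm V) (p : V × Fin 4) : V × Fin 3 :=
  if h : p.2.val < 3 then (p.1, ⟨p.2.val, h⟩) else (φ p.1, 0)

/-- The twisted product triangulation of `K` over the circle with gluing automorphism `φ`: the
product triangulation of `K × I`, `I` being an interval with four vertices, whose two boundary
copies of `K` are glued by `φ`. -/
def twistedProduct {V : Type*} [LinearOrder V] (K : AbstractSimplicialComplex V)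
    (φ : complexAut K) : AbstractSimplicialComplex (V × Fin 3) :=
  PreAbstractSimplicialComplex.toAbstractSimplicialComplex (V × Fin 3)
    ((productComplex K intervalComplex).toPreAbstractSimplicialComplex.map
      (gluingMap (φ : Equiv.Perm V)))
    (by
      rintro ⟨v, i⟩
      refine ⟨{(v, i.castSucc)}, (productComplex K intervalComplex).singleton_mem _, ?_⟩
      simp [gluingMap])

/-- The `8`-vertex Klein bottle `²8₂₀`, on the vertices `0, …, 7` in place of `1, …, 8`. -/
def kleinBottle8 : AbstractSimplicialComplex (Fin 8) where
  faces := {s | s.Nonempty ∧ ∃ t ∈ ({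
    {0, 1, 2}, {0, 1, 3}, {0, 2, 4}, {0, 3, 5}, {0, 4, 6}, {0, 5, 7}, {0, 6, 7}, {1, 2, 5},
    {1, 3, 4}, {1, 4, 7}, {1, 5, 6}, {1, 6, 7}, {2, 3, 4}, {2, 3, 5}, {4, 5, 6}, {4, 5, 7}} :
      Finset (Finset (Fin 8))), s ⊆ t}
  isRelLowerSet_faces := by
    rintro s ⟨hs, u, hu, hsu⟩
    exact ⟨hs, fun t hts ht => ⟨ht, u, hu, hts.trans hsu⟩⟩
  singleton_mem := by
    intro v
    refine ⟨Finset.singleton_nonempty _, ?_⟩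
    revert v
    decide

/-! ### Flat manifolds as quotients of Euclidean space -/

/-- The isometry `x ↦ (s₀ x₀ + t₀, s₁ x₁ + t₁, …)` of Euclidean space, where all `sᵢ = ± 1`. -/
noncomputable def signedMotion {n : ℕ} (s : Fin n → ℤˣ) (t : Fin n → ℝ) :
    EuclideanSpace ℝ (Fin n) ≃ᵢ EuclideanSpace ℝ (Fin n) where
  toFun x := WithLp.toLp 2 fun i => ((s i : ℤ) : ℝ) * x i + t i
  invFun x := WithLp.toLp 2 fun i => ((s i : ℤ) : ℝ) * (x i - t i)
  left_inv x := by
    ext i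
    rcases Int.units_eq_one_or (s i) with h | h <;> simp [h]
  right_inv x := by
    ext i
    rcases Int.units_eq_one_or (s i) with h | h <;> simp [h]
  isometry_toFun := by
    refine Isometry.of_dist_eq fun x y => ?_
    rw [EuclideanSpace.dist_eq, EuclideanSpace.dist_eq]
    congr 1
    refine Finset.sum_congr rfl fun i _ => ?_
    rcases Int.units_eq_one_or (s i) with h | h <;> simp [h, Real.dist_eq]

/-- Two points are equivalent if they lie in the same orbit of the group `Γ` of isometries. -/
def isometryOrbitRel {n : ℕ}
    (Γ : Subgroup (EuclideanSpace ℝ (Fin n) ≃ᵢ EuclideanSpace ℝ (Fin n))) :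
    Setoid (EuclideanSpace ℝ (Fin n)) where
  r x y := ∃ g ∈ Γ, g x = y
  iseqv :=
    { refl := fun _ => ⟨1, Γ.one_mem, rfl⟩
      symm := by
        rintro x y ⟨g, hg, rfl⟩
        exact ⟨g⁻¹, Γ.inv_mem hg, g.symm_apply_apply x⟩
      trans := by
        rintro x y z ⟨g, hg, rfl⟩ ⟨h, hh, rfl⟩
        exact ⟨h * g, Γ.mul_mem hh hg, rfl⟩ }

/-- The orbit space `ℝⁿ / Γ` with the quotient topology. -/
abbrev FlatQuotient {n : ℕ}
    (Γ : Subgroup (EuclideanSpace ℝ (Fin n) ≃ᵢ EuclideanSpace ℝ (Fin n))) : Type :=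
  Quotient (isometryOrbitRel Γ)

/-- The Klein bottle: the plane modulo the group generated by the glide reflection
`(x, y) ↦ (x + 1, -y)` and the translation `(x, y) ↦ (x, y + 1)`. -/
abbrev KleinBottle : Type :=
  FlatQuotient (n := 2) (Subgroup.closure
    {signedMotion ![1, -1] ![1, 0], signedMotion ![1, 1] ![0, 1]})

/-- The fundamental groups of the four closed non-orientable flat `3`-manifolds
`𝓑₁, 𝓑₂, 𝓑₃, 𝓑₄` (in the standard numbering), as groups of motions of Euclidean space. -/
noncomputable def bieberbachGroup :
    Fin 4 → Subgroup (EuclideanSpace ℝ (Fin 3) ≃ᵢ EuclideanSpace ℝ (Fin 3)) :=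
  ![Subgroup.closure
      {signedMotion ![1, 1, -1] ![1 / 2, 0, 0], signedMotion ![1, 1, 1] ![0, 1, 0],
        signedMotion ![1, 1, 1] ![0, 0, 1]},
    Subgroup.closure
      {signedMotion ![1, 1, -1] ![1 / 2, 0, 0], signedMotion ![1, 1, 1] ![0, 1, 0],
        signedMotion ![1, 1, 1] ![1 / 2, 1 / 2, 1]},
    Subgroup.closure
      {signedMotion ![1, -1, -1] ![1 / 2, 0, 0], signedMotion ![1, 1, -1] ![0, 1 / 2, 0],
        signedMotion ![1, 1, 1] ![0, 0, 1]},
    Subgroup.closure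
      {signedMotion ![1, -1, -1] ![1 / 2, 0, 0], signedMotion ![1, 1, -1] ![0, 1 / 2, 1 / 2],
        signedMotion ![1, 1, 1] ![0, 0, 1]}]

/-- The four closed non-orientable flat `3`-manifolds `𝓑₁, 𝓑₂, 𝓑₃, 𝓑₄`, indexed by
`0, 1, 2, 3`. -/
abbrev FlatB (i : Fin 4) : Type :=
  FlatQuotient (bieberbachGroup i)

/-! ### Signed motions -/

/-! Lower bounds. All target spaces are quotients of a Euclidean space `E` by a group `Γ` of
isometries acting freely and discretely. A triangulation of `E / Γ` then carries an edge labelling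
with values in `Γ`: the covering has a section over every open star, and on a connected overlap two
sections differ by one constant element. This is a cocycle, and connectedness of `E` forces its
values to generate `Γ` in every gauge (`exists_isFullCocycle`). It replaces the surjection from the
fundamental group of the complex onto `Γ`; no fundamental group is computed.

For a surface with at most seven vertices, `3F = 2E` and `E ≤ V(V-1)/2` give Euler characteristic at
least 1, unless there are seven vertices and all 21 edges. In the first case a spanning tree and a
dual cotree miss at most one edge, so every cocycle can be gauged into a cyclic group
(`exists_reduced_zpowers`). In the second case the surface is Möbius' torus
(`exists_torusLabelling`) and the values can be gauged into a group generated by two commuting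
elements. Both groups are commutative while the Klein bottle group is not, so the Klein bottle needs
eight vertices.

For the 3-manifolds, a full cocycle on a (twisted) product is squeezed into a cocycle on the base
together with elements `t v` intertwining it with its pullback under `φ` (`IsHolonomy`). For a base
with at most seven vertices, `Γ` is generated by a commutative subgroup `N` and one element `t` with
`t⁻¹ N t ⊆ N` (`exists_extension`). All linear parts in `Γ` are diagonal with entries `±1`. Let `T
g` be the translation part of `g²`: it is additive on commuting elements, conjugation acts on it by
signs, and `T N` together with `T t` must span three-space (`det_ne_zero`). A cyclic `N` is
therefore too small. On the torus `φ` acts on labels by `i ↦ α i + β` over `ℤ/7`, and the linear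
part of `t` carries the sum `ω d` of `T` over all edges of slope `d` to `ω (α d)`. Signs square to
one, so `ω d = ω (α² d)`. If `α ≠ ±1`, this makes `ω 1` and `ω 2` dependent, against the spanning
property. If `α = ±1`, then `t` acts on their span as a scalar `±1`, and every element of `Γ`
preserves orientation (`not_scalar`), which is false. So the base has at least eight vertices, the
circle at least three, and 24 follows.

Existence. A labelling of `ℤ²`, with one diagonal chosen in each unit square, is invariant under the
Klein bottle group. The resulting map from the plane to the realization of `²8₂₀` has exactly the
orbits as fibres (`planeCoord_eq_iff`), by a finite check on sixteen triangles. The translation by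
`(1/2, 1/2)` and the reflection `x ↦ -x` of the plane induce automorphisms. The twisted product is
the mapping torus of its gluing automorphism (`bundleCoord_eq_iff`), and in suitable coordinates
each flat manifold is a mapping torus of the Klein bottle, with monodromy the identity, the
translation, the reflection or their composite. A comparison of two quotients of one compact space
gives the homeomorphisms. -/

theorem signedMotion_apply {n : ℕ} (s : Fin n → ℤˣ) (t : Fin n → ℝ)
    (x : EuclideanSpace ℝ (Fin n)) (i : Fin n) :
    signedMotion s t x i = ((s i : ℤ) : ℝ) * x i + t i := rfl

theorem signedMotion_mul {n : ℕ} (s s' : Fin n → ℤˣ) (t t' : Fin n → ℝ) :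
    signedMotion s t * signedMotion s' t' =
      signedMotion (s * s') (fun i => ((s i : ℤ) : ℝ) * t' i + t i) := by
  refine IsometryEquiv.ext fun x => ?_
  ext i
  change signedMotion s t (signedMotion s' t' x) i = _
  simp only [signedMotion_apply, Pi.mul_apply, Units.val_mul, Int.cast_mul]
  ring

theorem signedMotion_one {n : ℕ} : signedMotion (1 : Fin n → ℤˣ) 0 = 1 := by
  refine IsometryEquiv.ext fun x => ?_
  ext i
  simp [signedMotion_apply]

theorem units_cast_mul_self (u : ℤˣ) : ((u : ℤ) : ℝ) * ((u : ℤ) : ℝ) = 1 := by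
  rcases Int.units_eq_one_or u with h | h <;> simp [h]

theorem signedMotion_inv {n : ℕ} (s : Fin n → ℤˣ) (t : Fin n → ℝ) :
    (signedMotion s t)⁻¹ = signedMotion s (fun i => -((s i : ℤ) : ℝ) * t i) := by
  rw [inv_eq_iff_mul_eq_one, signedMotion_mul, ← signedMotion_one]
  congr 1
  · ext i
    simp
  · ext i
    have := units_cast_mul_self (s i)
    simp only [Pi.zero_apply]
    linear_combination (-t i) * this

theorem signedMotion_inj {n : ℕ} {s s' : Fin n → ℤˣ} {t t' : Fin n → ℝ}
    (h : signedMotion s t = signedMotion s' t') : s = s' ∧ t = t' := by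
  have ht : t = t' := by
    ext i
    have := congrArg (fun g => g (0 : EuclideanSpace ℝ (Fin n)) i) h
    simpa [signedMotion_apply] using this
  refine ⟨?_, ht⟩
  ext i
  have := congrArg (fun g => g (WithLp.toLp 2 (fun _ => (1 : ℝ))) i) h
  simp only [signedMotion_apply, ht] at this
  have h2 : ((s i : ℤ) : ℝ) = ((s' i : ℤ) : ℝ) := by linarith
  exact_mod_cast h2

/-! ### Free discrete groups of isometries -/

/-- Every nontrivial element moves each point by at least `1 / 2` in some fixed coordinate. -/
def HasDisplacement {n : ℕ}
    (Γ : Subgroup (EuclideanSpace ℝ (Fin n) ≃ᵢ EuclideanSpace ℝ (Fin n))) : Prop :=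
  ∀ g ∈ Γ, g = 1 ∨ ∃ i, ∀ x, 1 / 2 ≤ |g x i - x i|

theorem HasDisplacement.eq_one {n : ℕ}
    {Γ : Subgroup (EuclideanSpace ℝ (Fin n) ≃ᵢ EuclideanSpace ℝ (Fin n))}
    (h : HasDisplacement Γ) {g : EuclideanSpace ℝ (Fin n) ≃ᵢ EuclideanSpace ℝ (Fin n)}
    (hg : g ∈ Γ) {x : EuclideanSpace ℝ (Fin n)} (hx : dist (g x) x < 1 / 2) : g = 1 := by
  rcases h g hg with h | ⟨i, hi⟩
  · exact h
  · have h1 := hi x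
    have h2 : ‖(g x - x) i‖ ≤ ‖g x - x‖ := PiLp.norm_apply_le _ _
    rw [← dist_eq_norm] at h2
    simp only [PiLp.sub_apply, Real.norm_eq_abs] at h2
    linarith

noncomputable instance isometrySubgroupAction {n : ℕ}
    (Γ : Subgroup (EuclideanSpace ℝ (Fin n) ≃ᵢ EuclideanSpace ℝ (Fin n))) :
    MulAction Γ (EuclideanSpace ℝ (Fin n)) where
  smul g x := g.1 x
  one_smul _ := rfl
  mul_smul _ _ _ := rfl

/-- The projection to the orbit space. -/
def orbitMk {n : ℕ} (Γ : Subgroup (EuclideanSpace ℝ (Fin n) ≃ᵢ EuclideanSpace ℝ (Fin n))) :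
    EuclideanSpace ℝ (Fin n) → FlatQuotient Γ := Quotient.mk (isometryOrbitRel Γ)

theorem orbitMk_eq_iff {n : ℕ}
    {Γ : Subgroup (EuclideanSpace ℝ (Fin n) ≃ᵢ EuclideanSpace ℝ (Fin n))}
    {x y : EuclideanSpace ℝ (Fin n)} : orbitMk Γ x = orbitMk Γ y ↔ ∃ g ∈ Γ, g x = y :=
  Quotient.eq

theorem continuous_orbitMk {n : ℕ}
    (Γ : Subgroup (EuclideanSpace ℝ (Fin n) ≃ᵢ EuclideanSpace ℝ (Fin n))) :
    Continuous (orbitMk Γ) := continuous_quotient_mk'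

/-- A ball of radius `1/8` that meets its translate contains a point moved by less than `1/4`, so
the translating element is trivial. -/
theorem HasDisplacement.isQuotientCoveringMap {n : ℕ}
    {Γ : Subgroup (EuclideanSpace ℝ (Fin n) ≃ᵢ EuclideanSpace ℝ (Fin n))}
    (h : HasDisplacement Γ) : IsQuotientCoveringMap (orbitMk Γ) Γ where
  toIsQuotientMap := isQuotientMap_quot_mk
  continuous_const_smul g := g.1.continuous
  apply_eq_iff_mem_orbit := by
    intro x y
    rw [eq_comm, orbitMk_eq_iff]
    constructor
    · rintro ⟨g, hg, rfl⟩
      exact ⟨⟨g, hg⟩, rfl⟩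
    · rintro ⟨g, rfl⟩
      exact ⟨g.1, g.2, rfl⟩
  disjoint e := by
    refine ⟨Metric.ball e (1 / 8), Metric.ball_mem_nhds _ (by norm_num), ?_⟩
    rintro g ⟨_, ⟨x, hx, rfl⟩, hy⟩
    refine Subtype.ext (h.eq_one g.2 (x := x) ?_)
    rw [Metric.mem_ball] at hx hy
    calc dist (g.1 x) x ≤ dist (g.1 x) e + dist e x := dist_triangle _ _ _
      _ < 1 / 8 + 1 / 8 := by
          rw [dist_comm e x]
          exact add_lt_add hy hx
      _ < 1 / 2 := by norm_num

/-- Two points in different orbits have orbits at positive distance: at most one translate of `x` is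
within `1/8` of `y`, since two such translates would be within `1/2` of each other. If there is one,
its distance to `y` is the minimum. -/
theorem HasDisplacement.t2Space {n : ℕ}
    {Γ : Subgroup (EuclideanSpace ℝ (Fin n) ≃ᵢ EuclideanSpace ℝ (Fin n))}
    (h : HasDisplacement Γ) : T2Space (FlatQuotient Γ) := by
  have hopen : IsOpenMap (orbitMk Γ) := h.isQuotientCoveringMap.isOpenQuotientMap.isOpenMap
  refine ⟨fun X Y hXY => ?_⟩
  obtain ⟨x, rfl⟩ := Quotient.exists_rep X
  obtain ⟨y, rfl⟩ := Quotient.exists_rep Y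
  change orbitMk Γ x ≠ orbitMk Γ y at hXY
  have hne : ∀ g ∈ Γ, g x ≠ y := fun g hg hgx => hXY (orbitMk_eq_iff.2 ⟨g, hg, hgx⟩)
  obtain ⟨δ, hδ, hd⟩ : ∃ δ > 0, ∀ g ∈ Γ, δ ≤ dist (g x) y := by
    by_cases hex : ∃ g ∈ Γ, dist (g x) y < 1 / 8
    · obtain ⟨g, hg, hgx⟩ := hex
      refine ⟨dist (g x) y, dist_pos.2 (hne g hg), fun k hk => ?_⟩
      by_contra hlt
      push Not at hlt
      have : g⁻¹ * k = 1 := by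
        refine h.eq_one (Γ.mul_mem (Γ.inv_mem hg) hk) (x := x) ?_
        have h1 : dist ((g⁻¹ * k) x) x = dist (k x) (g x) := by
          rw [← g.isometry.dist_eq]
          congr 1
          exact g.apply_symm_apply (k x)
        rw [h1]
        calc dist (k x) (g x) ≤ dist (k x) y + dist (g x) y := dist_triangle_right _ _ _
          _ < 1 / 2 := by linarith
      have : k = g := by
        rw [inv_mul_eq_one] at this
        exact this.symm
      rw [this] at hlt
      exact lt_irrefl _ hlt
    · push Not at hex
      exact ⟨1 / 8, by norm_num, hex⟩
  refine ⟨orbitMk Γ '' Metric.ball x (δ / 2), orbitMk Γ '' Metric.ball y (δ / 2),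
    hopen _ Metric.isOpen_ball, hopen _ Metric.isOpen_ball,
    ⟨x, Metric.mem_ball_self (by positivity), rfl⟩,
    ⟨y, Metric.mem_ball_self (by positivity), rfl⟩, ?_⟩
  rw [Set.disjoint_left]
  rintro _ ⟨a, ha, rfl⟩ ⟨b, hb, hab⟩
  obtain ⟨g, hg, hgb⟩ := orbitMk_eq_iff.1 hab.symm
  have := hd g hg
  rw [Metric.mem_ball] at ha hb
  have h1 : dist (g x) y ≤ dist (g x) (g a) + dist (g a) y := dist_triangle _ _ _
  rw [g.isometry.dist_eq, hgb, dist_comm x a] at h1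
  linarith

/-! ### Normal forms -/

/-- The sign `(-1) ^ m`. -/
def sgn (m : ℤ) : ℤˣ := m.negOnePow

theorem sgn_add (m n : ℤ) : sgn (m + n) = sgn m * sgn n := Int.negOnePow_add m n

theorem sgn_neg (m : ℤ) : sgn (-m) = sgn m := Int.negOnePow_neg m

theorem sgn_zero : sgn 0 = 1 := Int.negOnePow_zero

theorem sgn_one : sgn 1 = -1 := Int.negOnePow_one

theorem sgn_of_even {m : ℤ} (h : Even m) : sgn m = 1 := Int.negOnePow_even m h

theorem sgn_congr {m n : ℤ} (h : m % 2 = n % 2) : sgn m = sgn n := by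
  have : m = n + (m - n) := by ring
  rw [this, sgn_add, sgn_of_even (m := m - n) (by rw [Int.even_iff]; omega), mul_one]

/-- Signs do not affect parities. This keeps the congruences between parameters stable under
products and inverses of normal forms. -/
theorem sgn_mod_two (m k : ℤ) : ((sgn m : ℤ) * k) % 2 = k % 2 := by
  rcases Int.units_eq_one_or (sgn m) with h | h <;> rw [h] <;> simp

/-- A subgroup is described by a normal form as soon as the normal forms contain `1`, are closed
under products and inverses, and lie in the subgroup. -/
theorem mem_closure_iff_normalForm {G : Type*} [Group G] {S : Set G} {P : G → Prop}
    (hS : ∀ g ∈ S, P g) (h1 : P 1) (hm : ∀ g h, P g → P h → P (g * h))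
    (hi : ∀ g, P g → P g⁻¹) (hP : ∀ g, P g → g ∈ Subgroup.closure S) (g : G) :
    g ∈ Subgroup.closure S ↔ P g :=
  ⟨fun h => Subgroup.closure_induction (p := fun x _ => P x) hS h1
    (fun x y _ _ hx hy => hm x y hx hy) (fun x _ hx => hi x hx) h, hP g⟩

theorem signedMotion_mul_two (a b a' b' : ℤˣ) (x y x' y' : ℝ) :
    signedMotion ![a, b] ![x, y] * signedMotion ![a', b'] ![x', y'] =
      signedMotion ![a * a', b * b'] ![((a : ℤ) : ℝ) * x' + x, ((b : ℤ) : ℝ) * y' + y] := by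
  rw [signedMotion_mul]
  congr 1 <;> ext i <;> fin_cases i <;> simp

theorem signedMotion_mul_three (a b c a' b' c' : ℤˣ) (x y z x' y' z' : ℝ) :
    signedMotion ![a, b, c] ![x, y, z] * signedMotion ![a', b', c'] ![x', y', z'] =
      signedMotion ![a * a', b * b', c * c']
        ![((a : ℤ) : ℝ) * x' + x, ((b : ℤ) : ℝ) * y' + y, ((c : ℤ) : ℝ) * z' + z] := by
  rw [signedMotion_mul]
  congr 1 <;> ext i <;> fin_cases i <;> simp

theorem signedMotion_inv_two (a b : ℤˣ) (x y : ℝ) :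
    (signedMotion ![a, b] ![x, y])⁻¹ =
      signedMotion ![a, b] ![-((a : ℤ) : ℝ) * x, -((b : ℤ) : ℝ) * y] := by
  rw [signedMotion_inv]
  congr 1
  ext i
  fin_cases i <;> simp

theorem signedMotion_inv_three (a b c : ℤˣ) (x y z : ℝ) :
    (signedMotion ![a, b, c] ![x, y, z])⁻¹ =
      signedMotion ![a, b, c]
        ![-((a : ℤ) : ℝ) * x, -((b : ℤ) : ℝ) * y, -((c : ℤ) : ℝ) * z] := by
  rw [signedMotion_inv]
  congr 1
  ext i
  fin_cases i <;> simp

theorem signedMotion_one_two : signedMotion ![1, 1] ![0, 0] = 1 := by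
  rw [← signedMotion_one]
  congr 1 <;> ext i <;> fin_cases i <;> rfl

theorem signedMotion_one_three : signedMotion ![1, 1, 1] ![0, 0, 0] = 1 := by
  rw [← signedMotion_one]
  congr 1 <;> ext i <;> fin_cases i <;> rfl

/-- Normal forms are factored into one-parameter families, and each family is the set of powers of
one group element. -/
theorem mem_of_int_hom {G : Type*} [Group G] (H : Subgroup G) (f : ℤ → G)
    (hf : ∀ a b, f (a + b) = f a * f b) (h1 : f 1 ∈ H) (m : ℤ) : f m ∈ H := by
  have h0 : f 0 = 1 := by
    have := hf 0 0
    simpa using this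
  let F : Multiplicative ℤ →* G :=
    { toFun := fun a => f a.toAdd
      map_one' := h0
      map_mul' := fun a b => hf _ _ }
  have : f m = f 1 ^ m := by
    have h2 := map_zpow F (Multiplicative.ofAdd 1) m
    rw [← ofAdd_zsmul] at h2
    simpa [F] using h2
  rw [this]
  exact H.zpow_mem h1 m

/-- The group of the Klein bottle. -/
noncomputable abbrev kleinGroup : Subgroup (EuclideanSpace ℝ (Fin 2) ≃ᵢ EuclideanSpace ℝ (Fin 2)) :=
  Subgroup.closure {signedMotion ![1, -1] ![1, 0], signedMotion ![1, 1] ![0, 1]}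

/-- The normal form of an element of the Klein bottle group. -/
noncomputable def kleinForm (m n : ℤ) : EuclideanSpace ℝ (Fin 2) ≃ᵢ EuclideanSpace ℝ (Fin 2) :=
  signedMotion ![1, sgn m] ![m, n]

theorem kleinForm_mul (m n m' n' : ℤ) :
    kleinForm m n * kleinForm m' n' = kleinForm (m + m') (n + sgn m * n') := by
  rw [kleinForm, kleinForm, kleinForm, signedMotion_mul_two, sgn_add]
  push_cast
  simp [add_comm]

theorem mem_kleinGroup_iff (g) : g ∈ kleinGroup ↔ ∃ m n, g = kleinForm m n := by
  refine mem_closure_iff_normalForm (P := fun g => ∃ m n, g = kleinForm m n)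
    ?_ ?_ ?_ ?_ ?_ g
  · rintro g (rfl | rfl)
    · exact ⟨1, 0, by simp [kleinForm, sgn_one]⟩
    · exact ⟨0, 1, by simp [kleinForm, sgn_zero]⟩
  · exact ⟨0, 0, by simp [kleinForm, sgn_zero, signedMotion_one_two]⟩
  · rintro _ _ ⟨m, n, rfl⟩ ⟨m', n', rfl⟩
    exact ⟨_, _, kleinForm_mul m n m' n'⟩
  · rintro _ ⟨m, n, rfl⟩
    refine ⟨-m, -(sgn m * n), ?_⟩
    rw [kleinForm, signedMotion_inv_two, kleinForm, sgn_neg]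
    simp
  · rintro _ ⟨m, n, rfl⟩
    have h : kleinForm m n = kleinForm 0 n * kleinForm m 0 := by
      rw [kleinForm_mul]
      simp
    rw [h]
    refine mul_mem (mem_of_int_hom _ (fun n => kleinForm 0 n) ?_ ?_ n)
      (mem_of_int_hom _ (fun m => kleinForm m 0) ?_ ?_ m)
    · intro a b
      simp [kleinForm_mul, sgn_zero]
    · exact Subgroup.subset_closure (by simp [kleinForm, sgn_zero])
    · intro a b
      simp [kleinForm_mul]
    · exact Subgroup.subset_closure (by simp [kleinForm, sgn_one])

theorem int_cast_abs_ge {m : ℤ} (h : m ≠ 0) : (1 : ℝ) ≤ |(m : ℝ)| := by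
  exact_mod_cast Int.one_le_abs h

theorem int_half_abs_ge {m : ℤ} (h : m ≠ 0) : (1 / 2 : ℝ) ≤ |(m : ℝ) / 2| := by
  have := int_cast_abs_ge h
  rw [abs_div, abs_two]
  linarith

theorem signedMotion_displacement {n : ℕ} {s : Fin n → ℤˣ} {t : Fin n → ℝ} {i : Fin n}
    (hs : s i = 1) (ht : 1 / 2 ≤ |t i|) (x : EuclideanSpace ℝ (Fin n)) :
    1 / 2 ≤ |signedMotion s t x i - x i| := by
  rw [signedMotion_apply, hs]
  simpa using ht

theorem hasDisplacement_kleinGroup : HasDisplacement kleinGroup := by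
  intro g hg
  obtain ⟨m, n, rfl⟩ := (mem_kleinGroup_iff g).1 hg
  by_cases hm : m = 0
  · subst hm
    by_cases hn : n = 0
    · subst hn
      left
      simp [kleinForm, sgn_zero, signedMotion_one_two]
    · right
      refine ⟨1, signedMotion_displacement ?_ ?_⟩
      · simp [sgn_zero]
      · have := int_cast_abs_ge hn
        simp only [Matrix.cons_val_one, Matrix.cons_val_zero]
        linarith
  · right
    refine ⟨0, signedMotion_displacement ?_ ?_⟩
    · simp
    · have := int_cast_abs_ge hm
      simp only [Matrix.cons_val_zero]
      linarith

/-- Normal forms of the elements of the group of `𝓑₁`. -/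
noncomputable def form₁ (m n k : ℤ) : EuclideanSpace ℝ (Fin 3) ≃ᵢ EuclideanSpace ℝ (Fin 3) :=
  signedMotion ![1, 1, sgn m] ![m / 2, n, k]

/-- Normal forms of the elements of the group of `𝓑₂`, where `n ≡ k` modulo `2`. -/
noncomputable def form₂ (m n k : ℤ) : EuclideanSpace ℝ (Fin 3) ≃ᵢ EuclideanSpace ℝ (Fin 3) :=
  signedMotion ![1, 1, sgn (m + k)] ![m / 2, n / 2, k]

/-- Normal forms of the elements of the group of `𝓑₃`. -/
noncomputable def form₃ (m n k : ℤ) : EuclideanSpace ℝ (Fin 3) ≃ᵢ EuclideanSpace ℝ (Fin 3) :=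
  signedMotion ![1, sgn m, sgn (m + n)] ![m / 2, n / 2, k]

/-- Normal forms of the elements of the group of `𝓑₄`, where `n ≡ k` modulo `2`. -/
noncomputable def form₄ (m n k : ℤ) : EuclideanSpace ℝ (Fin 3) ≃ᵢ EuclideanSpace ℝ (Fin 3) :=
  signedMotion ![1, sgn m, sgn (m + n)] ![m / 2, n / 2, k / 2]

theorem form₁_mul (m n k m' n' k' : ℤ) :
    form₁ m n k * form₁ m' n' k' = form₁ (m + m') (n + n') (k + sgn m * k') := by
  rw [form₁, form₁, form₁, signedMotion_mul_three, sgn_add]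
  push_cast
  simp [add_comm, add_div]

theorem form₂_mul (m n k m' n' k' : ℤ) :
    form₂ m n k * form₂ m' n' k' = form₂ (m + m') (n + n') (k + sgn (m + k) * k') := by
  rw [form₂, form₂, form₂, signedMotion_mul_three, ← sgn_add,
    sgn_congr (m := m + k + (m' + k')) (n := m + m' + (k + sgn (m + k) * k'))]
  · push_cast
    simp [add_comm, add_div]
  · have := sgn_mod_two (m + k) k'
    omega

theorem form₃_mul (m n k m' n' k' : ℤ) :
    form₃ m n k * form₃ m' n' k' =
      form₃ (m + m') (n + sgn m * n') (k + sgn (m + n) * k') := by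
  rw [form₃, form₃, form₃, signedMotion_mul_three, ← sgn_add, ← sgn_add,
    sgn_congr (m := m + n + (m' + n')) (n := m + m' + (n + sgn m * n'))]
  · push_cast
    simp [add_comm, add_div, mul_div_assoc]
  · have := sgn_mod_two m n'
    omega

theorem form₄_mul (m n k m' n' k' : ℤ) :
    form₄ m n k * form₄ m' n' k' =
      form₄ (m + m') (n + sgn m * n') (k + sgn (m + n) * k') := by
  rw [form₄, form₄, form₄, signedMotion_mul_three, ← sgn_add, ← sgn_add,
    sgn_congr (m := m + n + (m' + n')) (n := m + m' + (n + sgn m * n'))]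
  · push_cast
    simp [add_comm, add_div, mul_div_assoc]
  · have := sgn_mod_two m n'
    omega

theorem mem_bieberbachGroup_zero_iff (g) :
    g ∈ bieberbachGroup 0 ↔ ∃ m n k, g = form₁ m n k := by
  change g ∈ Subgroup.closure _ ↔ _
  refine mem_closure_iff_normalForm (P := fun g => ∃ m n k, g = form₁ m n k)
    ?_ ?_ ?_ ?_ ?_ g
  · rintro g (rfl | rfl | rfl)
    · exact ⟨1, 0, 0, by simp [form₁, sgn_one]⟩
    · exact ⟨0, 1, 0, by simp [form₁, sgn_zero]⟩
    · exact ⟨0, 0, 1, by simp [form₁, sgn_zero]⟩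
  · exact ⟨0, 0, 0, by simp [form₁, sgn_zero, signedMotion_one_three]⟩
  · rintro _ _ ⟨m, n, k, rfl⟩ ⟨m', n', k', rfl⟩
    exact ⟨_, _, _, form₁_mul m n k m' n' k'⟩
  · rintro _ ⟨m, n, k, rfl⟩
    refine ⟨-m, -n, -(sgn m * k), ?_⟩
    rw [form₁, signedMotion_inv_three, form₁, sgn_neg]
    simp [neg_div]
  · rintro _ ⟨m, n, k, rfl⟩
    have h : form₁ m n k = form₁ 0 0 k * form₁ 0 n 0 * form₁ m 0 0 := by
      simp [form₁_mul]
    rw [h]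
    refine mul_mem (mul_mem (mem_of_int_hom _ (fun k => form₁ 0 0 k) ?_ ?_ k)
      (mem_of_int_hom _ (fun n => form₁ 0 n 0) ?_ ?_ n))
      (mem_of_int_hom _ (fun m => form₁ m 0 0) ?_ ?_ m)
    · intro a b
      simp [form₁_mul, sgn_zero]
    · exact Subgroup.subset_closure (by simp [form₁, sgn_zero])
    · intro a b
      simp [form₁_mul]
    · exact Subgroup.subset_closure (by simp [form₁, sgn_zero])
    · intro a b
      simp [form₁_mul]
    · exact Subgroup.subset_closure (by simp [form₁, sgn_one])

theorem mem_bieberbachGroup_one_iff (g) :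
    g ∈ bieberbachGroup 1 ↔ ∃ m n k, n % 2 = k % 2 ∧ g = form₂ m n k := by
  change g ∈ Subgroup.closure _ ↔ _
  refine mem_closure_iff_normalForm (P := fun g => ∃ m n k, n % 2 = k % 2 ∧ g = form₂ m n k)
    ?_ ?_ ?_ ?_ ?_ g
  · rintro g (rfl | rfl | rfl)
    · exact ⟨1, 0, 0, rfl, by simp [form₂, sgn_one]⟩
    · exact ⟨0, 2, 0, rfl, by simp [form₂, sgn_zero]⟩
    · exact ⟨1, 1, 1, rfl, by simp [form₂, sgn_of_even even_two]⟩
  · exact ⟨0, 0, 0, rfl, by simp [form₂, sgn_zero, signedMotion_one_three]⟩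
  · rintro _ _ ⟨m, n, k, h, rfl⟩ ⟨m', n', k', h', rfl⟩
    refine ⟨_, _, _, ?_, form₂_mul m n k m' n' k'⟩
    have := sgn_mod_two (m + k) k'
    omega
  · rintro _ ⟨m, n, k, h, rfl⟩
    refine ⟨-m, -n, -(sgn (m + k) * k), ?_, ?_⟩
    · have := sgn_mod_two (m + k) k
      omega
    · rw [form₂, signedMotion_inv_three, form₂,
        sgn_congr (m := -m + -(sgn (m + k) * k)) (n := m + k)]
      · simp [neg_div]
      · have := sgn_mod_two (m + k) k
        omega
  · rintro _ ⟨m, n, k, h, rfl⟩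
    -- The factors are powers of the three generators: the middle one has sign `sgn (2 k) = 1`, so
    -- it is the `k`-th power of the oblique translation, and `n ≡ k` modulo 2 leaves an integral
    -- translation in the second coordinate.
    have h : form₂ m n k = form₂ 0 (2 * ((n - k) / 2)) 0 * form₂ k k k * form₂ (m - k) 0 0 := by
      have : 2 * ((n - k) / 2) + k = n := by omega
      simp [form₂_mul, sgn_zero, this]
    rw [h]
    refine mul_mem (mul_mem (mem_of_int_hom _ (fun n => form₂ 0 (2 * n) 0) ?_ ?_ _)
      (mem_of_int_hom _ (fun k => form₂ k k k) ?_ ?_ k))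
      (mem_of_int_hom _ (fun m => form₂ m 0 0) ?_ ?_ (m - k))
    · intro a b
      simp [form₂_mul, mul_add]
    · exact Subgroup.subset_closure (by simp [form₂, sgn_zero])
    · intro a b
      simp [form₂_mul, sgn_of_even (m := a + a) ⟨a, rfl⟩]
    · exact Subgroup.subset_closure (by simp [form₂, sgn_of_even even_two])
    · intro a b
      simp [form₂_mul]
    · exact Subgroup.subset_closure (by simp [form₂, sgn_one])

theorem mem_bieberbachGroup_two_iff (g) :
    g ∈ bieberbachGroup 2 ↔ ∃ m n k, g = form₃ m n k := by
  change g ∈ Subgroup.closure _ ↔ _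
  refine mem_closure_iff_normalForm (P := fun g => ∃ m n k, g = form₃ m n k)
    ?_ ?_ ?_ ?_ ?_ g
  · rintro g (rfl | rfl | rfl)
    · exact ⟨1, 0, 0, by simp [form₃, sgn_one]⟩
    · exact ⟨0, 1, 0, by simp [form₃, sgn_zero, sgn_one]⟩
    · exact ⟨0, 0, 1, by simp [form₃, sgn_zero]⟩
  · exact ⟨0, 0, 0, by simp [form₃, sgn_zero, signedMotion_one_three]⟩
  · rintro _ _ ⟨m, n, k, rfl⟩ ⟨m', n', k', rfl⟩
    exact ⟨_, _, _, form₃_mul m n k m' n' k'⟩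
  · rintro _ ⟨m, n, k, rfl⟩
    refine ⟨-m, -(sgn m * n), -(sgn (m + n) * k), ?_⟩
    rw [form₃, signedMotion_inv_three, form₃, sgn_neg,
      sgn_congr (m := -m + -(sgn m * n)) (n := m + n)]
    · simp [neg_div, mul_div_assoc]
    · have := sgn_mod_two m n
      omega
  · rintro _ ⟨m, n, k, rfl⟩
    have h : form₃ m n k = form₃ 0 0 k * form₃ 0 n 0 * form₃ m 0 0 := by
      simp [form₃_mul, sgn_zero]
    rw [h]
    refine mul_mem (mul_mem (mem_of_int_hom _ (fun k => form₃ 0 0 k) ?_ ?_ k)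
      (mem_of_int_hom _ (fun n => form₃ 0 n 0) ?_ ?_ n))
      (mem_of_int_hom _ (fun m => form₃ m 0 0) ?_ ?_ m)
    · intro a b
      simp [form₃_mul, sgn_zero]
    · exact Subgroup.subset_closure (by simp [form₃, sgn_zero])
    · intro a b
      simp [form₃_mul, sgn_zero]
    · exact Subgroup.subset_closure (by simp [form₃, sgn_zero, sgn_one])
    · intro a b
      simp [form₃_mul]
    · exact Subgroup.subset_closure (by simp [form₃, sgn_one])

theorem mem_bieberbachGroup_three_iff (g) :
    g ∈ bieberbachGroup 3 ↔ ∃ m n k, n % 2 = k % 2 ∧ g = form₄ m n k := by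
  change g ∈ Subgroup.closure _ ↔ _
  refine mem_closure_iff_normalForm (P := fun g => ∃ m n k, n % 2 = k % 2 ∧ g = form₄ m n k)
    ?_ ?_ ?_ ?_ ?_ g
  · rintro g (rfl | rfl | rfl)
    · exact ⟨1, 0, 0, rfl, by simp [form₄, sgn_one]⟩
    · exact ⟨0, 1, 1, rfl, by simp [form₄, sgn_zero, sgn_one]⟩
    · exact ⟨0, 0, 2, rfl, by simp [form₄, sgn_zero]⟩
  · exact ⟨0, 0, 0, rfl, by simp [form₄, sgn_zero, signedMotion_one_three]⟩
  · rintro _ _ ⟨m, n, k, h, rfl⟩ ⟨m', n', k', h', rfl⟩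
    refine ⟨_, _, _, ?_, form₄_mul m n k m' n' k'⟩
    have := sgn_mod_two (m + n) k'
    have := sgn_mod_two m n'
    omega
  · rintro _ ⟨m, n, k, h, rfl⟩
    refine ⟨-m, -(sgn m * n), -(sgn (m + n) * k), ?_, ?_⟩
    · have := sgn_mod_two (m + n) k
      have := sgn_mod_two m n
      omega
    · rw [form₄, signedMotion_inv_three, form₄, sgn_neg,
        sgn_congr (m := -m + -(sgn m * n)) (n := m + n)]
      · simp [neg_div, mul_div_assoc]
      · have := sgn_mod_two m n
        omega
  · rintro _ ⟨m, n, k, h, rfl⟩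
    -- The second generator reflects `z` about `1/4`, so the `z`-part of its `n`-th power alternates
    -- between 0 and one half-unit. This is the residue `n % 2`.
    have h : form₄ m n k =
        form₄ 0 0 (2 * ((k - n % 2) / 2)) * form₄ 0 n (n % 2) * form₄ m 0 0 := by
      have : 2 * ((k - n % 2) / 2) + n % 2 = k := by omega
      simp [form₄_mul, sgn_zero, this]
    rw [h]
    refine mul_mem (mul_mem (mem_of_int_hom _ (fun k => form₄ 0 0 (2 * k)) ?_ ?_ _)
      (mem_of_int_hom _ (fun n => form₄ 0 n (n % 2)) ?_ ?_ n))
      (mem_of_int_hom _ (fun m => form₄ m 0 0) ?_ ?_ m)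
    · intro a b
      simp [form₄_mul, sgn_zero, mul_add]
    · exact Subgroup.subset_closure (by simp [form₄, sgn_zero])
    · intro a b
      have : (a + b) % 2 = a % 2 + sgn a * (b % 2) := by
        rcases Int.even_or_odd a with ha | ha
        · rw [sgn_of_even ha]
          rw [Int.even_iff] at ha
          push_cast
          omega
        · rw [sgn_congr (m := a) (n := 1) (by rw [Int.odd_iff] at ha; omega), sgn_one]
          rw [Int.odd_iff] at ha
          push_cast
          omega
      simp [form₄_mul, sgn_zero, this]
    · exact Subgroup.subset_closure (by simp [form₄, sgn_zero, sgn_one])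
    · intro a b
      simp [form₄_mul]
    · exact Subgroup.subset_closure (by simp [form₄, sgn_one])

/-- The displacement is seen in the coordinate of the first nonzero parameter: the preceding
parameters vanish, and therefore the sign in this coordinate is `+1`. The parity conditions in the
second and fourth group rule out the remaining reflections. -/
theorem hasDisplacement_bieberbachGroup (i : Fin 4) : HasDisplacement (bieberbachGroup i) := by
  intro g hg
  fin_cases i
  · obtain ⟨m, n, k, rfl⟩ := (mem_bieberbachGroup_zero_iff g).1 hg
    by_cases hm : m = 0
    · subst hm
      by_cases hn : n = 0
      · subst hn
        by_cases hk : k = 0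
        · subst hk
          left
          simp [form₁, sgn_zero, signedMotion_one_three]
        · right
          refine ⟨2, signedMotion_displacement (by simp [sgn_zero]) ?_⟩
          simpa using le_trans (by norm_num) (int_cast_abs_ge hk)
      · right
        refine ⟨1, signedMotion_displacement (by simp) ?_⟩
        simpa using le_trans (by norm_num) (int_cast_abs_ge hn)
    · right
      refine ⟨0, signedMotion_displacement (by simp) ?_⟩
      simpa using int_half_abs_ge hm
  · obtain ⟨m, n, k, h, rfl⟩ := (mem_bieberbachGroup_one_iff g).1 hg
    by_cases hm : m = 0
    · subst hm
      by_cases hn : n = 0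
      · subst hn
        by_cases hk : k = 0
        · subst hk
          left
          simp [form₂, sgn_zero, signedMotion_one_three]
        · right
          have : sgn k = 1 := sgn_of_even (by rw [Int.even_iff]; omega)
          refine ⟨2, signedMotion_displacement (by simp [this]) ?_⟩
          simpa using le_trans (by norm_num) (int_cast_abs_ge hk)
      · right
        refine ⟨1, signedMotion_displacement (by simp) ?_⟩
        simpa using int_half_abs_ge hn
    · right
      refine ⟨0, signedMotion_displacement (by simp) ?_⟩
      simpa using int_half_abs_ge hm
  · obtain ⟨m, n, k, rfl⟩ := (mem_bieberbachGroup_two_iff g).1 hg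
    by_cases hm : m = 0
    · subst hm
      by_cases hn : n = 0
      · subst hn
        by_cases hk : k = 0
        · subst hk
          left
          simp [form₃, sgn_zero, signedMotion_one_three]
        · right
          refine ⟨2, signedMotion_displacement (by simp [sgn_zero]) ?_⟩
          simpa using le_trans (by norm_num) (int_cast_abs_ge hk)
      · right
        refine ⟨1, signedMotion_displacement (by simp [sgn_zero]) ?_⟩
        simpa using int_half_abs_ge hn
    · right
      refine ⟨0, signedMotion_displacement (by simp) ?_⟩
      simpa using int_half_abs_ge hm
  · obtain ⟨m, n, k, h, rfl⟩ := (mem_bieberbachGroup_three_iff g).1 hg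
    by_cases hm : m = 0
    · subst hm
      by_cases hn : n = 0
      · subst hn
        by_cases hk : k = 0
        · subst hk
          left
          simp [form₄, sgn_zero, signedMotion_one_three]
        · right
          refine ⟨2, signedMotion_displacement (by simp [sgn_zero]) ?_⟩
          simpa using int_half_abs_ge hk
      · right
        refine ⟨1, signedMotion_displacement (by simp [sgn_zero]) ?_⟩
        simpa using int_half_abs_ge hn
    · right
      refine ⟨0, signedMotion_displacement (by simp) ?_⟩
      simpa using int_half_abs_ge hm

/-! ### Cocycles of a triangulated orbit space -/

/-- A cocycle on a complex: a labelling of the ordered edges that is multiplicative on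
triangles. -/
def IsCocycle {V G : Type*} [DecidableEq V] [Group G] (K : AbstractSimplicialComplex V)
    (c : V → V → G) : Prop :=
  ∀ u v w, ({u, v, w} : Finset V) ∈ K.faces → c u v * c v w = c u w

/-- A cocycle is full if, in every gauge, its values generate the whole group. -/
def IsFullCocycle {V G : Type*} [DecidableEq V] [Group G] (K : AbstractSimplicialComplex V)
    (c : V → V → G) : Prop :=
  IsCocycle K c ∧ ∀ (H : Subgroup G) (a : V → G),
    (∀ u v, ({u, v} : Finset V) ∈ K.faces → (a u)⁻¹ * c u v * a v ∈ H) → H = ⊤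

section Realization

variable {V : Type*} [Fintype V] {K : AbstractSimplicialComplex V}

theorem segment_mem_geomRealization {x y : V → ℝ} (hx : x ∈ geomRealization K)
    (hy : y ∈ geomRealization K) {s : Finset V} (hs : s ∈ K.faces) (hxs : ∀ v, v ∉ s → x v = 0)
    (hys : ∀ v, v ∉ s → y v = 0) (t : unitInterval) :
    (fun v => (1 - (t : ℝ)) * x v + t * y v) ∈ geomRealization K := by
  have h0 := t.2.1
  have h1 : 0 ≤ 1 - (t : ℝ) := sub_nonneg.2 t.2.2
  refine ⟨fun v => add_nonneg (mul_nonneg h1 (hx.1 v)) (mul_nonneg h0 (hy.1 v)), ?_, s, hs,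
    fun v hv => by simp [hxs v hv, hys v hv]⟩
  rw [Finset.sum_add_distrib, ← Finset.mul_sum, ← Finset.mul_sum, hx.2.1, hy.2.1]
  ring

/-- The barycenter of a face. -/
noncomputable def faceCenter {V : Type*} (s : Finset V) : V → ℝ :=
  Set.indicator (s : Set V) (fun _ => ((s.card : ℝ))⁻¹)

theorem faceCenter_of_notMem {V : Type*} {s : Finset V} {v : V} (h : v ∉ s) : faceCenter s v = 0 :=
  Set.indicator_of_notMem (by simpa using h) _

theorem faceCenter_pos {V : Type*} {s : Finset V} {v : V} (h : v ∈ s) : 0 < faceCenter s v := by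
  rw [faceCenter, Set.indicator_of_mem (by simpa using h)]
  have : 0 < s.card := Finset.card_pos.2 ⟨v, h⟩
  positivity

theorem faceCenter_mem {s : Finset V} (hs : s ∈ K.faces) : faceCenter s ∈ geomRealization K := by
  have hne : s.Nonempty := (K.isRelLowerSet_faces hs).1
  refine ⟨fun v => ?_, ?_, s, hs, fun v hv => faceCenter_of_notMem hv⟩
  · by_cases h : v ∈ s
    · exact (faceCenter_pos h).le
    · exact (faceCenter_of_notMem h).ge
  · classical
    simp only [faceCenter, Set.indicator_apply, Finset.mem_coe]
    rw [Finset.sum_ite_mem, Finset.univ_inter, Finset.sum_const, nsmul_eq_mul]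
    exact mul_inv_cancel₀ (by exact_mod_cast (Finset.card_pos.2 hne).ne')

/-- The open star of a vertex in the realization. -/
def openStar (K : AbstractSimplicialComplex V) (v : V) : Set (geomRealization K) :=
  {x | 0 < x.1 v}

theorem isOpen_openStar (v : V) : IsOpen (openStar K v) :=
  isOpen_lt continuous_const ((continuous_apply v).comp continuous_subtype_val)

theorem exists_mem_openStar (x : geomRealization K) : ∃ v, x ∈ openStar K v := by
  by_contra h
  push Not at h
  have h0 : ∑ v, x.1 v ≤ 0 := Finset.sum_nonpos fun v _ => not_lt.1 (h v)
  rw [x.2.2.1] at h0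
  exact absurd h0 (by norm_num)

theorem mem_support_of_pos {V : Type*} {x : V → ℝ} {s : Finset V} (hxs : ∀ v, v ∉ s → x v = 0) {v : V}
    (hv : 0 < x v) : v ∈ s := by
  by_contra h
  exact hv.ne' (hxs v h)

/-- The overlap of two stars is star-shaped about the midpoint of the edge; when it is nonempty,
this edge is a face. -/
theorem isPreconnected_inter_openStar [DecidableEq V] (u v : V) :
    IsPreconnected (openStar K u ∩ openStar K v) := by
  rcases Set.eq_empty_or_nonempty (openStar K u ∩ openStar K v) with h | ⟨x₀, hx₀⟩
  · rw [h]
    exact isPreconnected_empty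
  have key : ∀ x ∈ openStar K u ∩ openStar K v, ∃ s ∈ K.faces, (∀ w, w ∉ s → x.1 w = 0) ∧
      ({u, v} : Finset V) ⊆ s := by
    rintro x ⟨hu, hv⟩
    obtain ⟨s, hs, hxs⟩ := x.2.2.2
    refine ⟨s, hs, hxs, ?_⟩
    intro w hw
    simp only [Finset.mem_insert, Finset.mem_singleton] at hw
    rcases hw with rfl | rfl
    exacts [mem_support_of_pos hxs hu, mem_support_of_pos hxs hv]
  obtain ⟨s₀, hs₀, -, huv⟩ := key x₀ hx₀
  have he : ({u, v} : Finset V) ∈ K.faces :=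
    (K.isRelLowerSet_faces hs₀).2 huv (Finset.insert_nonempty _ _)
  set m : geomRealization K := ⟨_, faceCenter_mem he⟩ with hm
  have hmu : 0 < m.1 u := faceCenter_pos (by simp)
  have hmv : 0 < m.1 v := faceCenter_pos (by simp)
  refine isPreconnected_of_forall m fun y hy => ?_
  obtain ⟨s, hs, hys, hsub⟩ := key y hy
  let γ : unitInterval → geomRealization K := fun t =>
    ⟨_, segment_mem_geomRealization m.2 y.2 hs
      (fun w hw => faceCenter_of_notMem fun h => hw (hsub h)) hys t⟩
  have hγ : Continuous γ := by
    refine Continuous.subtype_mk (continuous_pi fun w => ?_) _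
    fun_prop
  have pos : ∀ (w : V), 0 < m.1 w → 0 < y.1 w → ∀ t : unitInterval, 0 < (γ t).1 w := by
    intro w h1 h2 t
    have h0 := t.2.1
    have h3 : 0 ≤ 1 - (t : ℝ) := sub_nonneg.2 t.2.2
    change 0 < (1 - (t : ℝ)) * m.1 w + t * y.1 w
    rcases h0.eq_or_lt with h | h
    · rw [← h]
      simpa using h1
    · have := mul_pos h h2
      have := mul_nonneg h3 h1.le
      linarith
  refine ⟨Set.range γ, ?_, ⟨0, ?_⟩, ⟨1, ?_⟩, isPreconnected_range hγ⟩
  · rintro _ ⟨t, rfl⟩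
    exact ⟨pos u hmu hy.1 t, pos v hmv hy.2 t⟩
  · refine Subtype.ext (funext fun w => ?_)
    simp [γ]
  · refine Subtype.ext (funext fun w => ?_)
    simp [γ]

/-- A covering has a section over every open star. -/
theorem exists_section_openStar {E X : Type*} [TopologicalSpace E] [TopologicalSpace X] {p : E → X}
    (hp : IsCoveringMap p) (hsurj : Function.Surjective p) {h : geomRealization K → X}
    (hh : Continuous h) (v : V) :
    ∃ s : C(openStar K v, E), ∀ x, p (s x) = h x.1 := by
  classical
  have hv : ({v} : Finset V) ∈ K.faces := K.singleton_mem v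
  set m : geomRealization K := ⟨_, faceCenter_mem hv⟩ with hm
  have key : ∀ x : openStar K v, ∃ s ∈ K.faces, (∀ w, w ∉ s → m.1 w = 0) ∧
      (∀ w, w ∉ s → x.1.1 w = 0) := by
    intro x
    obtain ⟨s, hs, hxs⟩ := x.1.2.2.2
    refine ⟨s, hs, fun w hw => faceCenter_of_notMem fun h => hw ?_, hxs⟩
    rw [Finset.mem_singleton] at h
    rw [h]
    exact mem_support_of_pos hxs x.2
  obtain ⟨e, he⟩ := hsurj (h m)
  -- The star is contracted to its centre, and the covering lifts the contraction, starting from the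
  -- constant lift of the centre. The time-one map of the lift is the section.
  let γ : unitInterval × openStar K v → geomRealization K := fun q =>
    ⟨fun w => (1 - (q.1 : ℝ)) * m.1 w + q.1 * q.2.1.1 w, by
      obtain ⟨s, hs, h1, h2⟩ := key q.2
      exact segment_mem_geomRealization m.2 q.2.1.2 hs h1 h2 q.1⟩
  have hγ : Continuous γ := by
    refine Continuous.subtype_mk (continuous_pi fun w => ?_) _
    have hw : Continuous fun q : unitInterval × openStar K v => q.2.1.1 w :=
      (continuous_apply w).comp
        (continuous_subtype_val.comp (continuous_subtype_val.comp continuous_snd))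
    have h1 : Continuous fun q : unitInterval × openStar K v => (q.1 : ℝ) :=
      continuous_subtype_val.comp continuous_fst
    exact ((continuous_const.sub h1).mul continuous_const).add (h1.mul hw)
  let H : C(unitInterval × openStar K v, X) := ⟨h ∘ γ, hh.comp hγ⟩
  have H0 : ∀ x, H (0, x) = p (ContinuousMap.const (openStar K v) e x) := by
    intro x
    rw [ContinuousMap.const_apply, he]
    change h (γ (0, x)) = h m
    congr 1
    refine Subtype.ext (funext fun w => ?_)
    simp [γ]
  let F := hp.liftHomotopy H (ContinuousMap.const _ e) H0
  refine ⟨⟨fun x => F (1, x), F.continuous.comp (by fun_prop)⟩, fun x => ?_⟩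
  have := congrFun (hp.liftHomotopy_lifts H (ContinuousMap.const _ e) H0) (1, x)
  change p (F (1, x)) = h (γ (1, x)) at this
  change p (F (1, x)) = h x.1
  rw [this]
  congr 1
  refine Subtype.ext (funext fun w => ?_)
  simp [γ]

/-- A triangulation of the quotient of a connected space by a free discrete group carries a full
cocycle with values in this group. -/
theorem exists_isFullCocycle [DecidableEq V] {E X G : Type*} [TopologicalSpace E]
    [TopologicalSpace X] [Group G] [MulAction G E] [ConnectedSpace E] {p : E → X}
    (hp : IsQuotientCoveringMap p G) (h : geomRealization K ≃ₜ X) :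
    Nonempty V ∧ ∃ c : V → V → G, IsFullCocycle K c := by
  have := hp.toContinuousConstSMul
  have hcov : IsCoveringMap p := hp.isCoveringMap
  have hcancel := hp.isCancelSMul
  choose s hs using exists_section_openStar (K := K) hcov hp.surjective h.continuous
  have inj : ∀ {u v : V} {x : openStar K u} {y : openStar K v} {g : G},
      s u x = g • s v y → x.1 = y.1 := by
    intro u v x y g hxy
    apply h.injective
    rw [← hs, ← hs, hxy, hp.map_smul]
  have free : ∀ {g g' : G} {e : E}, g • e = g' • e → g = g' := fun h =>
    IsCancelSMul.right_cancel _ _ _ h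
  have hc : ∀ u v : V, ∃ g : G, ∀ x (hu : x ∈ openStar K u) (hv : x ∈ openStar K v),
      s u ⟨x, hu⟩ = g • s v ⟨x, hv⟩ := by
    intro u v
    rcases Set.eq_empty_or_nonempty (openStar K u ∩ openStar K v) with hem | ⟨x₀, hx₀⟩
    · exact ⟨1, fun x hu hv => absurd (show x ∈ openStar K u ∩ openStar K v from ⟨hu, hv⟩)
        (by rw [hem]; exact Set.notMem_empty x)⟩
    · have h1 : p (s u ⟨x₀, hx₀.1⟩) = p (s v ⟨x₀, hx₀.2⟩) := by rw [hs, hs]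
      obtain ⟨g, hg⟩ := hp.apply_eq_iff_mem_orbit.1 h1
      refine ⟨g, fun x hu hv => ?_⟩
      have hpre : PreconnectedSpace ↥(openStar K u ∩ openStar K v) :=
        isPreconnected_iff_preconnectedSpace.1 (isPreconnected_inter_openStar u v)
      have h2 : Continuous fun y : ↥(openStar K u ∩ openStar K v) => s u ⟨y.1, y.2.1⟩ :=
        (s u).continuous.comp (by fun_prop)
      have h3 : Continuous fun y : ↥(openStar K u ∩ openStar K v) => g • s v ⟨y.1, y.2.2⟩ :=
        ((s v).continuous.comp (by fun_prop)).const_smul g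
      -- Both sides are lifts of the same map on a connected set and agree at `x₀`, so the element
      -- `g` found there works on the whole overlap.
      have h4 := hcov.eq_of_comp_eq h2 h3 (by
        funext y
        simp only [Function.comp_apply, hp.map_smul, hs]) ⟨x₀, hx₀⟩ hg.symm
      exact congrFun h4 ⟨x, hu, hv⟩
  choose c hc using hc
  have mem : ∀ {t : Finset V} (ht : t ∈ K.faces) {v : V}, v ∈ t →
      (⟨_, faceCenter_mem ht⟩ : geomRealization K) ∈ openStar K v :=
    fun ht v hv => faceCenter_pos hv
  obtain ⟨e₀⟩ := (inferInstance : Nonempty E)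
  have cover : ∀ e : E, ∃ (u : V) (x : openStar K u) (g : G), e = g • s u x := by
    intro e
    obtain ⟨u, hu⟩ := exists_mem_openStar (h.symm (p e))
    have : p e = p (s u ⟨_, hu⟩) := by
      rw [hs]
      exact (h.apply_symm_apply _).symm
    obtain ⟨g, hg⟩ := hp.apply_eq_iff_mem_orbit.1 this
    exact ⟨u, _, g, hg.symm⟩
  have hopen : ∀ u, IsOpen (Set.range (s u)) := by
    intro u
    have h1 : Topology.IsOpenEmbedding (p ∘ s u) := by
      have : p ∘ s u = h ∘ Subtype.val := funext fun x => hs u x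
      rw [this]
      exact h.isOpenEmbedding.comp (isOpen_openStar u).isOpenEmbedding_subtypeVal
    have h2 : IsLocalHomeomorph (s u) :=
      IsLocalHomeomorph.of_comp (g := p) h1.isLocalHomeomorph hcov.isLocalHomeomorph (s u).continuous
    exact h2.isOpenMap.isOpen_range
  refine ⟨(cover e₀).nonempty, c, ?_, ?_⟩
  · intro u v w huvw
    have hu := mem huvw (v := u) (by simp)
    have hv := mem huvw (v := v) (by simp)
    have hw := mem huvw (v := w) (by simp)
    refine free (e := s w ⟨_, hw⟩) ?_
    rw [mul_smul, ← hc v w _ hv hw, ← hc u v _ hu hv, ← hc u w _ hu hw]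
  · intro H a hH
    -- Sheets of the stars are normalized by the gauge. If a sheet with coefficient in `H`, moved by
    -- `k`, meets another such sheet, then the gauged edge label expresses `k` as an element of `H`.
    have key : ∀ {u v : V} {x : openStar K u} {y : openStar K v} {g h' : G} (k : G), g ∈ H →
        h' ∈ H → k • (g * (a u)⁻¹) • s u x = (h' * (a v)⁻¹) • s v y → k ∈ H := by
      intro u v x y g h' k hg hh' heq
      have hxy : x.1 = y.1 := by
        refine inj (g := (k * (g * (a u)⁻¹))⁻¹ * (h' * (a v)⁻¹)) ?_
        rw [mul_smul, ← heq, ← mul_smul k, inv_smul_smul]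
      obtain ⟨x, hx⟩ := x
      obtain ⟨y, hy⟩ := y
      dsimp only at hxy
      subst hxy
      rw [hc u v x hx hy, ← mul_smul, ← mul_smul] at heq
      have h1 := free heq
      have huv : ({u, v} : Finset V) ∈ K.faces := by
        obtain ⟨t, ht, hxt⟩ := x.2.2.2
        refine (K.isRelLowerSet_faces ht).2 ?_ (Finset.insert_nonempty _ _)
        intro w hw
        simp only [Finset.mem_insert, Finset.mem_singleton] at hw
        rcases hw with rfl | rfl
        exacts [mem_support_of_pos hxt hx, mem_support_of_pos hxt hy]
      have h2 : k = h' * ((a u)⁻¹ * c u v * a v)⁻¹ * g⁻¹ := by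
        rw [eq_mul_inv_iff_mul_eq, eq_mul_inv_iff_mul_eq]
        calc k * g * ((a u)⁻¹ * c u v * a v) = (k * (g * (a u)⁻¹) * c u v) * a v := by group
          _ = h' := by rw [h1]; group
      rw [h2]
      exact H.mul_mem (H.mul_mem hh' (H.inv_mem (hH u v huv))) (H.inv_mem hg)
    -- `Y k` is the union of the sheets belonging to the coset `k H`. Sheets of different cosets do
    -- not meet, so `Y 1` is clopen in the connected space `E` and hence everything. Every translate
    -- of a sheet then lies in `Y 1`, which puts every `k` into `H`.
    let Y : G → Set E := fun k => ⋃ u, ⋃ g : H, (fun e => (k * ((g : G) * (a u)⁻¹)) • e) '' Set.range (s u)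
    have hY : ∀ k, IsOpen (Y k) := fun k => isOpen_iUnion fun u => isOpen_iUnion fun g =>
      (isOpenMap_smul _) _ (hopen u)
    have memY : ∀ {k e}, e ∈ Y k ↔ ∃ (u : V) (g : H) (x : openStar K u),
        k • ((g : G) * (a u)⁻¹) • s u x = e := by
      intro k e
      simp [Y, mul_smul]
    have coverY : ∀ e, ∃ k, e ∈ Y k := by
      intro e
      obtain ⟨u, x, g, rfl⟩ := cover e
      refine ⟨g * a u, memY.2 ⟨u, 1, x, ?_⟩⟩
      simp [← mul_smul]
    have hcompl : (Y 1)ᶜ = ⋃ k : {k : G // k ∉ H}, Y k := by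
      ext e
      simp only [Set.mem_compl_iff, Set.mem_iUnion]
      constructor
      · intro he
        obtain ⟨k, hk⟩ := coverY e
        refine ⟨⟨k, fun hkH => he ?_⟩, hk⟩
        obtain ⟨u, g, x, rfl⟩ := memY.1 hk
        exact memY.2 ⟨u, ⟨k, hkH⟩ * g, x, by simp [mul_smul]⟩
      · rintro ⟨⟨k, hk⟩, hke⟩ he
        obtain ⟨u, g, x, rfl⟩ := memY.1 hke
        obtain ⟨v, g', y, hy⟩ := memY.1 he
        rw [one_smul] at hy
        exact hk (key k g.2 g'.2 hy.symm)
    have hclopen : IsClopen (Y 1) :=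
      ⟨⟨by rw [hcompl]; exact isOpen_iUnion fun k => hY _⟩, hY 1⟩
    have hne : (Y 1).Nonempty := by
      obtain ⟨u, x, g, -⟩ := cover e₀
      exact ⟨_, memY.2 ⟨u, 1, x, rfl⟩⟩
    have huniv := hclopen.eq_univ hne
    rw [eq_top_iff]
    intro k _
    obtain ⟨u, x, g, -⟩ := cover e₀
    have h1 : k • (1 * (a u)⁻¹) • s u x ∈ Y 1 := by rw [huniv]; trivial
    obtain ⟨v, g', y, hy⟩ := memY.1 h1
    rw [one_smul] at hy
    exact key k H.one_mem g'.2 hy.symm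

end Realization

/-! ### Breadth-first trees -/

/-- In a relation whose points can all be reached from a root, every point other than the root has
a parent that is closer to the root. -/
theorem exists_parent {α : Type*} {r : α → α → Prop} {root : α}
    (h : ∀ x, Relation.ReflTransGen r root x) :
    ∃ (lev : α → ℕ) (par : α → α), ∀ x, x ≠ root → r (par x) x ∧ lev (par x) < lev x := by
  classical
  -- `D n` is the set of points reachable in at most `n` steps; the level of a point is the first
  -- such `n`.
  let D : ℕ → Set α := fun n => Nat.rec (motive := fun _ => Set α) {root} (fun _ S => {y | y ∈ S ∨ ∃ x ∈ S, r x y}) n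
  have hD : ∀ x, ∃ n, x ∈ D n := by
    intro x
    induction h x with
    | refl => exact ⟨0, rfl⟩
    | tail _ hbc ih =>
      obtain ⟨n, hn⟩ := ih
      exact ⟨n + 1, Or.inr ⟨_, hn, hbc⟩⟩
  have hp : ∀ x, x ≠ root → ∃ y : α, r y x ∧ Nat.find (hD y) < Nat.find (hD x) := by
    intro x hx
    have hspec := Nat.find_spec (hD x)
    rcases hn : Nat.find (hD x) with _ | m
    · rw [hn] at hspec
      exact absurd hspec hx
    · rw [hn] at hspec
      have hm : x ∉ D m := Nat.find_min (hD x) (by omega)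
      rcases hspec with h1 | ⟨y, hy, hyx⟩
      · exact absurd h1 hm
      · exact ⟨y, hyx, Nat.lt_succ_of_le (Nat.find_min' (hD y) hy)⟩
  refine ⟨fun x => Nat.find (hD x), fun x => if hx : x ≠ root then (hp x hx).choose else x, ?_⟩
  intro x hx
  dsimp only
  rw [dif_pos hx]
  exact (hp x hx).choose_spec

theorem reflTransGen_of_parent {α : Type*} {r : α → α → Prop} {root : α} {lev : α → ℕ}
    {par : α → α} (hpar : ∀ x, x ≠ root → r (par x) x ∧ lev (par x) < lev x) (x : α) :
    Relation.ReflTransGen r root x := by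
  induction hn : lev x using Nat.strong_induction_on generalizing x with
  | _ n ih =>
    by_cases hx : x = root
    · rw [hx]
    · obtain ⟨h1, h2⟩ := hpar x hx
      exact (ih _ (hn ▸ h2) _ rfl).tail h1

/-- A labelling can be normalized to be trivial along a tree. -/
theorem exists_tree_gauge {V G : Type*} [Group G] (c : V → V → G) {root : V} {lev : V → ℕ}
    {par : V → V} (hpar : ∀ x, x ≠ root → lev (par x) < lev x) (g₀ : G) :
    ∃ a : V → G, a root = g₀ ∧ ∀ x, x ≠ root → (a (par x))⁻¹ * c (par x) x * a x = 1 := by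
  classical
  let F : (x : V) → ((y : V) → lev y < lev x → G) → G := fun x rec =>
    if h : x ≠ root then (c (par x) x)⁻¹ * rec (par x) (hpar x h) else g₀
  let a : V → G := (measure lev).wf.fix F
  have ha : ∀ x, a x = F x (fun y _ => a y) := fun x => (measure lev).wf.fix_eq F x
  refine ⟨a, by rw [ha]; simp [F], fun x hx => ?_⟩
  rw [ha x]
  simp [F, hx]

/-! ### Gauge transformations -/

section Gauge

variable {V G : Type*} [DecidableEq V] [Group G] {K : AbstractSimplicialComplex V}

/-- The gauge transform of a labelling. -/
def gaugeBy (a : V → G) (c : V → V → G) (u v : V) : G := (a u)⁻¹ * c u v * a v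

theorem IsCocycle.of_gauge {c : V → V → G} (hc : IsCocycle K c) (a : V → G) :
    IsCocycle K (gaugeBy a c) := by
  intro u v w h
  have := hc u v w h
  simp only [gaugeBy]
  rw [← this]
  group

theorem IsFullCocycle.of_gauge {c : V → V → G} (hc : IsFullCocycle K c) (a : V → G) :
    IsFullCocycle K (gaugeBy a c) := by
  refine ⟨hc.1.of_gauge a, fun H b hb => hc.2 H (fun v => a v * b v) fun u v huv => ?_⟩
  have := hb u v huv
  simp only [gaugeBy] at this
  convert this using 1
  group

theorem IsFullCocycle.eq_top {c : V → V → G} (hc : IsFullCocycle K c) (H : Subgroup G)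
    (h : ∀ u v, ({u, v} : Finset V) ∈ K.faces → c u v ∈ H) : H = ⊤ :=
  hc.2 H 1 fun u v huv => by simpa using h u v huv

theorem IsCocycle.self {c : V → V → G} (hc : IsCocycle K c) (u : V) : c u u = 1 := by
  have := hc u u u (by simpa using K.singleton_mem u)
  simpa using this

theorem IsCocycle.mul_swap {c : V → V → G} (hc : IsCocycle K c) {u v : V}
    (h : ({u, v} : Finset V) ∈ K.faces) : c u v * c v u = 1 := by
  rw [hc u v u (by
    have : ({u, v, u} : Finset V) = {u, v} := by
      ext x
      simp only [mem_insert, mem_singleton]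
      tauto
    rwa [this]), hc.self]

theorem IsCocycle.swap {c : V → V → G} (hc : IsCocycle K c) {u v : V}
    (h : ({u, v} : Finset V) ∈ K.faces) : c v u = (c u v)⁻¹ :=
  (inv_eq_of_mul_eq_one_right (hc.mul_swap h)).symm

end Gauge

/-! ### Triangulated surfaces -/

section Surface

open Classical in
/-- The faces with a given number of vertices. -/
noncomputable def facesOfCard {V : Type*} [Fintype V] (K : AbstractSimplicialComplex V) (k : ℕ) :
    Finset (Finset V) :=
  univ.filter fun s => s ∈ K.faces ∧ s.card = k

theorem mem_facesOfCard {V : Type*} [Fintype V] {K : AbstractSimplicialComplex V} {k : ℕ} {s : Finset V} :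
    s ∈ facesOfCard K k ↔ s ∈ K.faces ∧ s.card = k := by
  simp [facesOfCard]

variable {V : Type*} [DecidableEq V] [Fintype V] {K : AbstractSimplicialComplex V}

theorem face_mono {V : Type*} {K : AbstractSimplicialComplex V} {s t : Finset V}
    (hs : s ∈ K.faces) (hts : t ⊆ s) (ht : t.Nonempty) : t ∈ K.faces :=
  (K.isRelLowerSet_faces hs).2 hts ht

theorem IsTriangulatedSurface.exists_neighbour {V : Type*} [DecidableEq V]
    {K : AbstractSimplicialComplex V} (hK : IsTriangulatedSurface K) (v : V) :
    ∃ w, v ≠ w ∧ ({v, w} : Finset V) ∈ K.faces := by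
  obtain ⟨w, -, hw, h⟩ := (hK v).nonempty
  exact ⟨w, by simpa using hw, h⟩

/-- The two triangles at an edge. -/
theorem IsTriangulatedSurface.exists_apexes {V : Type*} [DecidableEq V]
    {K : AbstractSimplicialComplex V} (hK : IsTriangulatedSurface K) {v w : V} (hvw : v ≠ w)
    (h : ({v, w} : Finset V) ∈ K.faces) :
    ∃ a b, a ≠ b ∧ ∀ x, (x ≠ v ∧ x ≠ w ∧ ({v, w, x} : Finset V) ∈ K.faces) ↔ x = a ∨ x = b := by
  have hd := (hK v).degree w ⟨Finset.singleton_nonempty w, by simpa using hvw, h⟩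
  obtain ⟨a, b, hab, hS⟩ := Set.ncard_eq_two.1 hd
  refine ⟨a, b, hab, fun x => ?_⟩
  have hx : x ∈ {x | x ≠ w ∧ ({w, x} : Finset V) ∈ (vertexLink K v).faces} ↔ x ∈ ({a, b} : Set V) := by
    rw [hS]
  rw [Set.mem_insert_iff, Set.mem_singleton_iff] at hx
  rw [← hx]
  constructor
  · rintro ⟨h1, h2, h3⟩
    exact ⟨h2, Finset.insert_nonempty _ _, by simp [hvw, h1.symm], h3⟩
  · rintro ⟨h1, -, h2, h3⟩
    simp only [mem_insert, mem_singleton, not_or] at h2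
    exact ⟨fun h => h2.2 h.symm, h1, h3⟩

theorem eq_insert_of_card_three {V : Type*} [DecidableEq V] {t : Finset V} (ht : t.card = 3) {v w : V} (hvw : v ≠ w)
    (hv : v ∈ t) (hw : w ∈ t) : ∃ x, x ≠ v ∧ x ≠ w ∧ t = {v, w, x} := by
  have h2 : ((t.erase v).erase w).card = 1 := by
    rw [Finset.card_erase_of_mem (Finset.mem_erase.2 ⟨hvw.symm, hw⟩), Finset.card_erase_of_mem hv,
      ht]
  obtain ⟨x, hx⟩ := Finset.card_eq_one.1 h2
  have hxm : x ∈ (t.erase v).erase w := by rw [hx]; exact mem_singleton_self x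
  rw [Finset.mem_erase, Finset.mem_erase] at hxm
  refine ⟨x, hxm.2.1, hxm.1, ?_⟩
  rw [← hx, Finset.insert_erase (Finset.mem_erase.2 ⟨hvw.symm, hw⟩), Finset.insert_erase hv]

theorem card_triple {V : Type*} [DecidableEq V] {v w x : V} (hvw : v ≠ w) (hxv : x ≠ v) (hxw : x ≠ w) :
    ({v, w, x} : Finset V).card = 3 :=
  Finset.card_eq_three.2 ⟨v, w, x, hvw, hxv.symm, hxw.symm, rfl⟩

theorem IsTriangulatedSurface.card_triangles_of_edge (hK : IsTriangulatedSurface K)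
    {e : Finset V} (he : e ∈ facesOfCard K 2) :
    ((facesOfCard K 3).filter fun t => e ⊆ t).card = 2 := by
  obtain ⟨he, hcard⟩ := mem_facesOfCard.1 he
  obtain ⟨v, w, hvw, rfl⟩ := Finset.card_eq_two.1 hcard
  obtain ⟨a, b, hab, h⟩ := hK.exists_apexes hvw he
  have ha := (h a).2 (Or.inl rfl)
  have hb := (h b).2 (Or.inr rfl)
  have : (facesOfCard K 3).filter (fun t => {v, w} ⊆ t) = {{v, w, a}, {v, w, b}} := by
    ext t
    simp only [mem_filter, mem_facesOfCard, mem_insert, mem_singleton]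
    constructor
    · rintro ⟨⟨ht, htc⟩, hsub⟩
      obtain ⟨x, hx1, hx2, rfl⟩ := eq_insert_of_card_three htc hvw (hsub (by simp))
        (hsub (by simp))
      rcases (h x).1 ⟨hx1, hx2, ht⟩ with rfl | rfl
      exacts [Or.inl rfl, Or.inr rfl]
    · rintro (rfl | rfl)
      · exact ⟨⟨ha.2.2, card_triple hvw ha.1 ha.2.1⟩, by intro x; simp; tauto⟩
      · exact ⟨⟨hb.2.2, card_triple hvw hb.1 hb.2.1⟩, by intro x; simp; tauto⟩
  rw [this, Finset.card_pair]
  intro heq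
  have : b ∈ ({v, w, a} : Finset V) := by rw [heq]; simp
  simp only [mem_insert, mem_singleton] at this
  rcases this with h1 | h1 | h1
  exacts [hb.1 h1, hb.2.1 h1, hab h1.symm]

/-- Incident pairs of an edge and a triangle are counted in two ways. -/
theorem IsTriangulatedSurface.three_mul_card (hK : IsTriangulatedSurface K) :
    3 * (facesOfCard K 3).card = 2 * (facesOfCard K 2).card := by
  have h := Finset.sum_card_bipartiteAbove_eq_sum_card_bipartiteBelow
    (s := facesOfCard K 2) (t := facesOfCard K 3) (fun e t => e ⊆ t)
  have h1 : ∑ e ∈ facesOfCard K 2, (bipartiteAbove (fun e t => e ⊆ t) (facesOfCard K 3) e).card =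
      ∑ e ∈ facesOfCard K 2, 2 :=
    Finset.sum_congr rfl fun e he => hK.card_triangles_of_edge he
  have h2 : ∑ t ∈ facesOfCard K 3, (bipartiteBelow (fun e t => e ⊆ t) (facesOfCard K 2) t).card =
      ∑ t ∈ facesOfCard K 3, 3 := by
    refine Finset.sum_congr rfl fun t ht => ?_
    obtain ⟨ht, htc⟩ := mem_facesOfCard.1 ht
    have : bipartiteBelow (fun e t => e ⊆ t) (facesOfCard K 2) t = t.powersetCard 2 := by
      ext e
      simp only [mem_bipartiteBelow, mem_facesOfCard, mem_powersetCard]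
      constructor
      · rintro ⟨⟨-, h1⟩, h2⟩
        exact ⟨h2, h1⟩
      · rintro ⟨h2, h1⟩
        exact ⟨⟨face_mono ht h2 (Finset.card_pos.1 (by omega)), h1⟩, h2⟩
    rw [this, Finset.card_powersetCard, htc]
    rfl
  rw [h1, h2] at h
  simp only [sum_const, smul_eq_mul] at h
  omega

theorem IsTriangulatedSurface.eq_or_eq_of_edge (hK : IsTriangulatedSurface K)
    {e t₁ t₂ t₃ : Finset V} (he : e ∈ facesOfCard K 2) (h₁ : t₁ ∈ facesOfCard K 3)
    (h₂ : t₂ ∈ facesOfCard K 3) (h₃ : t₃ ∈ facesOfCard K 3) (he₁ : e ⊆ t₁) (he₂ : e ⊆ t₂)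
    (he₃ : e ⊆ t₃) : t₁ = t₂ ∨ t₁ = t₃ ∨ t₂ = t₃ := by
  by_contra hcon
  push Not at hcon
  have hsub : ({t₁, t₂, t₃} : Finset (Finset V)) ⊆ (facesOfCard K 3).filter fun t => e ⊆ t := by
    intro t
    simp only [mem_insert, mem_singleton, mem_filter]
    rintro (rfl | rfl | rfl)
    exacts [⟨h₁, he₁⟩, ⟨h₂, he₂⟩, ⟨h₃, he₃⟩]
  have := Finset.card_le_card hsub
  rw [hK.card_triangles_of_edge he, Finset.card_eq_three.2
    ⟨t₁, t₂, t₃, hcon.1, hcon.2.1, hcon.2.2, rfl⟩] at this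
  omega

/-- Two triangles are adjacent if they share an edge. -/
def dualAdj (K : AbstractSimplicialComplex V) (s t : facesOfCard K 3) : Prop :=
  ∃ e ∈ facesOfCard K 2, e ⊆ s.1 ∧ e ⊆ t.1

/-- All vertices can be joined by edge paths. -/
def EdgeConnected {V : Type*} [DecidableEq V] (K : AbstractSimplicialComplex V) : Prop :=
  ∀ u v, Relation.ReflTransGen (fun a b => ({a, b} : Finset V) ∈ K.faces) u v

theorem pair_mem_edges {v w : V} (hvw : v ≠ w) {t : Finset V} (ht : t ∈ K.faces) (hv : v ∈ t)
    (hw : w ∈ t) : ({v, w} : Finset V) ∈ facesOfCard K 2 := by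
  refine mem_facesOfCard.2 ⟨face_mono ht ?_ (Finset.insert_nonempty _ _), Finset.card_pair hvw⟩
  intro x
  simp only [mem_insert, mem_singleton]
  rintro (rfl | rfl)
  exacts [hv, hw]

theorem pair_subset {V : Type*} [DecidableEq V] {v w : V} {t : Finset V} (hv : v ∈ t) (hw : w ∈ t) :
    ({v, w} : Finset V) ⊆ t := by
  intro x
  simp only [mem_insert, mem_singleton]
  rintro (rfl | rfl)
  exacts [hv, hw]

/-- Walking along the link circle of `v` is walking through the triangles at `v`, across edges that
contain `v`. -/
theorem IsTriangulatedSurface.dual_star_connected (hK : IsTriangulatedSurface K)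
    {s t : facesOfCard K 3} {v : V} (hs : v ∈ s.1) (ht : v ∈ t.1) :
    Relation.ReflTransGen (dualAdj K) s t := by
  obtain ⟨hsK, hsc⟩ := mem_facesOfCard.1 s.2
  obtain ⟨htK, htc⟩ := mem_facesOfCard.1 t.2
  obtain ⟨a, has, hav⟩ := Finset.exists_mem_ne (by omega : 1 < s.1.card) v
  obtain ⟨b, hbt, hbv⟩ := Finset.exists_mem_ne (by omega : 1 < t.1.card) v
  have hmem : ∀ {x : V} {r : Finset V}, x ≠ v → r ∈ K.faces → v ∈ r → x ∈ r →
      ({x} : Finset V) ∈ (vertexLink K v).faces := fun hxv hr hv hx =>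
    ⟨Finset.singleton_nonempty _, by simpa using hxv.symm,
      face_mono hr (pair_subset hv hx) (Finset.insert_nonempty _ _)⟩
  have hpath := (hK v).connected a b (hmem hav hsK hs has) (hmem hbv htK ht hbt)
  have key : ∀ x, Relation.ReflTransGen
      (fun a b => ({a, b} : Finset V) ∈ (vertexLink K v).faces) a x → x ≠ v ∧
      ∀ r : facesOfCard K 3, v ∈ r.1 → x ∈ r.1 → Relation.ReflTransGen (dualAdj K) s r := by
    intro x hx
    induction hx with
    | refl =>
      exact ⟨hav, fun r hvr har => Relation.ReflTransGen.single
        ⟨{v, a}, pair_mem_edges hav.symm hsK hs has, pair_subset hs has, pair_subset hvr har⟩⟩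
    | @tail y z _ hyz ih =>
      obtain ⟨-, hv, hK3⟩ := hyz
      simp only [mem_insert, mem_singleton, not_or] at hv
      refine ⟨fun h => hv.2 h.symm, fun r hvr hzr => ?_⟩
      by_cases hyz : y = z
      · subst hyz
        exact ih.2 r hvr hzr
      · have h3 : ({v, y, z} : Finset V) ∈ facesOfCard K 3 :=
          mem_facesOfCard.2 ⟨hK3, card_triple hv.1 (fun h => hv.2 h.symm) (fun h => hyz h.symm)⟩
        exact (ih.2 ⟨_, h3⟩ (by simp) (by simp)).tail
          ⟨{v, z}, pair_mem_edges hv.2 hK3 (by simp) (by simp), pair_subset (by simp) (by simp),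
            pair_subset hvr hzr⟩
  exact (key b hpath).2 t ht hbt

theorem IsTriangulatedSurface.dual_connected (hK : IsTriangulatedSurface K)
    (hconn : EdgeConnected K) (s t : facesOfCard K 3) :
    Relation.ReflTransGen (dualAdj K) s t := by
  obtain ⟨u, hu⟩ := (K.isRelLowerSet_faces (mem_facesOfCard.1 s.2).1).1
  obtain ⟨v, hv⟩ := (K.isRelLowerSet_faces (mem_facesOfCard.1 t.2).1).1
  have key : ∀ x, Relation.ReflTransGen (fun a b => ({a, b} : Finset V) ∈ K.faces) u x →
      ∀ r : facesOfCard K 3, x ∈ r.1 → Relation.ReflTransGen (dualAdj K) s r := by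
    intro x hx
    induction hx with
    | refl => exact fun r hr => hK.dual_star_connected hu hr
    | @tail y z _ hyz ih =>
      intro r hr
      by_cases h : y = z
      · subst h
        exact ih r hr
      · obtain ⟨a, b, -, hab⟩ := hK.exists_apexes h hyz
        obtain ⟨h1, h2, h3⟩ := (hab a).2 (Or.inl rfl)
        have h4 : ({y, z, a} : Finset V) ∈ facesOfCard K 3 :=
          mem_facesOfCard.2 ⟨h3, card_triple h h1 h2⟩
        exact (ih ⟨_, h4⟩ (by simp)).trans (hK.dual_star_connected (v := z) (by simp) hr)
  exact key v (hconn u v) t hv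

/-- A cotree of a connected triangulated surface: a set of edges dual to a spanning tree of the
dual graph.  A property of edges that propagates across triangles holds for all edges as soon as
it holds outside the cotree. -/
theorem IsTriangulatedSurface.exists_cotree [Nonempty V] (hK : IsTriangulatedSurface K)
    (hconn : EdgeConnected K) :
    ∃ C ⊆ facesOfCard K 2, C.card + 1 = (facesOfCard K 3).card ∧
      ∀ Q : V → V → Prop, (∀ a b, Q a b → Q b a) →
        (∀ a b, a ≠ b → ({a, b} : Finset V) ∈ K.faces → {a, b} ∉ C → Q a b) →
        (∀ a b w, ({a, b, w} : Finset V) ∈ K.faces → Q a w → Q w b → Q a b) →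
        ∀ a b, a ≠ b → ({a, b} : Finset V) ∈ K.faces → Q a b := by
  obtain ⟨v₀⟩ := (inferInstance : Nonempty V)
  obtain ⟨w₀, hvw, he⟩ := hK.exists_neighbour v₀
  obtain ⟨x₀, _, _, hx₀⟩ := hK.exists_apexes hvw he
  obtain ⟨h1, h2, h3⟩ := (hx₀ x₀).2 (Or.inl rfl)
  let root : facesOfCard K 3 :=
    ⟨_, mem_facesOfCard.2 ⟨h3, card_triple hvw h1 h2⟩⟩
  obtain ⟨lev, par, hpar⟩ := exists_parent (fun t => hK.dual_connected hconn root t)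
  have hchoice : ∀ t : facesOfCard K 3, ∃ e, t ≠ root →
      e ∈ facesOfCard K 2 ∧ e ⊆ (par t).1 ∧ e ⊆ t.1 := by
    intro t
    by_cases ht : t = root
    · exact ⟨∅, fun h => absurd ht h⟩
    · obtain ⟨⟨e, he, h1, h2⟩, -⟩ := hpar t ht
      exact ⟨e, fun _ => ⟨he, h1, h2⟩⟩
  choose ed hed using hchoice
  -- Only two triangles meet at the edge crossed between `t` and its parent, so a triangle on it
  -- other than `t` is the parent. This gives injectivity of `ed` now, and identifies children
  -- later.
  have eq_par : ∀ t t' : facesOfCard K 3, t ≠ root → ed t ⊆ t'.1 → t' ≠ t → t' = par t := by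
    intro t t' ht hsub hne
    obtain ⟨he, h1, h2⟩ := hed t ht
    rcases hK.eq_or_eq_of_edge he t'.2 t.2 (par t).2 hsub h2 h1 with h | h | h
    · exact absurd (Subtype.ext h) hne
    · exact Subtype.ext h
    · have := (hpar t ht).2
      rw [← Subtype.ext h] at this
      exact absurd this (lt_irrefl _)
  have hinj : ∀ t t', t ≠ root → t' ≠ root → ed t = ed t' → t = t' := by
    intro t t' ht ht' heq
    by_contra hne
    have e1 := eq_par t t' ht (heq ▸ (hed t' ht').2.2) (Ne.symm hne)
    have e2 := eq_par t' t ht' (heq ▸ (hed t ht).2.2) hne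
    have l1 := (hpar t ht).2
    have l2 := (hpar t' ht').2
    rw [← e1] at l1
    rw [← e2] at l2
    omega
  refine ⟨(univ.erase root).image ed, ?_, ?_, ?_⟩
  · intro e he
    obtain ⟨t, ht, rfl⟩ := Finset.mem_image.1 he
    exact (hed t (Finset.ne_of_mem_erase ht)).1
  · rw [Finset.card_image_of_injOn, Finset.card_erase_of_mem (mem_univ _), Finset.card_univ,
      Fintype.card_coe]
    · have : 0 < (facesOfCard K 3).card := Finset.card_pos.2 ⟨_, root.2⟩
      omega
    · intro t ht t' ht' heq
      exact hinj t t' (Finset.ne_of_mem_erase ht) (Finset.ne_of_mem_erase ht') heq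
  · intro Q hsymm hout htri
    -- Induction from the leaves of the dual tree. The two sides of `t` other than the one towards
    -- the parent are either outside the cotree or lead to a child, whose level is larger; the
    -- property then passes to the third side.
    have key : ∀ t, t ≠ root → ∀ a b, ed t = {a, b} → Q a b := by
      intro t
      induction hn : (univ.sup lev) - lev t using Nat.strong_induction_on generalizing t with
      | _ n ih =>
        intro ht a b hab
        obtain ⟨he, h1, h2⟩ := hed t ht
        obtain ⟨heK, hec⟩ := mem_facesOfCard.1 he
        obtain ⟨htK, htc⟩ := mem_facesOfCard.1 t.2
        have hne : a ≠ b := by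
          rintro rfl
          rw [hab] at hec
          simp at hec
        obtain ⟨w, hwa, hwb, htw⟩ := eq_insert_of_card_three htc hne
          (h2 (by rw [hab]; simp)) (h2 (by rw [hab]; simp))
        have side : ∀ x y, x ≠ y → ({x, y} : Finset V) ⊆ t.1 → ({x, y} : Finset V) ≠ {a, b} →
            Q x y := by
          intro x y hxy hsub hxyne
          by_cases hC : ({x, y} : Finset V) ∈ (univ.erase root).image ed
          · obtain ⟨t', ht', heq⟩ := Finset.mem_image.1 hC
            have ht'r := Finset.ne_of_mem_erase ht'
            have hne' : t ≠ t' := by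
              rintro rfl
              exact hxyne (heq ▸ hab)
            have hp := eq_par t' t ht'r (heq ▸ hsub) hne'
            have hl := (hpar t' ht'r).2
            rw [← hp] at hl
            have hle : lev t' ≤ univ.sup lev := Finset.le_sup (mem_univ t')
            exact ih _ (by omega) t' rfl ht'r x y heq
          · exact hout x y hxy (face_mono htK hsub (Finset.insert_nonempty _ _)) hC
        refine htri a b w (htw ▸ htK) ?_ ?_
        · refine side a w hwa.symm (by rw [htw]; exact pair_subset (by simp) (by simp)) ?_
          intro h
          have : w ∈ ({a, b} : Finset V) := by rw [← h]; simp
          simp [hwa, hwb] at this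
        · refine side w b hwb (by rw [htw]; exact pair_subset (by simp) (by simp)) ?_
          intro h
          have : w ∈ ({a, b} : Finset V) := by rw [← h]; simp
          simp [hwa, hwb] at this
    intro a b hab habK
    by_cases hC : ({a, b} : Finset V) ∈ (univ.erase root).image ed
    · obtain ⟨t, ht, heq⟩ := Finset.mem_image.1 hC
      exact key t (Finset.ne_of_mem_erase ht) a b heq
    · exact hout a b hab habK hC

/-- The edges of a spanning tree. -/
theorem exists_treeEdges {r : V → V → Prop} {root : V} {lev : V → ℕ} {par : V → V}
    (hpar : ∀ x, x ≠ root → r (par x) x ∧ lev (par x) < lev x) {E : Finset (Finset V)}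
    (hE : ∀ x y, r x y → ({x, y} : Finset V) ∈ E) :
    ∃ T ⊆ E, T.card + 1 = Fintype.card V ∧
      ∀ u v, u ≠ v → ({u, v} : Finset V) ∈ T → (v ≠ root ∧ par v = u) ∨ (u ≠ root ∧ par u = v) := by
  have hinj : ∀ x y, x ≠ root → y ≠ root → ({par x, x} : Finset V) = {par y, y} → x = y := by
    intro x y hx hy h
    by_contra hne
    have h1 : x ∈ ({par y, y} : Finset V) := by rw [← h]; simp
    have h2 : y ∈ ({par x, x} : Finset V) := by rw [h]; simp
    simp only [mem_insert, mem_singleton, hne, Ne.symm hne, or_false] at h1 h2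
    have l1 := (hpar x hx).2
    have l2 := (hpar y hy).2
    rw [← h2] at l1
    rw [← h1] at l2
    omega
  refine ⟨(univ.erase root).image fun x => {par x, x}, ?_, ?_, ?_⟩
  · intro e he
    obtain ⟨x, hx, rfl⟩ := Finset.mem_image.1 he
    exact hE _ _ (hpar x (Finset.ne_of_mem_erase hx)).1
  · rw [Finset.card_image_of_injOn, Finset.card_erase_of_mem (mem_univ _), Finset.card_univ]
    · have : 0 < Fintype.card V := Fintype.card_pos_iff.2 ⟨root⟩
      omega
    · intro x hx y hy h
      exact hinj x y (Finset.ne_of_mem_erase hx) (Finset.ne_of_mem_erase hy) h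
  · intro u v huv h
    obtain ⟨x, hx, heq⟩ := Finset.mem_image.1 h
    have hxr := Finset.ne_of_mem_erase hx
    have hu : u ∈ ({par x, x} : Finset V) := by rw [heq]; simp
    have hv : v ∈ ({par x, x} : Finset V) := by rw [heq]; simp
    simp only [mem_insert, mem_singleton] at hu hv
    rcases hu with rfl | rfl
    · rcases hv with rfl | rfl
      · exact absurd rfl huv
      · exact Or.inl ⟨hxr, rfl⟩
    · rcases hv with rfl | rfl
      · exact Or.inr ⟨hxr, rfl⟩
      · exact absurd rfl huv

/-- A labelling has its values in `N` and is trivial along paths joining any two vertices. -/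
def HasReducedValues {V G : Type*} [DecidableEq V] [Group G] (K : AbstractSimplicialComplex V)
    (c : V → V → G) (N : Subgroup G) : Prop :=
  (∀ u v, ({u, v} : Finset V) ∈ K.faces → c u v ∈ N) ∧
    ∀ u v, Relation.ReflTransGen (fun a b => ({a, b} : Finset V) ∈ K.faces ∧ c a b = 1) u v

/-- On a connected triangulated surface of Euler characteristic at least `1`, the values of every
cocycle can be reduced to a cyclic group. -/
theorem IsTriangulatedSurface.exists_reduced_zpowers [Nonempty V] (hK : IsTriangulatedSurface K)
    (hconn : EdgeConnected K)
    (hχ : (facesOfCard K 2).card + 1 ≤ (facesOfCard K 3).card + Fintype.card V)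
    {G : Type*} [Group G] {c : V → V → G} (hc : IsCocycle K c) :
    ∃ (a : V → G) (x : G), HasReducedValues K (gaugeBy a c) (Subgroup.zpowers x) := by
  obtain ⟨C, hCE, hCcard, hC⟩ := hK.exists_cotree hconn
  obtain ⟨root⟩ := (inferInstance : Nonempty V)
  let r : V → V → Prop := fun a b => a ≠ b ∧ ({a, b} : Finset V) ∈ K.faces ∧ {a, b} ∉ C
  have hrsymm : ∀ a b, r a b → r b a := fun a b h => by
    refine ⟨h.1.symm, ?_⟩
    rw [Finset.pair_comm]
    exact h.2
  -- Connectability by paths avoiding the cotree propagates across a triangle by concatenation.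
  -- Hence the complement of the cotree still connects all vertices and contains a spanning tree.
  have hr : ∀ a b, a ≠ b → ({a, b} : Finset V) ∈ K.faces → Relation.ReflTransGen r a b :=
    hC (Relation.ReflTransGen r)
      (fun a b h => by
        induction h with
        | refl => exact Relation.ReflTransGen.refl
        | tail _ h ih => exact Relation.ReflTransGen.head (hrsymm _ _ h) ih)
      (fun a b h1 h2 h3 => Relation.ReflTransGen.single ⟨h1, h2, h3⟩)
      (fun a b w _ h1 h2 => h1.trans h2)
  have hrc : ∀ v, Relation.ReflTransGen r root v := by
    intro v
    induction hconn root v with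
    | refl => exact Relation.ReflTransGen.refl
    | @tail y z _ hyz ih =>
      by_cases h : y = z
      · exact h ▸ ih
      · exact ih.trans (hr y z h hyz)
  obtain ⟨lev, par, hpar⟩ := exists_parent hrc
  obtain ⟨T, hTE, hTcard, hT⟩ := exists_treeEdges (E := facesOfCard K 2 \ C) hpar
    (fun x y h => Finset.mem_sdiff.2 ⟨mem_facesOfCard.2 ⟨h.2.1, Finset.card_pair h.1⟩, h.2.2⟩)
  obtain ⟨a, -, ha⟩ := exists_tree_gauge c (fun x hx => (hpar x hx).2) 1
  have hg := hc.of_gauge a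
  have htree : ∀ x, x ≠ root → gaugeBy a c (par x) x = 1 := ha
  have hTone : ∀ u v, u ≠ v → ({u, v} : Finset V) ∈ T → gaugeBy a c u v = 1 := by
    intro u v huv h
    have hK2 := (mem_facesOfCard.1 (Finset.mem_sdiff.1 (hTE h)).1).1
    rcases hT u v huv h with ⟨h1, rfl⟩ | ⟨h1, rfl⟩
    · exact htree v h1
    · rw [hg.swap (by rw [Finset.pair_comm]; exact hK2), htree u h1, inv_one]
  -- The number of remaining edges is `E - (F - 1) - (V - 1) = 2 - χ`.
  have hcard : ((facesOfCard K 2 \ C) \ T).card ≤ 1 := by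
    rw [Finset.card_sdiff_of_subset hTE, Finset.card_sdiff_of_subset hCE]
    omega
  obtain ⟨x, hx⟩ : ∃ x, ∀ u v, u ≠ v → ({u, v} : Finset V) ∈ (facesOfCard K 2 \ C) \ T →
      gaugeBy a c u v ∈ Subgroup.zpowers x := by
    rcases Finset.eq_empty_or_nonempty ((facesOfCard K 2 \ C) \ T) with hem | ⟨e, he⟩
    · exact ⟨1, fun u v _ h => by simp [hem] at h⟩
    · have hecard := (mem_facesOfCard.1 (Finset.mem_sdiff.1 (Finset.mem_sdiff.1 he).1).1).2
      have heK := (mem_facesOfCard.1 (Finset.mem_sdiff.1 (Finset.mem_sdiff.1 he).1).1).1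
      obtain ⟨p, q, hpq, rfl⟩ := Finset.card_eq_two.1 hecard
      refine ⟨gaugeBy a c p q, fun u v huv h => ?_⟩
      have heq := Finset.card_le_one.1 hcard _ h _ he
      have hu : u ∈ ({p, q} : Finset V) := by rw [← heq]; simp
      have hv : v ∈ ({p, q} : Finset V) := by rw [← heq]; simp
      simp only [mem_insert, mem_singleton] at hu hv
      rcases hu with rfl | rfl <;> rcases hv with rfl | rfl
      · exact absurd rfl huv
      · exact Subgroup.mem_zpowers _
      · rw [hg.swap heK]
        exact inv_mem (Subgroup.mem_zpowers _)
      · exact absurd rfl huv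
  refine ⟨a, x, ?_, ?_⟩
  -- Membership of the label in the cyclic group holds outside the cotree and passes to the third
  -- side of a triangle by the cocycle identity.
  · have hall := hC (fun u v => ({u, v} : Finset V) ∈ K.faces → gaugeBy a c u v ∈ Subgroup.zpowers x)
      ?_ ?_ ?_
    · intro u v huv
      by_cases h : u = v
      · rw [← h, hg.self]
        exact one_mem _
      · exact hall u v h huv huv
    · intro u v h huv
      have huv' : ({u, v} : Finset V) ∈ K.faces := by rwa [Finset.pair_comm]
      rw [hg.swap huv']
      exact inv_mem (h huv')
    · intro u v huv hK2 hnC _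
      by_cases hT' : ({u, v} : Finset V) ∈ T
      · rw [hTone u v huv hT']
        exact one_mem _
      · exact hx u v huv (Finset.mem_sdiff.2 ⟨Finset.mem_sdiff.2
          ⟨mem_facesOfCard.2 ⟨hK2, Finset.card_pair huv⟩, hnC⟩, hT'⟩)
    · intro u v w h3 h1 h2 _
      have e1 : ({u, w} : Finset V) ∈ K.faces :=
        face_mono h3 (pair_subset (by simp) (by simp)) (Finset.insert_nonempty _ _)
      have e2 : ({w, v} : Finset V) ∈ K.faces :=
        face_mono h3 (pair_subset (by simp) (by simp)) (Finset.insert_nonempty _ _)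
      rw [← hg u w v (by rw [Finset.pair_comm w v]; exact h3)]
      exact mul_mem (h1 e1) (h2 e2)
  · have h1 : ∀ v, Relation.ReflTransGen
        (fun p q => ({p, q} : Finset V) ∈ K.faces ∧ gaugeBy a c p q = 1) root v :=
      reflTransGen_of_parent (lev := lev) (par := par) fun x hxr =>
        ⟨⟨(hpar x hxr).1.2.1, htree x hxr⟩, (hpar x hxr).2⟩
    intro u v
    refine Relation.ReflTransGen.trans ?_ (h1 v)
    induction h1 u with
    | refl => exact Relation.ReflTransGen.refl
    | tail _ h ih =>
      refine Relation.ReflTransGen.head ⟨by rw [Finset.pair_comm]; exact h.1, ?_⟩ ih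
      rw [hg.swap h.1, h.2, inv_one]

/-! ### Surfaces with few vertices -/

theorem IsTriangulatedSurface.four_le_card_closedNeighbourhood {V : Type*} [DecidableEq V]
    {K : AbstractSimplicialComplex V} (hK : IsTriangulatedSurface K)
    (v : V) : ∃ N : Finset V, 4 ≤ N.card ∧ ∀ x ∈ N, ({v, x} : Finset V) ∈ K.faces := by
  obtain ⟨w, hvw, he⟩ := hK.exists_neighbour v
  obtain ⟨a, b, hab, h⟩ := hK.exists_apexes hvw he
  have ha := (h a).2 (Or.inl rfl)
  have hb := (h b).2 (Or.inr rfl)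
  refine ⟨{v, w, a, b}, ?_, ?_⟩
  · rw [Finset.card_insert_of_notMem, Finset.card_insert_of_notMem, Finset.card_pair hab]
    · simp [ha.2.1.symm, hb.2.1.symm]
    · simp [hvw, ha.1.symm, hb.1.symm]
  · intro x hx
    simp only [mem_insert, mem_singleton] at hx
    rcases hx with rfl | rfl | rfl | rfl
    · simpa using K.singleton_mem x
    · exact he
    · exact face_mono ha.2.2 (pair_subset (by simp) (by simp)) (Finset.insert_nonempty _ _)
    · exact face_mono hb.2.2 (pair_subset (by simp) (by simp)) (Finset.insert_nonempty _ _)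

/-- Two closed neighbourhoods with at least four vertices each must meet among seven vertices. -/
theorem IsTriangulatedSurface.edgeConnected (hK : IsTriangulatedSurface K)
    (hV : Fintype.card V ≤ 7) : EdgeConnected K := by
  intro u v
  obtain ⟨M, hM, hMu⟩ := hK.four_le_card_closedNeighbourhood u
  obtain ⟨N, hN, hNv⟩ := hK.four_le_card_closedNeighbourhood v
  have hne : (M ∩ N).Nonempty := by
    by_contra hem
    rw [Finset.not_nonempty_iff_eq_empty] at hem
    have h1 := Finset.card_union_add_card_inter M N
    have h2 := Finset.card_le_univ (M ∪ N)
    rw [hem, Finset.card_empty] at h1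
    omega
  obtain ⟨x, hx⟩ := hne
  rw [Finset.mem_inter] at hx
  refine (Relation.ReflTransGen.single (hMu x hx.1)).tail ?_
  rw [Finset.pair_comm]
  exact hNv x hx.2

theorem card_edges_le {V : Type*} [Fintype V] {K : AbstractSimplicialComplex V} : (facesOfCard K 2).card ≤ (Fintype.card V).choose 2 := by
  have : facesOfCard K 2 ⊆ (univ : Finset V).powersetCard 2 := by
    intro e he
    rw [mem_powersetCard]
    exact ⟨subset_univ _, (mem_facesOfCard.1 he).2⟩
  have h := Finset.card_le_card this
  rwa [Finset.card_powersetCard, Finset.card_univ] at h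

/-- From `3F = 2E` one gets `χ = V - E/3`, and `3` divides `E`. With `E ≤ V(V-1)/2` this leaves only
`V = 7`, `E = 21` with `χ < 1`, and then no edge is missing. -/
theorem IsTriangulatedSurface.euler_or_complete [Nonempty V] (hK : IsTriangulatedSurface K)
    (hV : Fintype.card V ≤ 7) :
    (facesOfCard K 2).card + 1 ≤ (facesOfCard K 3).card + Fintype.card V ∨
      (Fintype.card V = 7 ∧ ∀ u v : V, ({u, v} : Finset V) ∈ K.faces) := by
  have h3 := hK.three_mul_card
  have hle : (facesOfCard K 2).card ≤ (Fintype.card V).choose 2 := card_edges_le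
  have hpos : 0 < Fintype.card V := Fintype.card_pos
  by_cases h : Fintype.card V = 7 ∧ (facesOfCard K 2).card = 21
  · right
    refine ⟨h.1, fun u v => ?_⟩
    by_cases huv : u = v
    · subst huv
      simpa using K.singleton_mem u
    · have hsub : facesOfCard K 2 ⊆ (univ : Finset V).powersetCard 2 := by
        intro e he
        rw [mem_powersetCard]
        exact ⟨subset_univ _, (mem_facesOfCard.1 he).2⟩
      have heq := Finset.eq_of_subset_of_card_le hsub (by
        rw [Finset.card_powersetCard, Finset.card_univ, h.1, h.2]
        decide)
      have : ({u, v} : Finset V) ∈ facesOfCard K 2 := by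
        rw [heq, mem_powersetCard]
        exact ⟨subset_univ _, Finset.card_pair huv⟩
      exact (mem_facesOfCard.1 this).1
  · left
    generalize Fintype.card V = n at *
    generalize (facesOfCard K 2).card = e at *
    generalize (facesOfCard K 3).card = f at *
    interval_cases n <;> simp [Nat.choose] at hle h <;> omega

end Surface

/-! ### The seven-vertex torus -/

/-- A connected graph on six vertices in which all vertices have degree `2` is a hexagon. -/
theorem exists_hexagon {α : Type*} [Fintype α] [DecidableEq α] (hα : Fintype.card α = 6)
    {r : α → α → Prop} (hsymm : ∀ x y, r x y → r y x) (hirr : ∀ x, ¬ r x x)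
    (hdeg : ∀ x, ∃ a b, a ≠ b ∧ ∀ y, r x y ↔ y = a ∨ y = b)
    (hconn : ∀ x y, Relation.ReflTransGen r x y) :
    ∃ w : Fin 6 → α, Function.Bijective w ∧ ∀ i, r (w i) (w (i + 1)) := by
  have hother : ∀ x p, r x p → ∃ q, q ≠ p ∧ r x q ∧ ∀ y, r x y → y = p ∨ y = q := by
    intro x p hxp
    obtain ⟨a, b, hab, h⟩ := hdeg x
    rcases (h p).1 hxp with rfl | rfl
    · exact ⟨b, hab.symm, (h b).2 (Or.inr rfl), fun y hy => (h y).1 hy⟩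
    · exact ⟨a, hab, (h a).2 (Or.inl rfl), fun y hy => ((h y).1 hy).symm⟩
  have huniq : ∀ x p q s, r x p → r x q → r x s → p ≠ q → s = p ∨ s = q := by
    intro x p q s hp hq hs hpq
    obtain ⟨t, -, -, ht⟩ := hother x p hp
    rcases ht q hq with h | h
    · exact absurd h.symm hpq
    · rw [h]
      exact ht s hs
  -- A nonempty set closed under adjacency is everything. So the path `x5, x0, x1, …` built below
  -- cannot close up before it has six vertices.
  have hclosed : ∀ (S : Finset α) (x : α), x ∈ S → (∀ y ∈ S, ∀ z, r y z → z ∈ S) →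
      6 ≤ S.card := by
    intro S x hx hS
    have : S = univ := by
      rw [Finset.eq_univ_iff_forall]
      intro y
      induction hconn x y with
      | refl => exact hx
      | tail _ h ih => exact hS _ ih _ h
    rw [this, Finset.card_univ, hα]
  obtain ⟨x0⟩ : Nonempty α := Fintype.card_pos_iff.1 (by omega)
  obtain ⟨x1, x5, h15, hx0⟩ := hdeg x0
  have h01 : r x0 x1 := (hx0 x1).2 (Or.inl rfl)
  have h05 : r x0 x5 := (hx0 x5).2 (Or.inr rfl)
  obtain ⟨x2, h20, h12, hx1⟩ := hother x1 x0 (hsymm _ _ h01)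
  have n01 : x0 ≠ x1 := fun h => hirr x1 (h ▸ h01)
  have n05 : x0 ≠ x5 := fun h => hirr x5 (h ▸ h05)
  have n12 : x1 ≠ x2 := fun h => hirr x2 (h ▸ h12)
  have n25 : x2 ≠ x5 := by
    rintro rfl
    have := hclosed {x0, x1, x2} x0 (by simp) (by
      intro y hy z hyz
      simp only [mem_insert, mem_singleton] at hy ⊢
      rcases hy with rfl | rfl | rfl
      · rcases (hx0 z).1 hyz with h | h <;> simp [h]
      · rcases hx1 z hyz with h | h <;> simp [h]
      · rcases huniq _ _ _ _ (hsymm _ _ h05) (hsymm _ _ h12) hyz n01 with h | h <;> simp [h])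
    have := Finset.card_le_three (a := x0) (b := x1) (c := x2)
    omega
  obtain ⟨x3, h31, h23, hx2⟩ := hother x2 x1 (hsymm _ _ h12)
  have n23 : x2 ≠ x3 := fun h => hirr x3 (h ▸ h23)
  have n03 : x3 ≠ x0 := by
    rintro rfl
    rcases (hx0 x2).1 (hsymm _ _ h23) with h | h
    exacts [n12 h.symm, n25 h]
  have n35 : x3 ≠ x5 := by
    rintro rfl
    have := hclosed {x0, x1, x2, x3} x0 (by simp) (by
      intro y hy z hyz
      simp only [mem_insert, mem_singleton] at hy ⊢
      rcases hy with rfl | rfl | rfl | rfl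
      · rcases (hx0 z).1 hyz with h | h <;> simp [h]
      · rcases hx1 z hyz with h | h <;> simp [h]
      · rcases hx2 z hyz with h | h <;> simp [h]
      · rcases huniq _ _ _ _ (hsymm _ _ h05) (hsymm _ _ h23) hyz h20.symm with h | h <;> simp [h])
    have := Finset.card_le_four (a := x0) (b := x1) (c := x2) (d := x3)
    omega
  obtain ⟨x4, h42, h34, hx3⟩ := hother x3 x2 (hsymm _ _ h23)
  have n34 : x3 ≠ x4 := fun h => hirr x4 (h ▸ h34)
  have n04 : x4 ≠ x0 := by
    rintro rfl
    rcases (hx0 x3).1 (hsymm _ _ h34) with h | h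
    exacts [h31 h, n35 h]
  have n14 : x4 ≠ x1 := by
    rintro rfl
    rcases hx1 x3 (hsymm _ _ h34) with h | h
    exacts [n03 h, n23 h.symm]
  have n45 : x4 ≠ x5 := by
    rintro rfl
    have := hclosed {x0, x1, x2, x3, x4} x0 (by simp) (by
      intro y hy z hyz
      simp only [mem_insert, mem_singleton] at hy ⊢
      rcases hy with rfl | rfl | rfl | rfl | rfl
      · rcases (hx0 z).1 hyz with h | h <;> simp [h]
      · rcases hx1 z hyz with h | h <;> simp [h]
      · rcases hx2 z hyz with h | h <;> simp [h]
      · rcases hx3 z hyz with h | h <;> simp [h]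
      · rcases huniq _ _ _ _ (hsymm _ _ h05) (hsymm _ _ h34) hyz n03.symm with h | h <;> simp [h])
    have := Finset.card_le_five (a := x0) (b := x1) (c := x2) (d := x3) (e := x4)
    omega
  let w : Fin 6 → α := ![x0, x1, x2, x3, x4, x5]
  have hinj : Function.Injective w := by
    intro i j hij
    fin_cases i <;> fin_cases j <;> first | rfl | (exfalso; simp [w] at hij; grind)
  have hbij : Function.Bijective w :=
    (Fintype.bijective_iff_injective_and_card w).2 ⟨hinj, by simp [hα]⟩
  obtain ⟨y, hy3, h4y, -⟩ := hother x4 x3 (hsymm _ _ h34)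
  -- The neighbours of `x0, …, x3` are already known, so the second neighbour of `x4` can only be
  -- `x5`.
  have hy5 : y = x5 := by
    obtain ⟨i, hi⟩ := hbij.2 y
    fin_cases i
    · have hi : x0 = y := hi
      subst hi
      rcases (hx0 x4).1 (hsymm _ _ h4y) with h | h
      exacts [absurd h n14, absurd h n45]
    · have hi : x1 = y := hi
      subst hi
      rcases hx1 x4 (hsymm _ _ h4y) with h | h
      exacts [absurd h n04, absurd h h42]
    · have hi : x2 = y := hi
      subst hi
      rcases hx2 x4 (hsymm _ _ h4y) with h | h
      exacts [absurd h n14, absurd h n34.symm]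
    · exact absurd hi.symm hy3
    · have hi : x4 = y := hi
      subst hi
      exact absurd h4y (hirr _)
    · exact hi.symm
  subst hy5
  refine ⟨w, hbij, fun i => ?_⟩
  fin_cases i
  exacts [h01, h12, h23, h34, h4y, hsymm _ _ h05]

/-- A labelling of a complex by `Fin 7` that identifies it with Möbius' torus: the two triangles at
the edge `i j` have the third vertices `3 j - 2 i` and `5 j - 4 i`. -/
def IsTorusLabelling {V : Type*} [DecidableEq V] (K : AbstractSimplicialComplex V)
    (e : Fin 7 ≃ V) : Prop :=
  ∀ i j, i ≠ j → ∀ k, (k ≠ i ∧ k ≠ j ∧ ({e i, e j, e k} : Finset V) ∈ K.faces) ↔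
    k = 3 * j - 2 * i ∨ k = 5 * j - 4 * i

/-- Every edge of the seven-vertex torus lies in two of the fourteen listed triangles, and an edge
of a surface lies in no further triangle. So the presence of these triangles already determines the
complex. -/
theorem isTorusLabelling_of_faces {V : Type*} [DecidableEq V] {K : AbstractSimplicialComplex V}
    (hK : IsTriangulatedSurface K) {e : Fin 7 ≃ V}
    (h1 : ∀ i, ({e i, e (i + 1), e (i + 3)} : Finset V) ∈ K.faces)
    (h2 : ∀ i, ({e i, e (i + 2), e (i + 3)} : Finset V) ∈ K.faces) : IsTorusLabelling K e := by
  have hface : ∀ s : Finset (Fin 7), (∃ i : Fin 7, s = {i, i + 1, i + 3} ∨ s = {i, i + 2, i + 3}) →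
      s.image e ∈ K.faces := by
    rintro _ ⟨i, rfl | rfl⟩
    · simpa [Finset.image_insert] using h1 i
    · simpa [Finset.image_insert] using h2 i
  have htri : ∀ i j k : Fin 7, (∃ x : Fin 7, ({i, j, k} : Finset (Fin 7)) = {x, x + 1, x + 3} ∨
      ({i, j, k} : Finset (Fin 7)) = {x, x + 2, x + 3}) →
      ({e i, e j, e k} : Finset V) ∈ K.faces := by
    intro i j k h
    simpa [Finset.image_insert] using hface _ h
  have hdec : ∀ i j : Fin 7, i ≠ j →
      (3 * j - 2 * i ≠ i ∧ 3 * j - 2 * i ≠ j ∧ 5 * j - 4 * i ≠ i ∧ 5 * j - 4 * i ≠ j ∧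
        3 * j - 2 * i ≠ 5 * j - 4 * i) ∧
      (∃ x : Fin 7, ({i, j, 3 * j - 2 * i} : Finset (Fin 7)) = {x, x + 1, x + 3} ∨
        ({i, j, 3 * j - 2 * i} : Finset (Fin 7)) = {x, x + 2, x + 3}) ∧
      (∃ x : Fin 7, ({i, j, 5 * j - 4 * i} : Finset (Fin 7)) = {x, x + 1, x + 3} ∨
        ({i, j, 5 * j - 4 * i} : Finset (Fin 7)) = {x, x + 2, x + 3}) := by decide
  intro i j hij k
  obtain ⟨⟨n1, n2, n3, n4, n5⟩, t1, t2⟩ := hdec i j hij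
  have f1 := htri _ _ _ t1
  have f2 := htri _ _ _ t2
  have hedge : ({e i, e j} : Finset V) ∈ K.faces :=
    face_mono f1 (pair_subset (by simp) (by simp)) (Finset.insert_nonempty _ _)
  obtain ⟨a, b, hab, h⟩ := hK.exists_apexes (e.injective.ne hij) hedge
  have m1 := (h _).1 ⟨e.injective.ne n1, e.injective.ne n2, f1⟩
  have m2 := (h _).1 ⟨e.injective.ne n3, e.injective.ne n4, f2⟩
  have n5' := e.injective.ne n5
  constructor
  · rintro ⟨hk1, hk2, hk⟩
    have m3 := (h _).1 ⟨e.injective.ne hk1, e.injective.ne hk2, hk⟩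
    have : e k = e (3 * j - 2 * i) ∨ e k = e (5 * j - 4 * i) := by
      rcases m1 with m1 | m1 <;> rcases m2 with m2 | m2 <;> rcases m3 with m3 | m3 <;>
        simp_all
    exact this.imp (fun h => e.injective h) fun h => e.injective h
  · rintro (rfl | rfl)
    exacts [⟨n1, n2, f1⟩, ⟨n3, n4, f2⟩]

/-- In a complete triangulated surface with seven vertices, no link contains a triangle. -/
theorem IsTriangulatedSurface.no_three_triangles {V : Type*} [DecidableEq V] [Fintype V]
    {K : AbstractSimplicialComplex V} (hK : IsTriangulatedSurface K) (hV : Fintype.card V = 7)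
    (hcomplete : ∀ u v : V, ({u, v} : Finset V) ∈ K.faces) {x a b c : V} (xa : x ≠ a)
    (xb : x ≠ b) (xc : x ≠ c) (hab : ({x, a, b} : Finset V) ∈ K.faces)
    (hbc : ({x, b, c} : Finset V) ∈ K.faces) (hac : ({x, a, c} : Finset V) ∈ K.faces)
    (nab : a ≠ b) (nbc : b ≠ c) (nac : a ≠ c) : False := by
  have perm3 : ∀ {a b c : V} {s : Finset V}, ({a, b, c} : Finset V) ∈ K.faces → s = {a, b, c} →
      s ∈ K.faces := fun h hs => hs ▸ h
  -- In the link of `x` each of `a`, `b`, `c` already has its two neighbours among the others, so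
  -- the connected link consists of these three vertices, and the complex would have four vertices
  -- instead of seven.
  have hsub : (univ : Finset V) ⊆ {x, a, b, c} := by
    intro y _
    by_cases hyx : y = x
    · simp [hyx]
    have hl : ∀ z : V, z ≠ x → ({z} : Finset V) ∈ (vertexLink K x).faces := fun z hz =>
      ⟨Finset.singleton_nonempty _, by simpa using hz.symm, hcomplete x z⟩
    have hpath := (hK x).connected a y (hl a xa.symm) (hl y hyx)
    have key : ∀ {z}, Relation.ReflTransGen
        (fun a b => ({a, b} : Finset V) ∈ (vertexLink K x).faces) a z →
        z = a ∨ z = b ∨ z = c := by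
      intro z hz
      induction hz with
      | refl => exact Or.inl rfl
      | @tail p q _ hpq ih =>
        obtain ⟨-, hx, hf⟩ := hpq
        simp only [mem_insert, mem_singleton, not_or] at hx
        by_cases hpq : p = q
        · exact hpq ▸ ih
        have two : ∀ p' s t : V, x ≠ p' → s ≠ t → s ≠ x → s ≠ p' → t ≠ x → t ≠ p' →
            ({x, p', s} : Finset V) ∈ K.faces → ({x, p', t} : Finset V) ∈ K.faces → p = p' →
            q = s ∨ q = t := by
          intro p' s t hxp hst h1 h2 h3 h4 hs ht hpp
          subst hpp
          obtain ⟨g, g', -, hg⟩ := hK.exists_apexes hxp (hcomplete x p)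
          have e1 := (hg s).1 ⟨h1, h2, hs⟩
          have e2 := (hg t).1 ⟨h3, h4, ht⟩
          have e3 := (hg q).1 ⟨fun h => hx.2 h.symm, fun h => hpq h.symm, hf⟩
          rcases e1 with e1 | e1 <;> rcases e2 with e2 | e2 <;> rcases e3 with e3 | e3 <;>
            simp_all
        rcases ih with h | h | h
        · have := two a b c xa nbc xb.symm nab.symm xc.symm nac.symm hab hac h
          tauto
        · have := two b a c xb nac xa.symm nab xc.symm nbc.symm
            (perm3 hab (by rw [Finset.pair_comm])) hbc h
          tauto
        · have := two c a b xc nab xa.symm nac xb.symm nbc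
            (perm3 hac (by rw [Finset.pair_comm])) (perm3 hbc (by rw [Finset.pair_comm])) h
          tauto
    rcases key hpath with h | h | h <;> simp [h]
  have h1 := Finset.card_le_card hsub
  have h2 := Finset.card_le_four (a := x) (b := a) (c := b) (d := c)
  rw [Finset.card_univ, hV] at h1
  omega

/-- In a complete triangulated surface with seven vertices, the link of a vertex is a hexagon. -/
theorem IsTriangulatedSurface.exists_hexagon_link {V : Type*} [DecidableEq V] [Fintype V]
    {K : AbstractSimplicialComplex V} (hK : IsTriangulatedSurface K) (hV : Fintype.card V = 7)
    (hcomplete : ∀ u v : V, ({u, v} : Finset V) ∈ K.faces) :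
    ∃ (v₀ : V) (W : Fin 6 → V), Function.Injective W ∧ (∀ i, W i ≠ v₀) ∧
      ∀ i, ({v₀, W i, W (i + 1)} : Finset V) ∈ K.faces := by
  obtain ⟨v₀⟩ : Nonempty V := Fintype.card_pos_iff.1 (by omega)
  have hα : Fintype.card {x : V // x ≠ v₀} = 6 := by
    rw [Fintype.card_subtype_compl, hV, Fintype.card_subtype_eq]
  obtain ⟨w, hw, hr⟩ := exists_hexagon (α := {x // x ≠ v₀}) hα
    (r := fun x y => x ≠ y ∧ ({v₀, x.1, y.1} : Finset V) ∈ K.faces)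
    (fun x y h => ⟨h.1.symm, by rw [Finset.pair_comm]; exact h.2⟩) (fun x h => h.1 rfl)
    (by
      rintro ⟨x, hx⟩
      obtain ⟨a, b, hab, h⟩ := hK.exists_apexes (Ne.symm hx) (hcomplete v₀ x)
      have ha := (h a).2 (Or.inl rfl)
      have hb := (h b).2 (Or.inr rfl)
      refine ⟨⟨a, ha.1⟩, ⟨b, hb.1⟩, fun h => hab (congrArg Subtype.val h), ?_⟩
      rintro ⟨y, hy⟩
      have := h y
      simp only [ne_eq, Subtype.mk.injEq]
      rw [← this]
      constructor
      · rintro ⟨h1, h2⟩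
        exact ⟨hy, fun h => h1 h.symm, h2⟩
      · rintro ⟨-, h1, h2⟩
        exact ⟨fun h => h1 h.symm, h2⟩)
    (by
      rintro ⟨x, hx⟩ ⟨y, hy⟩
      have hl : ∀ z : V, z ≠ v₀ → ({z} : Finset V) ∈ (vertexLink K v₀).faces := fun z hz =>
        ⟨Finset.singleton_nonempty _, by simpa using hz.symm, hcomplete v₀ z⟩
      have hpath := (hK v₀).connected x y (hl x hx) (hl y hy)
      have key : ∀ {z}, Relation.ReflTransGen
          (fun a b => ({a, b} : Finset V) ∈ (vertexLink K v₀).faces) x z → ∀ hz : z ≠ v₀,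
          Relation.ReflTransGen (fun x y : {x // x ≠ v₀} => x ≠ y ∧ ({v₀, x.1, y.1} : Finset V) ∈ K.faces)
            ⟨x, hx⟩ ⟨z, hz⟩ := by
        intro z hz
        induction hz with
        | refl => exact fun _ => Relation.ReflTransGen.refl
        | @tail p q _ hpq ih =>
          obtain ⟨-, hx, hf⟩ := hpq
          simp only [mem_insert, mem_singleton, not_or] at hx
          intro hz
          by_cases hpq : p = q
          · subst hpq
            exact ih _
          · exact (ih (fun h => hx.1 h.symm)).tail ⟨fun h => hpq (congrArg Subtype.val h), hf⟩
      exact key hpath hy)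
  exact ⟨v₀, fun i => (w i).1, fun i j h => hw.1 (Subtype.ext h), fun i => (w i).2,
    fun i => (hr i).2⟩

/-- The equations satisfied by the indicators `F (2 ^ i + 2 ^ j + 2 ^ k)` of the triangles
`W i, W j, W k` off the vertex `v₀` whose link is the hexagon `W`. -/
theorem IsTriangulatedSurface.exists_triangle_indicator {V : Type*} [DecidableEq V] [Fintype V]
    {K : AbstractSimplicialComplex V} (hK : IsTriangulatedSurface K) (hV : Fintype.card V = 7)
    (hcomplete : ∀ u v : V, ({u, v} : Finset V) ∈ K.faces) {v₀ : V} {W : Fin 6 → V}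
    (hWinj : Function.Injective W) (hW0 : ∀ i, W i ≠ v₀)
    (hWr : ∀ i, ({v₀, W i, W (i + 1)} : Finset V) ∈ K.faces) :
    ∃ F : ℕ → ℕ, (∀ n, F n ≤ 1) ∧
      (∀ i j k : Fin 6, i ≠ j → i ≠ k → j ≠ k →
        (F (2 ^ (i : ℕ) + 2 ^ (j : ℕ) + 2 ^ (k : ℕ)) = 1 ↔
          ({W i, W j, W k} : Finset V) ∈ K.faces)) ∧
      (∀ i j : Fin 6, i ≠ j → (if j = i + 1 ∨ i = j + 1 then 1 else 0) +
        ∑ k : Fin 6, (if k ≠ i ∧ k ≠ j then F (2 ^ (i : ℕ) + 2 ^ (j : ℕ) + 2 ^ (k : ℕ)) else 0)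
          = 2) ∧
      ∀ i : Fin 6, F (2 ^ (i : ℕ) + 2 ^ ((i + 1 : Fin 6) : ℕ) +
        2 ^ ((i + 2 : Fin 6) : ℕ)) = 0 := by
  have perm3 : ∀ {a b c : V} {s : Finset V}, ({a, b, c} : Finset V) ∈ K.faces → s = {a, b, c} →
      s ∈ K.faces := fun h hs => hs ▸ h
  classical
  -- A triple of hexagon vertices is coded by its bit mask. This makes the indicator symmetric in
  -- the three vertices and turns the edge conditions into linear equations between explicit
  -- numbers.
  let F : ℕ → ℕ := fun n =>
    if ((univ.filter fun i : Fin 6 => n.testBit i).image W) ∈ K.faces then 1 else 0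
  have hFle : ∀ n, F n ≤ 1 := fun n => by
    simp only [F]
    split_ifs <;> omega
  have hbits : ∀ i j k : Fin 6, i ≠ j → i ≠ k → j ≠ k →
      (univ.filter fun l : Fin 6 => (2 ^ (i : ℕ) + 2 ^ (j : ℕ) + 2 ^ (k : ℕ)).testBit l) =
        {i, j, k} := by decide
  have hF : ∀ i j k : Fin 6, i ≠ j → i ≠ k → j ≠ k →
      (F (2 ^ (i : ℕ) + 2 ^ (j : ℕ) + 2 ^ (k : ℕ)) = 1 ↔
        ({W i, W j, W k} : Finset V) ∈ K.faces) := by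
    intro i j k hij hik hjk
    simp only [F, hbits i j k hij hik hjk]
    simp [Finset.image_insert]
  -- Each edge `W i, W j` has exactly two apexes; one of them is `v₀` precisely for the edges of the
  -- hexagon.
  have hsum : ∀ i j : Fin 6, i ≠ j →
      (if ({v₀, W i, W j} : Finset V) ∈ K.faces then 1 else 0) +
        ∑ k : Fin 6, (if k ≠ i ∧ k ≠ j then F (2 ^ (i : ℕ) + 2 ^ (j : ℕ) + 2 ^ (k : ℕ)) else 0)
          = 2 := by
    intro i j hij
    obtain ⟨a, b, hab, h⟩ := hK.exists_apexes (hWinj.ne hij) (hcomplete _ _)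
    have h1 : (univ.filter fun x : V => x ≠ W i ∧ x ≠ W j ∧
        ({W i, W j, x} : Finset V) ∈ K.faces) = {a, b} := by
      ext x
      simp only [mem_filter, mem_univ, true_and, mem_insert, mem_singleton]
      exact h x
    have h2 : ∑ x : V, (if x ≠ W i ∧ x ≠ W j ∧ ({W i, W j, x} : Finset V) ∈ K.faces then 1 else 0)
        = 2 := by
      rw [← Finset.card_filter, h1, Finset.card_pair hab]
    rw [← Finset.add_sum_erase _ _ (mem_univ v₀)] at h2
    have h3 : ∀ g : V → ℕ, ∑ x ∈ univ.erase v₀, g x = ∑ k : Fin 6, g (W k) := by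
      intro g
      have : univ.erase v₀ = univ.image W := by
        ext x
        simp only [mem_erase, mem_univ, and_true, mem_image, true_and]
        constructor
        · intro hx
          have hne : (⟨x, hx⟩ : {x // x ≠ v₀}) ∈ Set.range fun k => (⟨W k, hW0 k⟩ : {x // x ≠ v₀}) := by
            have hb := (Fintype.bijective_iff_injective_and_card
              fun k => (⟨W k, hW0 k⟩ : {x // x ≠ v₀})).2
              ⟨fun i j h => hWinj (congrArg Subtype.val h), by
                rw [Fintype.card_subtype_compl, hV, Fintype.card_subtype_eq, Fintype.card_fin]⟩
            exact hb.2 _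
          obtain ⟨k, hk⟩ := hne
          exact ⟨k, congrArg Subtype.val hk⟩
        · rintro ⟨k, rfl⟩
          exact hW0 k
      rw [this, Finset.sum_image (fun x _ y _ h => hWinj h)]
    rw [h3] at h2
    refine Eq.trans ?_ h2
    congr 1
    · have e : ({W i, W j, v₀} : Finset V) = {v₀, W i, W j} := by
        ext x
        simp only [mem_insert, mem_singleton]
        tauto
      simp [(hW0 i).symm, (hW0 j).symm, e]
    · refine Finset.sum_congr rfl fun k _ => ?_
      by_cases hk : k ≠ i ∧ k ≠ j
      · rw [if_pos hk]
        have := hF i j k hij hk.1.symm hk.2.symm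
        have hle := hFle (2 ^ (i : ℕ) + 2 ^ (j : ℕ) + 2 ^ (k : ℕ))
        by_cases hm : ({W i, W j, W k} : Finset V) ∈ K.faces
        · rw [if_pos ⟨hWinj.ne hk.1, hWinj.ne hk.2, hm⟩]
          exact this.2 hm
        · rw [if_neg fun h => hm h.2.2]
          have := mt this.1 hm
          omega
      · rw [if_neg hk, if_neg fun h => hk ⟨fun h' => h.1 (h' ▸ rfl), fun h' => h.2.1 (h' ▸ rfl)⟩]
  have hhex : ∀ i j : Fin 6, i ≠ j → (({v₀, W i, W j} : Finset V) ∈ K.faces ↔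
      j = i + 1 ∨ i = j + 1) := by
    intro i j hij
    constructor
    · intro hm
      obtain ⟨a, b, -, h⟩ := hK.exists_apexes (hW0 i).symm (hcomplete v₀ (W i))
      have d : ∀ i : Fin 6, i + 1 ≠ i ∧ i - 1 ≠ i ∧ i + 1 ≠ i - 1 ∧ i - 1 + 1 = i := by decide
      obtain ⟨d1, d2, d3, d4⟩ := d i
      have hp := hWr (i - 1)
      rw [d4, Finset.pair_comm] at hp
      have m1 := (h (W (i + 1))).1 ⟨hW0 _, hWinj.ne d1, hWr i⟩
      have m2 := (h (W (i - 1))).1 ⟨hW0 _, hWinj.ne d2, hp⟩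
      have m3 := (h (W j)).1 ⟨hW0 _, hWinj.ne hij.symm, hm⟩
      have n := hWinj.ne d3
      have : W j = W (i + 1) ∨ W j = W (i - 1) := by
        rcases m1 with m1 | m1 <;> rcases m2 with m2 | m2 <;> rcases m3 with m3 | m3 <;>
          simp_all
      rcases this with h | h
      · exact Or.inl (hWinj h)
      · right
        rw [hWinj h, d4]
    · rintro (rfl | rfl)
      · exact hWr i
      · rw [Finset.pair_comm]
        exact hWr j
  have hzero : ∀ i : Fin 6, F (2 ^ (i : ℕ) + 2 ^ ((i + 1 : Fin 6) : ℕ) +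
      2 ^ ((i + 2 : Fin 6) : ℕ)) = 0 := by
    intro i
    have d : ∀ i : Fin 6, i ≠ i + 1 ∧ i ≠ i + 2 ∧ i + 1 ≠ i + 2 ∧ i + 1 + 1 = i + 2 := by decide
    obtain ⟨d1, d2, d3, d4⟩ := d i
    have hle := hFle (2 ^ (i : ℕ) + 2 ^ ((i + 1 : Fin 6) : ℕ) + 2 ^ ((i + 2 : Fin 6) : ℕ))
    by_contra hne
    have hm := (hF i (i + 1) (i + 2) d1 d2 d3).1 (by omega)
    have h2 := hWr (i + 1)
    rw [d4] at h2
    -- Together with the two triangles at `v₀`, a triangle on three consecutive hexagon vertices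
    -- would close the link of the middle one to a 3-cycle.
    refine hK.no_three_triangles hV hcomplete (x := W (i + 1)) (a := W i) (b := v₀) (c := W (i + 2)) (hWinj.ne d1.symm) (hW0 _) (hWinj.ne d3)
      (perm3 (hWr i) ?_) (perm3 h2 ?_) (perm3 hm ?_) (hW0 _) (hW0 _).symm (hWinj.ne d2)
    all_goals
      ext x
      simp only [mem_insert, mem_singleton]
      tauto
  refine ⟨F, hFle, hF, fun i j hij => ?_, hzero⟩
  have := hsum i j hij
  simp only [hhex i j hij] at this
  exact this


/-- The numbers `aᵢ` and `bᵢ` indicate the two possible second triangles at the `i`-th hexagon edge,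
with the third vertex two or three places past its end; `c` and `d` indicate the two triangles of
alternating vertices. Once `c = d = 1`, each short diagonal links two further indicators by an
equation, and with the long diagonals the value of `a₁` decides all the others. -/
theorem linear_triangle_equations {a₁ a₂ a₃ a₄ a₅ a₆ b₁ b₂ b₃ b₄ b₅ b₆ c d : ℕ} (hc : c ≤ 1)
    (hd : d ≤ 1) (ha : a₁ ≤ 1) (hb : b₁ ≤ 1) (hcd : c + d = 2) (h₁ : a₁ + b₁ = 1)
    (h₂ : a₂ + b₂ = 1) (h₃ : b₃ + a₃ = 1) (h₄ : a₄ + b₄ = 1) (h₅ : a₅ + b₅ = 1)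
    (h₆ : a₆ + b₆ = 1) (k₁ : b₃ + c + a₆ = 2) (k₂ : a₁ + b₄ + d = 2) (k₃ : c + a₂ + b₅ = 2)
    (k₄ : b₆ + d + a₃ = 2) (k₅ : b₁ + c + a₄ = 2) (k₆ : b₂ + d + a₅ = 2) 
    (k₇ : a₁ + b₃ + a₄ + b₆ = 2) (k₈ : b₁ + a₂ + b₄ + a₅ = 2) (k₉ : a₆ + b₂ + a₃ + b₅ = 2) :
    c = 1 ∧ d = 1 ∧
      ((a₁ = 1 ∧ a₂ = 1 ∧ a₃ = 1 ∧ a₄ = 1 ∧ a₅ = 1 ∧ a₆ = 1) ∨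
       (b₁ = 1 ∧ b₂ = 1 ∧ b₃ = 1 ∧ b₄ = 1 ∧ b₅ = 1 ∧ b₆ = 1)) := by
  obtain rfl : c = 1 := by omega
  obtain rfl : d = 1 := by omega
  refine ⟨rfl, rfl, ?_⟩
  obtain rfl | rfl : a₁ = 0 ∨ a₁ = 1 := by omega
  · right
    obtain rfl : b₁ = 1 := by omega
    obtain rfl : b₄ = 1 := by omega
    obtain rfl : a₄ = 0 := by omega
    refine ⟨rfl, ?_⟩
    omega
  · left
    obtain rfl : b₁ = 0 := by omega
    obtain rfl : b₄ = 0 := by omega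
    obtain rfl : a₄ = 1 := by omega
    refine ⟨rfl, ?_⟩
    omega

theorem triangle_equations {F : ℕ → ℕ} (hF : ∀ n, F n ≤ 1)
    (hs : ∀ i j : Fin 6, i ≠ j → (if j = i + 1 ∨ i = j + 1 then 1 else 0) +
      ∑ k : Fin 6, (if k ≠ i ∧ k ≠ j then F (2 ^ (i : ℕ) + 2 ^ (j : ℕ) + 2 ^ (k : ℕ)) else 0) = 2)
    (hz : ∀ i : Fin 6, F (2 ^ (i : ℕ) + 2 ^ ((i + 1 : Fin 6) : ℕ) +
      2 ^ ((i + 2 : Fin 6) : ℕ)) = 0) :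
    F 21 = 1 ∧ F 42 = 1 ∧
      ((F 11 = 1 ∧ F 22 = 1 ∧ F 44 = 1 ∧ F 25 = 1 ∧ F 50 = 1 ∧ F 37 = 1) ∨
       (F 19 = 1 ∧ F 38 = 1 ∧ F 13 = 1 ∧ F 26 = 1 ∧ F 52 = 1 ∧ F 41 = 1)) := by
  have z0 : F 7 = 0 := hz 0
  have z1 : F 14 = 0 := hz 1
  have z2 : F 28 = 0 := hz 2
  have z3 : F 56 = 0 := hz 3
  have z4 : F 49 = 0 := hz 4
  have z5 : F 35 = 0 := hz 5
  have s01 : 1 + (0 + 0 + F 7 + F 11 + F 19 + F 35) = 2 := by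
    rw [← hs 0 1 (by decide), Fin.sum_univ_six]
    rfl
  have s02 : 0 + (0 + F 7 + 0 + F 13 + F 21 + F 37) = 2 := by
    rw [← hs 0 2 (by decide), Fin.sum_univ_six]
    rfl
  have s03 : 0 + (0 + F 11 + F 13 + 0 + F 25 + F 41) = 2 := by
    rw [← hs 0 3 (by decide), Fin.sum_univ_six]
    rfl
  have s04 : 0 + (0 + F 19 + F 21 + F 25 + 0 + F 49) = 2 := by
    rw [← hs 0 4 (by decide), Fin.sum_univ_six]
    rfl
  have s05 : 1 + (0 + F 35 + F 37 + F 41 + F 49 + 0) = 2 := by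
    rw [← hs 0 5 (by decide), Fin.sum_univ_six]
    rfl
  have s12 : 1 + (F 7 + 0 + 0 + F 14 + F 22 + F 38) = 2 := by
    rw [← hs 1 2 (by decide), Fin.sum_univ_six]
    rfl
  have s13 : 0 + (F 11 + 0 + F 14 + 0 + F 26 + F 42) = 2 := by
    rw [← hs 1 3 (by decide), Fin.sum_univ_six]
    rfl
  have s14 : 0 + (F 19 + 0 + F 22 + F 26 + 0 + F 50) = 2 := by
    rw [← hs 1 4 (by decide), Fin.sum_univ_six]
    rfl
  have s15 : 0 + (F 35 + 0 + F 38 + F 42 + F 50 + 0) = 2 := by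
    rw [← hs 1 5 (by decide), Fin.sum_univ_six]
    rfl
  have s23 : 1 + (F 13 + F 14 + 0 + 0 + F 28 + F 44) = 2 := by
    rw [← hs 2 3 (by decide), Fin.sum_univ_six]
    rfl
  have s24 : 0 + (F 21 + F 22 + 0 + F 28 + 0 + F 52) = 2 := by
    rw [← hs 2 4 (by decide), Fin.sum_univ_six]
    rfl
  have s25 : 0 + (F 37 + F 38 + 0 + F 44 + F 52 + 0) = 2 := by
    rw [← hs 2 5 (by decide), Fin.sum_univ_six]
    rfl
  have s34 : 1 + (F 25 + F 26 + F 28 + 0 + 0 + F 56) = 2 := by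
    rw [← hs 3 4 (by decide), Fin.sum_univ_six]
    rfl
  have s35 : 0 + (F 41 + F 42 + F 44 + 0 + F 56 + 0) = 2 := by
    rw [← hs 3 5 (by decide), Fin.sum_univ_six]
    rfl
  have s45 : 1 + (F 49 + F 50 + F 52 + F 56 + 0 + 0) = 2 := by
    rw [← hs 4 5 (by decide), Fin.sum_univ_six]
    rfl
  -- Summing the equations of the six short diagonals counts each of the twelve `aᵢ`, `bᵢ` once,
  -- with total 6, and the two alternating triangles three times each: `6 + 3(c + d) = 12`.
  have p42 : F 21 + F 42 = 2 := by
    clear hs hz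
    omega
  exact linear_triangle_equations (hF 21) (hF 42) (hF 11) (hF 19) p42 (by omega) (by omega)
    (by omega) (by omega) (by omega) (by omega) (by omega) (by omega) (by omega) (by omega)
    (by omega) (by omega) (by omega) (by omega) (by omega)

theorem exists_torusLabelling_of_list {V : Type*} [DecidableEq V] [Fintype V]
    {K : AbstractSimplicialComplex V} (hK : IsTriangulatedSurface K) (f : Fin 7 ≃ V)
    (L : List (Finset (Fin 7))) (hL : ∀ s ∈ L, s.image f ∈ K.faces) (p : Equiv.Perm (Fin 7))
    (h1 : ∀ i, ({p i, p (i + 1), p (i + 3)} : Finset (Fin 7)) ∈ L)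
    (h2 : ∀ i, ({p i, p (i + 2), p (i + 3)} : Finset (Fin 7)) ∈ L) :
    ∃ e : Fin 7 ≃ V, IsTorusLabelling K e := by
  refine ⟨p.trans f, isTorusLabelling_of_faces hK (fun i => ?_) fun i => ?_⟩
  · simpa [Finset.image_insert] using hL _ (h1 i)
  · simpa [Finset.image_insert] using hL _ (h2 i)

/-- A complete triangulated surface with seven vertices is Möbius' torus. -/
theorem IsTriangulatedSurface.exists_torusLabelling {V : Type*} [DecidableEq V] [Fintype V]
    {K : AbstractSimplicialComplex V} (hK : IsTriangulatedSurface K) (hV : Fintype.card V = 7)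
    (hcomplete : ∀ u v : V, ({u, v} : Finset V) ∈ K.faces) :
    ∃ e : Fin 7 ≃ V, IsTorusLabelling K e := by
  obtain ⟨v₀, W, hWinj, hW0, hWr⟩ := hK.exists_hexagon_link hV hcomplete
  obtain ⟨F, hF, hface, hs, hz⟩ := hK.exists_triangle_indicator hV hcomplete hWinj hW0 hWr
  have hinj : Function.Injective (Fin.cons v₀ W : Fin 7 → V) :=
    Fin.cons_injective_iff.2 ⟨fun ⟨i, hi⟩ => hW0 i hi, hWinj⟩
  let f : Fin 7 ≃ V := Equiv.ofBijective _
    ((Fintype.bijective_iff_injective_and_card _).2 ⟨hinj, by simp [hV]⟩)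
  have hex : ∀ s ∈ ([{0, 1, 2}, {0, 2, 3}, {0, 3, 4}, {0, 4, 5}, {0, 5, 6}, {0, 6, 1}] :
      List (Finset (Fin 7))), s.image f ∈ K.faces := by
    intro s hs
    simp only [List.mem_cons, List.not_mem_nil, or_false] at hs
    rcases hs with rfl | rfl | rfl | rfl | rfl | rfl
    · rw [Finset.image_insert, Finset.image_insert, Finset.image_singleton]
      exact hWr 0
    · rw [Finset.image_insert, Finset.image_insert, Finset.image_singleton]
      exact hWr 1
    · rw [Finset.image_insert, Finset.image_insert, Finset.image_singleton]
      exact hWr 2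
    · rw [Finset.image_insert, Finset.image_insert, Finset.image_singleton]
      exact hWr 3
    · rw [Finset.image_insert, Finset.image_insert, Finset.image_singleton]
      exact hWr 4
    · rw [Finset.image_insert, Finset.image_insert, Finset.image_singleton]
      exact hWr 5
  have htri : ∀ i j k : Fin 6, i ≠ j → i ≠ k → j ≠ k →
      F (2 ^ (i : ℕ) + 2 ^ (j : ℕ) + 2 ^ (k : ℕ)) = 1 →
      ({i.succ, j.succ, k.succ} : Finset (Fin 7)).image f ∈ K.faces := by
    intro i j k h1 h2 h3 h
    rw [Finset.image_insert, Finset.image_insert, Finset.image_singleton]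
    exact (hface i j k h1 h2 h3).1 h
  obtain ⟨h21, h42, ⟨a1, a2, a3, a4, a5, a6⟩ | ⟨b1, b2, b3, b4, b5, b6⟩⟩ :=
    triangle_equations hF hs hz
  -- Label `0` is `v₀` and label `i + 1` is `W i`. The six triangles at `v₀` and the eight just
  -- determined make up all fourteen, and the permutation is an explicit isomorphism from the
  -- standard model. The other case differs only in the list and the permutation.
  · refine exists_torusLabelling_of_list hK f ([{0, 1, 2}, {0, 2, 3}, {0, 3, 4}, {0, 4, 5},
      {0, 5, 6}, {0, 6, 1}] ++ [{1, 3, 5}, {2, 4, 6}, {1, 2, 4}, {2, 3, 5}, {3, 4, 6}, {4, 5, 1},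
      {5, 6, 2}, {6, 1, 3}]) ?_
      ⟨![0, 1, 5, 6, 3, 2, 4], ![0, 1, 5, 4, 6, 2, 3], by decide, by decide⟩ (by decide)
      (by decide)
    intro s hs
    rcases List.mem_append.1 hs with hs | hs
    · exact hex s hs
    simp only [List.mem_cons, List.not_mem_nil, or_false] at hs
    rcases hs with rfl | rfl | rfl | rfl | rfl | rfl | rfl | rfl
    · exact htri 0 2 4 (by decide) (by decide) (by decide) h21
    · exact htri 1 3 5 (by decide) (by decide) (by decide) h42
    · exact htri 0 1 3 (by decide) (by decide) (by decide) a1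
    · exact htri 1 2 4 (by decide) (by decide) (by decide) a2
    · exact htri 2 3 5 (by decide) (by decide) (by decide) a3
    · exact htri 3 4 0 (by decide) (by decide) (by decide) a4
    · exact htri 4 5 1 (by decide) (by decide) (by decide) a5
    · exact htri 5 0 2 (by decide) (by decide) (by decide) a6
  · refine exists_torusLabelling_of_list hK f ([{0, 1, 2}, {0, 2, 3}, {0, 3, 4}, {0, 4, 5},
      {0, 5, 6}, {0, 6, 1}] ++ [{1, 3, 5}, {2, 4, 6}, {1, 2, 5}, {2, 3, 6}, {3, 4, 1}, {4, 5, 2},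
      {5, 6, 3}, {6, 1, 4}]) ?_
      ⟨![0, 1, 3, 2, 5, 6, 4], ![0, 1, 3, 2, 6, 4, 5], by decide, by decide⟩ (by decide)
      (by decide)
    intro s hs
    rcases List.mem_append.1 hs with hs | hs
    · exact hex s hs
    simp only [List.mem_cons, List.not_mem_nil, or_false] at hs
    rcases hs with rfl | rfl | rfl | rfl | rfl | rfl | rfl | rfl
    · exact htri 0 2 4 (by decide) (by decide) (by decide) h21
    · exact htri 1 3 5 (by decide) (by decide) (by decide) h42
    · exact htri 0 1 4 (by decide) (by decide) (by decide) b1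
    · exact htri 1 2 5 (by decide) (by decide) (by decide) b2
    · exact htri 2 3 0 (by decide) (by decide) (by decide) b3
    · exact htri 3 4 1 (by decide) (by decide) (by decide) b4
    · exact htri 4 5 2 (by decide) (by decide) (by decide) b5
    · exact htri 5 0 3 (by decide) (by decide) (by decide) b6

/-- The labels of the third vertices of the two triangles of Möbius' torus at the edge `i j`. -/
def torusApexes (i j : Fin 7) : List (Fin 7) := [3 * j - 2 * i, 5 * j - 4 * i]

-- Here `pᵢ` is the image of the label `i` under an automorphism. Each image is one of the two
-- apexes over an edge already placed, and the inequalities exclude the wrong choice, so the images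
-- of 0 and 1 determine an affine map.
set_option synthInstance.maxSize 2000 in
set_option synthInstance.maxHeartbeats 200000 in
theorem torusApexes_rigid : ∀ p₀ p₁ : Fin 7, ∀ p₃ ∈ torusApexes p₀ p₁,
    ∀ p₅ ∈ torusApexes p₀ p₁, ∀ p₂ ∈ torusApexes p₀ p₃,
    ∀ p₆ ∈ torusApexes p₀ p₂, ∀ p₄ ∈ torusApexes p₁ p₂,
    p₀ ≠ p₁ ∧ p₅ ≠ p₃ ∧ p₂ ≠ p₁ ∧ p₆ ≠ p₃ ∧ p₆ ∈ torusApexes p₁ p₂ ∧ p₄ ≠ p₆ →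
    p₂ = (p₁ - p₀) * 2 + p₀ ∧ p₃ = (p₁ - p₀) * 3 + p₀ ∧ p₄ = (p₁ - p₀) * 4 + p₀ ∧
      p₅ = (p₁ - p₀) * 5 + p₀ ∧ p₆ = (p₁ - p₀) * 6 + p₀ := by decide +kernel

/-- The automorphisms of Möbius' torus are affine. -/
theorem IsTorusLabelling.exists_affine {V : Type*} [DecidableEq V]
    {K : AbstractSimplicialComplex V} {e : Fin 7 ≃ V} (he : IsTorusLabelling K e)
    (φ : complexAut K) :
    ∃ α β : Fin 7, α ≠ 0 ∧ ∀ i, (φ : Equiv.Perm V) (e i) = e (α * i + β) := by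
  let ψ : Fin 7 → Fin 7 := fun i => e.symm ((φ : Equiv.Perm V) (e i))
  have heψ : ∀ i, e (ψ i) = (φ : Equiv.Perm V) (e i) := fun i => e.apply_symm_apply _
  have hinj : Function.Injective ψ := fun i j h =>
    e.injective ((φ : Equiv.Perm V).injective (e.symm.injective h))
  have key : ∀ i j k : Fin 7, i ≠ j → k ∈ torusApexes i j →
      ψ k ∈ torusApexes (ψ i) (ψ j) := by
    intro i j k hij hk
    simp only [torusApexes, List.mem_cons, List.not_mem_nil, or_false] at hk ⊢
    obtain ⟨h1, h2, h3⟩ := (he i j hij k).2 hk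
    refine (he _ _ (hinj.ne hij) _).1 ⟨hinj.ne h1, hinj.ne h2, ?_⟩
    rw [heψ, heψ, heψ]
    have := (φ.2 {e i, e j, e k}).2 h3
    simpa [Finset.image_insert] using this
  obtain ⟨e2, e3, e4, e5, e6⟩ := torusApexes_rigid (ψ 0) (ψ 1) (ψ 3)
    (key 0 1 3 (by decide) (by decide)) (ψ 5) (key 0 1 5 (by decide) (by decide)) (ψ 2)
    (key 0 3 2 (by decide) (by decide)) (ψ 6) (key 0 2 6 (by decide) (by decide)) (ψ 4)
    (key 1 2 4 (by decide) (by decide)) ⟨hinj.ne (by decide), hinj.ne (by decide),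
      hinj.ne (by decide), hinj.ne (by decide), key 1 2 6 (by decide) (by decide),
      hinj.ne (by decide)⟩
  refine ⟨ψ 1 - ψ 0, ψ 0, fun h => hinj.ne (show (1 : Fin 7) ≠ 0 by decide) (sub_eq_zero.1 h),
    fun i => ?_⟩
  rw [← heψ]
  congr 1
  fin_cases i
  · simp
  · simp
  exacts [e2, e3, e4, e5, e6]

/-- The values of a cocycle on Möbius' torus, for a gauge trivial along the path `0, 1, …, 6`. -/
structure IsTorusCocycle {V G : Type*} [Group G] (e : Fin 7 ≃ V) (c : V → V → G) (u q : G) :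
    Prop where
  comm : u * q = q * u
  one : ∀ i, c (e i) (e (i + 1)) = if i = 6 then u else 1
  two : ∀ i, c (e i) (e (i + 2)) = if i = 5 ∨ i = 6 then q * u else q
  three : ∀ i, c (e i) (e (i + 3)) = c (e i) (e (i + 1)) * c (e (i + 1)) (e (i + 1 + 2))

/-- The edges of slope 3 are eliminated between the triangles `i, i+1, i+3` and `i, i+2, i+3`. In
the gauge trivial along `0, 1, …, 6`, all labels of slope 2 then equal `q` until the edge from 6 to
0, labelled `u`, is passed. Going once around closes up with the relation `u q = q u`. -/
theorem IsTorusLabelling.exists_gauge {V G : Type*} [DecidableEq V] [Group G]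
    {K : AbstractSimplicialComplex V} {e : Fin 7 ≃ V} (he : IsTorusLabelling K e)
    {c : V → V → G} (hc : IsCocycle K c) :
    ∃ (a : V → G) (u q : G), IsTorusCocycle e (gaugeBy a c) u q := by
  obtain ⟨a, -, ha⟩ := exists_tree_gauge c (root := e 0) (lev := fun x => (e.symm x : ℕ))
    (par := fun x => e (e.symm x - 1)) (fun x hx => by
      have h : ∀ i : Fin 7, i ≠ 0 → ((i - 1 : Fin 7) : ℕ) < (i : ℕ) := by decide
      simp only [Equiv.symm_apply_apply]
      exact h _ fun h0 => hx (by rw [← h0, Equiv.apply_symm_apply])) 1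
  have hc' := hc.of_gauge a
  set b := gaugeBy a c with hb
  have hone : ∀ i : Fin 7, i ≠ 6 → b (e i) (e (i + 1)) = 1 := by
    intro i hi
    have h1 : i + 1 ≠ 0 := by
      revert hi i
      decide
    have := ha (e (i + 1)) (e.injective.ne h1)
    simp only [Equiv.symm_apply_apply, add_sub_cancel_right] at this
    exact this
  have t1 : ∀ i : Fin 7, b (e i) (e (i + 1)) * b (e (i + 1)) (e (i + 1 + 2)) =
      b (e i) (e (i + 3)) := by
    intro i
    have h : ∀ i : Fin 7, i ≠ i + 1 ∧ (i + 1 + 2 = 3 * (i + 1) - 2 * i ∨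
      i + 1 + 2 = 5 * (i + 1) - 4 * i) ∧ i + 1 + 2 = i + 3 := by decide
    obtain ⟨h1, h2, h3⟩ := h i
    have := hc' _ _ _ ((he i (i + 1) h1 (i + 1 + 2)).2 h2).2.2
    rw [this, h3]
  have t2 : ∀ i : Fin 7, b (e i) (e (i + 2)) * b (e (i + 2)) (e (i + 2 + 1)) =
      b (e i) (e (i + 3)) := by
    intro i
    have h : ∀ i : Fin 7, i ≠ i + 2 ∧ (i + 2 + 1 = 3 * (i + 2) - 2 * i ∨
      i + 2 + 1 = 5 * (i + 2) - 4 * i) ∧ i + 2 + 1 = i + 3 := by decide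
    obtain ⟨h1, h2, h3⟩ := h i
    have := hc' _ _ _ ((he i (i + 2) h1 (i + 2 + 1)).2 h2).2.2
    rw [this, h3]
  have t : ∀ i, _ := fun i => (t1 i).trans (t2 i).symm
  have p0 : b (e 0) (e 1) = 1 := hone 0 (by decide)
  have p1 : b (e 1) (e 2) = 1 := hone 1 (by decide)
  have p2 : b (e 2) (e 3) = 1 := hone 2 (by decide)
  have p3 : b (e 3) (e 4) = 1 := hone 3 (by decide)
  have p4 : b (e 4) (e 5) = 1 := hone 4 (by decide)
  have p5 : b (e 5) (e 6) = 1 := hone 5 (by decide)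
  have q0 : b (e 0) (e 1) * b (e 1) (e 3) = b (e 0) (e 2) * b (e 2) (e 3) := t 0
  have q1 : b (e 1) (e 2) * b (e 2) (e 4) = b (e 1) (e 3) * b (e 3) (e 4) := t 1
  have q2 : b (e 2) (e 3) * b (e 3) (e 5) = b (e 2) (e 4) * b (e 4) (e 5) := t 2
  have q3 : b (e 3) (e 4) * b (e 4) (e 6) = b (e 3) (e 5) * b (e 5) (e 6) := t 3
  have q4 : b (e 4) (e 5) * b (e 5) (e 0) = b (e 4) (e 6) * b (e 6) (e 0) := t 4
  have q5 : b (e 5) (e 6) * b (e 6) (e 1) = b (e 5) (e 0) * b (e 0) (e 1) := t 5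
  have q6 : b (e 6) (e 0) * b (e 0) (e 2) = b (e 6) (e 1) * b (e 1) (e 2) := t 6
  simp only [p0, p1, p2, p3, p4, p5, one_mul, mul_one] at q0 q1 q2 q3 q4 q5 q6
  refine ⟨a, b (e 6) (e 0), b (e 0) (e 2), ?_, ?_, ?_, ?_⟩
  · rw [q6, q5, q4, q3, q2, q1, q0]
  · intro i
    split_ifs with hi
    · rw [hi]
      rfl
    · exact hone i hi
  · intro i
    fin_cases i
    · rfl
    · exact q0
    · exact q1.trans q0
    · exact q2.trans (q1.trans q0)
    · exact q3.trans (q2.trans (q1.trans q0))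
    · exact q4.trans (by rw [q3, q2, q1, q0]; rfl)
    · exact q5.trans (q4.trans (by rw [q3, q2, q1, q0]; rfl))
  · intro i
    exact (t1 i).symm

theorem IsTorusCocycle.hasReducedValues {V G : Type*} [DecidableEq V] [Group G]
    {K : AbstractSimplicialComplex V} (hcomplete : ∀ u v : V, ({u, v} : Finset V) ∈ K.faces)
    {e : Fin 7 ≃ V} {c : V → V → G} (hc : IsCocycle K c) {u q : G} (h : IsTorusCocycle e c u q) :
    HasReducedValues K c (Subgroup.closure {u, q}) := by
  have hu : u ∈ Subgroup.closure {u, q} := Subgroup.subset_closure (by simp)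
  have hq : q ∈ Subgroup.closure {u, q} := Subgroup.subset_closure (by simp)
  have m1 : ∀ i, c (e i) (e (i + 1)) ∈ Subgroup.closure {u, q} := by
    intro i
    rw [h.one]
    split_ifs
    exacts [hu, Subgroup.one_mem _]
  have m2 : ∀ i, c (e i) (e (i + 2)) ∈ Subgroup.closure {u, q} := by
    intro i
    rw [h.two]
    split_ifs
    exacts [Subgroup.mul_mem _ hq hu, hq]
  have m3 : ∀ i, c (e i) (e (i + 3)) ∈ Subgroup.closure {u, q} := by
    intro i
    rw [h.three]
    exact Subgroup.mul_mem _ (m1 _) (m2 _)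
  have key : ∀ i j, c (e i) (e j) ∈ Subgroup.closure {u, q} := by
    have hd : ∀ i j : Fin 7, i = j ∨ (j = i + 1 ∨ j = i + 2 ∨ j = i + 3) ∨
        (i = j + 1 ∨ i = j + 2 ∨ i = j + 3) := by decide
    intro i j
    rcases hd i j with rfl | (rfl | rfl | rfl) | h'
    · rw [hc.self]
      exact Subgroup.one_mem _
    · exact m1 _
    · exact m2 _
    · exact m3 _
    · rw [hc.swap (hcomplete (e j) (e i))]
      refine Subgroup.inv_mem _ ?_
      rcases h' with rfl | rfl | rfl
      exacts [m1 _, m2 _, m3 _]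
  refine ⟨fun x y _ => ?_, fun x y => ?_⟩
  · obtain ⟨i, rfl⟩ := e.surjective x
    obtain ⟨j, rfl⟩ := e.surjective y
    exact key i j
  · have hstep : ∀ i : Fin 7, i ≠ 6 → c (e i) (e (i + 1)) = 1 := by
      intro i hi
      rw [h.one, if_neg hi]
    have up : ∀ i : Fin 7, Relation.ReflTransGen
        (fun a b => ({a, b} : Finset V) ∈ K.faces ∧ c a b = 1) (e 0) (e i) := by
      intro i
      induction i using Fin.induction with
      | zero => exact Relation.ReflTransGen.refl
      | succ i ih =>
        refine ih.tail ⟨hcomplete _ _, ?_⟩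
        rw [← Fin.coeSucc_eq_succ]
        exact hstep _ (by clear ih; revert i; decide)
    have down : ∀ {y}, Relation.ReflTransGen
        (fun a b => ({a, b} : Finset V) ∈ K.faces ∧ c a b = 1) (e 0) y →
        Relation.ReflTransGen (fun a b => ({a, b} : Finset V) ∈ K.faces ∧ c a b = 1) y (e 0) := by
      intro y hy
      induction hy with
      | refl => exact Relation.ReflTransGen.refl
      | @tail a b _ hab ih =>
        exact ih.head ⟨hcomplete _ _, by rw [hc.swap (hcomplete a b), hab.2, inv_one]⟩
    obtain ⟨i, rfl⟩ := e.surjective x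
    obtain ⟨j, rfl⟩ := e.surjective y
    exact (down (up i)).trans (up j)

/-! ### Groups of motions with diagonal linear parts -/

/-- A representation of a group by motions `x ↦ (sᵢ xᵢ + tᵢ)` of three-space with `sᵢ = ± 1`, such
that the group has no elements of order two, is discrete enough to be faithful, has a lattice of
full rank and contains an orientation reversing element. -/
structure FlatRep (G : Type*) [Group G] where
  /-- the linear part -/
  s : G → Fin 3 → ℝ
  /-- the translation part -/
  t : G → Fin 3 → ℝ
  mul_s : ∀ g h i, s (g * h) i = s g i * s h i
  mul_t : ∀ g h i, t (g * h) i = s g i * t h i + t g i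
  sq_s : ∀ g i, s g i * s g i = 1
  faithful : ∀ g, (∀ i, s g i = 1) → (∀ i, t g i = 0) → g = 1
  two_torsion : ∀ g : G, g * g = 1 → g = 1
  lattice : ∀ a : Fin 3 → ℝ, (∀ g, ∑ i, t (g * g * (g * g)) i * a i = 0) → a = 0
  reversing : ∃ g, ∏ i, s g i = -1

namespace FlatRep

variable {G : Type*} [Group G] (R : FlatRep G)

theorem s_one (i : Fin 3) : R.s 1 i = 1 := by
  have := R.mul_s 1 1 i
  rw [mul_one, R.sq_s] at this
  exact this

theorem t_one (i : Fin 3) : R.t 1 i = 0 := by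
  have := R.mul_t 1 1 i
  rw [mul_one, R.s_one] at this
  linarith

theorem s_inv (g : G) (i : Fin 3) : R.s g⁻¹ i = R.s g i := by
  have h1 := R.mul_s g⁻¹ g i
  rw [inv_mul_cancel, R.s_one] at h1
  have h2 := R.sq_s g i
  calc R.s g⁻¹ i = R.s g⁻¹ i * (R.s g i * R.s g i) := by rw [h2, mul_one]
    _ = R.s g i := by rw [← mul_assoc, ← h1, one_mul]

theorem t_inv (g : G) (i : Fin 3) : R.t g⁻¹ i = -(R.s g i * R.t g i) := by
  have h1 := R.mul_t g⁻¹ g i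
  rw [inv_mul_cancel, R.t_one, R.s_inv] at h1
  linarith

/-- The translation part of the square. -/
def T (g : G) (i : Fin 3) : ℝ := R.t (g * g) i

theorem s_mul_self (g : G) (i : Fin 3) : R.s (g * g) i = 1 := by
  rw [R.mul_s, R.sq_s]

theorem T_eq (g : G) (i : Fin 3) : R.T g i = R.s g i * R.t g i + R.t g i := R.mul_t g g i

theorem s_mul_T (g : G) (i : Fin 3) : R.s g i * R.T g i = R.T g i := by
  rw [R.T_eq, mul_add, ← mul_assoc, R.sq_s, one_mul, add_comm]

theorem t_conj {w : G} (hw : ∀ i, R.s w i = 1) (g : G) (i : Fin 3) :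
    R.t (g⁻¹ * w * g) i = R.s g i * R.t w i := by
  rw [R.mul_t, R.mul_t, R.mul_s, R.s_inv, R.t_inv, hw]
  ring

/-- `T n` is the vector of the translation `n²`, and conjugating a translation applies the linear
part to its vector. -/
theorem T_conj (n g : G) (i : Fin 3) : R.T (g⁻¹ * n * g) i = R.s g i * R.T n i := by
  rw [T, T, ← R.t_conj (R.s_mul_self n)]
  congr 1
  group

theorem t_mul_of_translation {w : G} (hw : ∀ i, R.s w i = 1) (g : G) (i : Fin 3) :
    R.t (w * g) i = R.t w i + R.t g i := by
  rw [R.mul_t, hw, one_mul, add_comm]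

/-- For commuting elements `(gh)² = g² h²`, and squares are pure translations, whose vectors add. -/
theorem T_mul {g h : G} (hgh : g * h = h * g) (i : Fin 3) :
    R.T (g * h) i = R.T g i + R.T h i := by
  rw [T, T, T, ← R.t_mul_of_translation (R.s_mul_self g)]
  congr 1
  rw [mul_assoc, ← mul_assoc h g h, ← hgh]
  group

theorem T_one (i : Fin 3) : R.T 1 i = 0 := by rw [T, mul_one, R.t_one]

theorem T_inv (g : G) (i : Fin 3) : R.T g⁻¹ i = -R.T g i := by
  have := R.T_mul (g := g) (h := g⁻¹) (by rw [mul_inv_cancel, inv_mul_cancel]) i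
  rw [mul_inv_cancel, R.T_one] at this
  linarith

theorem T_zpow (g : G) (k : ℤ) (i : Fin 3) : R.T (g ^ k) i = k * R.T g i := by
  induction k using Int.induction_on with
  | zero => simp [R.T_one]
  | succ k ih =>
    rw [zpow_add_one, R.T_mul (by rw [← zpow_add_one, ← zpow_one_add, add_comm]), ih]
    push_cast
    ring
  | pred k ih =>
    rw [zpow_sub_one, R.T_mul (by rw [← zpow_sub_one, ← zpow_neg_one, ← zpow_add]; congr 1; ring),
      ih, R.T_inv]
    push_cast
    ring

theorem s_mul_T_of_commute {n x : G} (h : n * x = x * n) (i : Fin 3) :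
    R.s n i * R.T x i = R.T x i := by
  rw [← R.T_conj, mul_assoc, ← h, inv_mul_cancel_left]

/-! ### Flat groups generated by a commutative subgroup and one further element -/

section Extension


/-- The square of `t` centralizes `N`. -/
theorem sq_commute (R : FlatRep G) {N : Subgroup G} {t : G}
    (hcomm : ∀ a ∈ N, ∀ b ∈ N, a * b = b * a)
    (hconj : ∀ n ∈ N, t⁻¹ * n * t ∈ N) 
    {n : G} (hn : n ∈ N) : n * (t * t) = t * t * n := by
  -- Conjugating twice by `t` applies each sign twice, so `T m = T n` and `m n⁻¹` has trivial
  -- square. Absence of 2-torsion gives `m = n`.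
  set m := t⁻¹ * (t⁻¹ * n * t) * t with hm
  have hmN : m ∈ N := hconj _ (hconj n hn)
  have hT : ∀ i, R.T m i = R.T n i := by
    intro i
    rw [hm, R.T_conj, R.T_conj, ← mul_assoc, R.sq_s, one_mul]
  have hinv : n⁻¹ ∈ N := N.inv_mem hn
  have hx : m * n⁻¹ = 1 := by
    refine R.two_torsion _ (R.faithful _ (R.s_mul_self _) fun i => ?_)
    have := R.T_mul (hcomm _ hmN _ hinv) i
    rw [R.T_inv, hT, add_neg_cancel] at this
    exact this
  have hmn : m = n := by rwa [mul_inv_eq_one] at hx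
  calc n * (t * t) = t * t * m := by rw [hm]; group
    _ = t * t * n := by rw [hmn]

/-- Since `t²` centralizes `N`, conjugation by `t` and by its inverse agree on `N`. So `t`
normalizes `N`, and the group is the product of `N` with the powers of `t`. -/
theorem exists_normal_form (R : FlatRep G) {N : Subgroup G} {t : G}
    (hcomm : ∀ a ∈ N, ∀ b ∈ N, a * b = b * a)
    (hconj : ∀ n ∈ N, t⁻¹ * n * t ∈ N) 
    (hgen : Subgroup.closure ((N : Set G) ∪ {t}) = ⊤)
    (g : G) : ∃ n ∈ N, ∃ k : ℤ, g = n * t ^ k := by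
  have hsq : ∀ n ∈ N, n * (t * t) = t * t * n := fun n hn => R.sq_commute hcomm hconj hn
  have hnorm : Subgroup.normalizer (N : Set G) = ⊤ := by
    rw [← top_le_iff, ← hgen, Subgroup.closure_le]
    rintro x (hx | hx)
    · exact Subgroup.le_normalizer hx
    · rw [Set.mem_singleton_iff] at hx
      subst hx
      rw [SetLike.mem_coe, Subgroup.mem_normalizer_iff]
      intro h
      constructor
      · intro hh
        have : x * h * x⁻¹ = x⁻¹ * h * x := by
          have := hsq h hh
          calc x * h * x⁻¹ = x⁻¹ * (x * x * h) * x⁻¹ := by group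
            _ = x⁻¹ * (h * (x * x)) * x⁻¹ := by rw [this]
            _ = x⁻¹ * h * x := by group
        rw [this]
        exact hconj h hh
      · intro hh
        have := hconj _ hh
        convert this using 1
        group
  have : N.Normal := Subgroup.normalizer_eq_top_iff.1 hnorm
  have hg : g ∈ N ⊔ Subgroup.zpowers t := by
    have : (⊤ : Subgroup G) ≤ N ⊔ Subgroup.zpowers t := by
      rw [← hgen, Subgroup.closure_le]
      rintro x (hx | hx)
      · exact Subgroup.mem_sup_left hx
      · rw [Set.mem_singleton_iff] at hx
        subst hx
        exact Subgroup.mem_sup_right (Subgroup.mem_zpowers x)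
    exact this (Subgroup.mem_top g)
  rw [Subgroup.mem_sup_of_normal_left] at hg
  obtain ⟨n, hn, z, ⟨k, rfl⟩, rfl⟩ := hg
  exact ⟨n, hn, k, rfl⟩

theorem conj_zpow_mem (R : FlatRep G) {N : Subgroup G} {t : G}
    (hcomm : ∀ a ∈ N, ∀ b ∈ N, a * b = b * a)
    (hconj : ∀ n ∈ N, t⁻¹ * n * t ∈ N) 
    {n : G} (hn : n ∈ N) (k : ℤ) : t ^ k * n * (t ^ k)⁻¹ ∈ N := by
  have hsq : ∀ n ∈ N, n * (t * t) = t * t * n := fun n hn => R.sq_commute hcomm hconj hn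
  have h1 : ∀ n ∈ N, t * n * t⁻¹ ∈ N := by
    intro n hn
    have : t * n * t⁻¹ = t⁻¹ * n * t := by
      calc t * n * t⁻¹ = t⁻¹ * (t * t * n) * t⁻¹ := by group
        _ = t⁻¹ * (n * (t * t)) * t⁻¹ := by rw [hsq n hn]
        _ = t⁻¹ * n * t := by group
    rw [this]
    exact hconj n hn
  induction k using Int.induction_on with
  | zero => simpa using hn
  | succ k ih =>
    convert h1 _ ih using 1
    rw [add_comm, zpow_one_add]
    group
  | pred k ih =>
    convert hconj _ ih using 1
    rw [sub_eq_neg_add, zpow_add, zpow_neg_one]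
    group

/-- The translation parts of `N` and of `t` span three-space. -/
theorem det_ne_zero (R : FlatRep G) {N : Subgroup G} {t : G}
    (hcomm : ∀ a ∈ N, ∀ b ∈ N, a * b = b * a)
    (hconj : ∀ n ∈ N, t⁻¹ * n * t ∈ N) 
    (hgen : Subgroup.closure ((N : Set G) ∪ {t}) = ⊤)
    {w₁ w₂ : Fin 3 → ℝ}
    (hspan : ∀ n ∈ N, ∃ a b : ℝ, ∀ i, R.T n i = a * w₁ i + b * w₂ i) :
    (Matrix.of ![w₁, w₂, R.T t]).det ≠ 0 := by
  intro hdet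
  obtain ⟨a, ha, h⟩ := Matrix.exists_mulVec_eq_zero_iff.2 hdet
  have hsq : ∀ n ∈ N, n * (t * t) = t * t * n := fun n hn => R.sq_commute hcomm hconj hn
  have e1 : ∑ i, w₁ i * a i = 0 := congrFun h 0
  have e2 : ∑ i, w₂ i * a i = 0 := congrFun h 1
  have e3 : ∑ i, R.T t i * a i = 0 := congrFun h 2
  refine ha (R.lattice a fun g => ?_)
  obtain ⟨n, hn, k, rfl⟩ := R.exists_normal_form hcomm hconj hgen g
  -- The square of `n t ^ k` is `m t ^ (2k)` with commuting factors, so its fourth power translates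
  -- by `T m + 2 k T t`. A linear form vanishing on `w₁`, `w₂` and `T t` would thus vanish on all
  -- fourth powers, against the lattice condition.
  set m := n * (t ^ k * n * (t ^ k)⁻¹) with hm
  have hmN : m ∈ N := N.mul_mem hn (R.conj_zpow_mem hcomm hconj hn k)
  have hg2 : n * t ^ k * (n * t ^ k) = m * (t ^ k * t ^ k) := by
    rw [hm]
    group
  have htt : t ^ k * t ^ k = (t * t) ^ k := by
    rw [← zpow_add, ← two_mul, zpow_mul]
    congr 1
    exact zpow_two t
  have hcm : m * (t ^ k * t ^ k) = t ^ k * t ^ k * m := by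
    rw [htt]
    exact (Commute.zpow_right (hsq m hmN) k : Commute m ((t * t) ^ k))
  obtain ⟨x, y, hxy⟩ := hspan m hmN
  have hT : ∀ i, R.t (n * t ^ k * (n * t ^ k) * (n * t ^ k * (n * t ^ k))) i =
      x * w₁ i + y * w₂ i + (2 * k) * R.T t i := by
    intro i
    have h1 := R.T_mul hcm i
    rw [← hg2, hxy, htt, R.T_zpow, R.T_mul (g := t) rfl] at h1
    rw [← T, h1]
    ring
  calc ∑ i, R.t (n * t ^ k * (n * t ^ k) * (n * t ^ k * (n * t ^ k))) i * a i
      = ∑ i, (x * (w₁ i * a i) + y * (w₂ i * a i) + (2 * k) * (R.T t i * a i)) :=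
        Finset.sum_congr rfl fun i _ => by rw [hT]; ring
    _ = 0 := by
      rw [Finset.sum_add_distrib, Finset.sum_add_distrib, ← Finset.mul_sum, ← Finset.mul_sum,
        ← Finset.mul_sum, e1, e2, e3]
      ring

/-- In the basis `w₁, w₂, T t` the elements of `N` act trivially (they commute with `t²`), and `t`
acts as `diag(ε, ε, 1)`, of determinant `ε² = 1`. Then no element of the group reverses orientation.
-/
theorem not_scalar (R : FlatRep G) {N : Subgroup G} {t : G}
    (hcomm : ∀ a ∈ N, ∀ b ∈ N, a * b = b * a)
    (hconj : ∀ n ∈ N, t⁻¹ * n * t ∈ N) 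
    (hgen : Subgroup.closure ((N : Set G) ∪ {t}) = ⊤)
    {w₁ w₂ : Fin 3 → ℝ}
    (hspan : ∀ n ∈ N, ∃ a b : ℝ, ∀ i, R.T n i = a * w₁ i + b * w₂ i)
    (hw : ∀ n ∈ N, ∀ i, R.s n i * w₁ i = w₁ i ∧ R.s n i * w₂ i = w₂ i) {ε : ℝ}
    (hε : ε * ε = 1) (h₁ : ∀ i, R.s t i * w₁ i = ε * w₁ i)
    (h₂ : ∀ i, R.s t i * w₂ i = ε * w₂ i) : False := by
  have hdet := R.det_ne_zero hcomm hconj hgen hspan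
  set M := Matrix.of ![w₁, w₂, R.T t] with hM
  have key : ∀ (g : G) (δ : ℝ), δ * δ = 1 → (∀ i, R.s g i * w₁ i = δ * w₁ i) →
      (∀ i, R.s g i * w₂ i = δ * w₂ i) → (∀ i, R.s g i * R.T t i = R.T t i) →
      ∏ i, R.s g i = 1 := by
    intro g δ hδ k1 k2 k3
    have : M * Matrix.diagonal (R.s g) = Matrix.diagonal ![δ, δ, 1] * M := by
      ext i j
      rw [Matrix.mul_diagonal, Matrix.diagonal_mul]
      fin_cases i
      · exact (mul_comm _ _).trans (k1 j)
      · exact (mul_comm _ _).trans (k2 j)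
      · exact (mul_comm _ _).trans ((k3 j).trans (one_mul _).symm)
    have := congrArg Matrix.det this
    rw [Matrix.det_mul, Matrix.det_mul, Matrix.det_diagonal, Matrix.det_diagonal,
      Fin.prod_univ_three (f := ![δ, δ, 1])] at this
    simp only [Matrix.cons_val_zero, Matrix.cons_val_one, Matrix.cons_val, hδ, one_mul, mul_one]
      at this
    exact mul_left_cancel₀ hdet (by rw [this, mul_one])
  have hall : ∀ g, ∏ i, R.s g i = 1 := by
    intro g
    have hg : g ∈ Subgroup.closure ((N : Set G) ∪ {t}) := hgen ▸ Subgroup.mem_top g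
    induction hg using Subgroup.closure_induction with
    | mem x hx =>
      rcases hx with hx | hx
      · refine key x 1 (one_mul 1) (fun i => ?_) (fun i => ?_) fun i => ?_
        · rw [one_mul, (hw x hx i).1]
        · rw [one_mul, (hw x hx i).2]
        · have h1 := R.t_conj (R.s_mul_self t) x i
          rw [mul_assoc, ← R.sq_commute hcomm hconj hx, inv_mul_cancel_left] at h1
          exact h1.symm
      · rw [Set.mem_singleton_iff] at hx
        rw [hx]
        exact key t ε hε h₁ h₂ (R.s_mul_T t)
    | one => simp [R.s_one]
    | mul x y _ _ hx hy => simp only [R.mul_s, Finset.prod_mul_distrib, hx, hy, mul_one]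
    | inv x _ hx => simp only [R.s_inv, hx]
  obtain ⟨g, hg⟩ := R.reversing
  rw [hall g] at hg
  norm_num at hg

end Extension

end FlatRep

/-! ### Cocycles on product complexes -/

section Product

variable {V W G : Type*} [LinearOrder V] [LinearOrder W] [Group G]
  {K : AbstractSimplicialComplex V} {L : AbstractSimplicialComplex W}

theorem mem_productComplex_of_chain {u v : V} {i j : W} (huv : ({u, v} : Finset V) ∈ K.faces)
    (hij : ({i, j} : Finset W) ∈ L.faces) {p q r : V × W} (hpq : p ≤ q) (hqr : q ≤ r)
    (hV : ({p.1, q.1, r.1} : Finset V) ⊆ {u, v}) (hW : ({p.2, q.2, r.2} : Finset W) ⊆ {i, j}) :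
    ({p, q, r} : Finset (V × W)) ∈ (productComplex K L).faces := by
  refine ⟨Finset.insert_nonempty _ _, ?_, ?_, ?_⟩
  · have hpr := hpq.trans hqr
    intro x hx y hy _
    simp only [coe_insert, coe_singleton, Set.mem_insert_iff, Set.mem_singleton_iff] at hx hy
    rcases hx with rfl | rfl | rfl <;> rcases hy with rfl | rfl | rfl <;> simp [*]
  · refine face_mono huv ?_ (by simp)
    simpa [Finset.image_insert] using hV
  · refine face_mono hij ?_ (by simp)
    simpa [Finset.image_insert] using hW

theorem mem_productComplex_horizontal {u v : V} (huv : ({u, v} : Finset V) ∈ K.faces) (i : W) :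
    ({(u, i), (v, i)} : Finset (V × W)) ∈ (productComplex K L).faces := by
  have hi : ({i, i} : Finset W) ∈ L.faces := by simpa using L.singleton_mem i
  rcases le_total u v with h | h
  · have := mem_productComplex_of_chain huv hi (p := (u, i)) (q := (v, i)) (r := (v, i))
      ⟨h, le_rfl⟩ le_rfl (by simp) (by simp)
    simpa using this
  · have := mem_productComplex_of_chain huv hi (p := (v, i)) (q := (u, i)) (r := (u, i))
      ⟨h, le_rfl⟩ le_rfl (by simp [Finset.pair_comm]) (by simp)
    rw [Finset.pair_comm]
    simpa using this

theorem mem_productComplex_vertical {i j : W} (hij : ({i, j} : Finset W) ∈ L.faces) (u : V) :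
    ({(u, i), (u, j)} : Finset (V × W)) ∈ (productComplex K L).faces := by
  have hu : ({u, u} : Finset V) ∈ K.faces := by simpa using K.singleton_mem u
  rcases le_total i j with h | h
  · have := mem_productComplex_of_chain hu hij (p := (u, i)) (q := (u, j)) (r := (u, j))
      ⟨le_rfl, h⟩ le_rfl (by simp) (by simp)
    simpa using this
  · have := mem_productComplex_of_chain hu hij (p := (u, j)) (q := (u, i)) (r := (u, i))
      ⟨le_rfl, h⟩ le_rfl (by simp) (by simp [Finset.pair_comm])
    rw [Finset.pair_comm]
    simpa using this

/-- The staircase diagonal from `(u, i)` to `(v, j)` cuts the square into two triangles, and both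
products equal its label. -/
theorem IsCocycle.product_square_of_le {c : V × W → V × W → G}
    (hc : IsCocycle (productComplex K L) c) {u v : V} (huv : ({u, v} : Finset V) ∈ K.faces)
    {i j : W} (hij : ({i, j} : Finset W) ∈ L.faces) (h1 : u ≤ v) (h2 : i ≤ j) :
    c (u, i) (v, i) * c (v, i) (v, j) = c (u, i) (u, j) * c (u, j) (v, j) := by
  rw [hc (u, i) (v, i) (v, j), hc (u, i) (u, j) (v, j)]
  · exact mem_productComplex_of_chain huv hij ⟨le_rfl, h2⟩ ⟨h1, le_rfl⟩ (by simp) (by simp)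
  · exact mem_productComplex_of_chain huv hij ⟨h1, le_rfl⟩ ⟨le_rfl, h2⟩ (by simp) (by simp)

theorem IsCocycle.product_square {c : V × W → V × W → G}
    (hc : IsCocycle (productComplex K L) c) {u v : V} (huv : ({u, v} : Finset V) ∈ K.faces)
    {i j : W} (hij : ({i, j} : Finset W) ∈ L.faces) :
    c (u, i) (v, i) * c (v, i) (v, j) = c (u, i) (u, j) * c (u, j) (v, j) := by
  have hi := hc.swap (mem_productComplex_horizontal (L := L) huv i)
  have hj := hc.swap (mem_productComplex_horizontal (L := L) huv j)
  have hu := hc.swap (mem_productComplex_vertical (K := K) hij u)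
  have hv := hc.swap (mem_productComplex_vertical (K := K) hij v)
  have hji : ({j, i} : Finset W) ∈ L.faces := by rwa [Finset.pair_comm]
  have hvu : ({v, u} : Finset V) ∈ K.faces := by rwa [Finset.pair_comm]
  rcases le_total u v with h1 | h1 <;> rcases le_total i j with h2 | h2
  · exact hc.product_square_of_le huv hij h1 h2
  · have := hc.product_square_of_le huv hji h1 h2
    rw [hu, hv, eq_inv_mul_iff_mul_eq, ← mul_assoc, mul_inv_eq_iff_eq_mul] at this
    exact this.symm
  · have := hc.product_square_of_le hvu hij h1 h2
    rw [hi, hj, inv_mul_eq_iff_eq_mul, ← mul_assoc, eq_mul_inv_iff_mul_eq] at this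
    exact this.symm
  · have := hc.product_square_of_le hvu hji h1 h2
    rw [hi, hj, hu, hv, ← mul_inv_rev, ← mul_inv_rev, inv_inj] at this
    exact this.symm

/-- Every edge of the staircase triangulation is the third side of a triangle with one horizontal
and one vertical side, possibly degenerate. -/
theorem IsCocycle.product_mem {c : V × W → V × W → G}
    (hc : IsCocycle (productComplex K L) c) {H : Subgroup G}
    (h1 : ∀ u v, ({u, v} : Finset V) ∈ K.faces → ∀ i, c (u, i) (v, i) ∈ H)
    (h2 : ∀ i j, ({i, j} : Finset W) ∈ L.faces → ∀ v, c (v, i) (v, j) ∈ H) {p q : V × W}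
    (hpq : ({p, q} : Finset (V × W)) ∈ (productComplex K L).faces) : c p q ∈ H := by
  have key : ∀ p q : V × W, ({p, q} : Finset (V × W)) ∈ (productComplex K L).faces → p ≤ q →
      c p q ∈ H := by
    rintro ⟨u, i⟩ ⟨v, j⟩ ⟨-, -, hV, hW⟩ ⟨huv, hij⟩
    have hV : ({u, v} : Finset V) ∈ K.faces := by simpa [Finset.image_insert] using hV
    have hW : ({i, j} : Finset W) ∈ L.faces := by simpa [Finset.image_insert] using hW
    rw [← hc (u, i) (v, i) (v, j) (mem_productComplex_of_chain hV hW ⟨huv, le_rfl⟩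
      ⟨le_rfl, hij⟩ (by simp) (by simp))]
    exact H.mul_mem (h1 _ _ hV _) (h2 _ _ hW _)
  by_cases h : p = q
  · rw [h, hc.self]
    exact H.one_mem
  rcases hpq.2.1 (by simp) (by simp) h with h | h
  · exact key p q hpq h
  · have hqp : ({q, p} : Finset (V × W)) ∈ (productComplex K L).faces := by
      rwa [Finset.pair_comm]
    rw [hc.swap hqp]
    exact H.inv_mem (key q p hqp h)

end Product

/-! ### Holonomy data -/

/-- A cocycle `b` on `K`, together with elements `t v` intertwining it with its image under `φ`,
that describes a surjection from the fundamental group of a bundle over the circle. -/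
structure IsHolonomy {V G : Type*} [DecidableEq V] [Group G] (K : AbstractSimplicialComplex V)
    (φ : complexAut K) (b : V → V → G) (t : V → G) : Prop where
  cocycle : IsCocycle K b
  rel : ∀ u v, ({u, v} : Finset V) ∈ K.faces →
    b ((φ : Equiv.Perm V) u) ((φ : Equiv.Perm V) v) = (t u)⁻¹ * b u v * t v
  full : ∀ (a : V → G) (H : Subgroup G),
    (∀ u v, ({u, v} : Finset V) ∈ K.faces → gaugeBy a b u v ∈ H) →
    (∀ v, (a v)⁻¹ * t v * a ((φ : Equiv.Perm V) v) ∈ H) → H = ⊤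

theorem complexAut_pair {V : Type*} [DecidableEq V] {K : AbstractSimplicialComplex V}
    (φ : complexAut K) {u v : V} (h : ({u, v} : Finset V) ∈ K.faces) :
    ({(φ : Equiv.Perm V) u, (φ : Equiv.Perm V) v} : Finset V) ∈ K.faces := by
  have := (φ.2 {u, v}).2 h
  simpa [Finset.image_insert] using this

theorem IsHolonomy.of_gauge {V G : Type*} [DecidableEq V] [Group G]
    {K : AbstractSimplicialComplex V} {φ : complexAut K} {b : V → V → G} {t : V → G}
    (h : IsHolonomy K φ b t) (a : V → G) :
    IsHolonomy K φ (gaugeBy a b) (fun v => (a v)⁻¹ * t v * a ((φ : Equiv.Perm V) v)) where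
  cocycle := h.cocycle.of_gauge a
  rel u v huv := by
    simp only [gaugeBy]
    rw [h.rel u v huv]
    group
  full a' H h1 h2 := by
    refine h.full (fun v => a v * a' v) H (fun u v huv => ?_) fun v => ?_
    · have := h1 u v huv
      simp only [gaugeBy] at this ⊢
      convert this using 1
      group
    · have := h2 v
      convert this using 1
      group

theorem gluingMap_of_lt {V : Type*} (φ : Equiv.Perm V) (v : V) (i : Fin 3) :
    gluingMap φ (v, i.castSucc) = (v, i) := by
  simp [gluingMap]

theorem gluingMap_three {V : Type*} (φ : Equiv.Perm V) (v : V) :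
    gluingMap φ (v, 3) = (φ v, 0) := by
  simp [gluingMap]

/-- The vertical labels below level 2 are gauged away. The square relation then makes the labels of
the three horizontal slices equal, and the only remaining data are the labels `t v` of the edges
from `(v, 2)` to `(φ v, 0)`; the squares in the last slab give the intertwining relation. -/
theorem IsFullCocycle.exists_holonomy_of_twistedProduct {V G : Type*} [LinearOrder V] [Group G]
    {K : AbstractSimplicialComplex V} {φ : complexAut K} {c : V × Fin 3 → V × Fin 3 → G}
    (hc : IsFullCocycle (twistedProduct K φ) c) : ∃ (b : V → V → G) (t : V → G), IsHolonomy K φ b t := by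
  -- The gauge at level `j` is the inverse of the product of the vertical labels below level `j`.
  let A : V × Fin 3 → G := fun x => ![1, (c (x.1, 0) (x.1, 1))⁻¹,
    (c (x.1, 1) (x.1, 2))⁻¹ * (c (x.1, 0) (x.1, 1))⁻¹] x.2
  have hc' := hc.of_gauge A
  set c' := gaugeBy A c with hc'def
  have v01 : ∀ v, c' (v, 0) (v, 1) = 1 := fun v => by
    simp [c', gaugeBy, A]
  have v12 : ∀ v, c' (v, 1) (v, 2) = 1 := fun v => by
    simp [c', gaugeBy, A]
  obtain ⟨g, hg⟩ : ∃ g, g = gluingMap (φ : Equiv.Perm V) := ⟨_, rfl⟩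
  have g0 : ∀ v, g (v, 0) = (v, 0) := fun v => hg ▸ gluingMap_of_lt _ v 0
  have g1 : ∀ v, g (v, 1) = (v, 1) := fun v => hg ▸ gluingMap_of_lt _ v 1
  have g2 : ∀ v, g (v, 2) = (v, 2) := fun v => hg ▸ gluingMap_of_lt _ v 2
  have g3 : ∀ v, g (v, 3) = ((φ : Equiv.Perm V) v, 0) := fun v => hg ▸ gluingMap_three _ v
  have hface : ∀ s ∈ (productComplex K intervalComplex).faces,
      s.image g ∈ (twistedProduct K φ).faces := fun s hs => ⟨s, hs, by rw [hg]⟩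
  have hlift : ∀ d : V × Fin 3 → V × Fin 3 → G, IsCocycle (twistedProduct K φ) d →
      IsCocycle (productComplex K intervalComplex) fun p q => d (g p) (g q) := by
    intro d hd p q r h
    refine hd _ _ _ ?_
    simpa [Finset.image_insert] using hface _ h
  have e01 : ({0, 1} : Finset (Fin 4)) ∈ intervalComplex.faces := ⟨by simp, 0, by decide⟩
  have e12 : ({1, 2} : Finset (Fin 4)) ∈ intervalComplex.faces := ⟨by simp, 1, by decide⟩
  have e23 : ({2, 3} : Finset (Fin 4)) ∈ intervalComplex.faces := ⟨by simp, 2, by decide⟩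
  have s01 : ∀ u v, ({u, v} : Finset V) ∈ K.faces → c' (u, 1) (v, 1) = c' (u, 0) (v, 0) := by
    intro u v huv
    have : c' (u, 0) (v, 0) * c' (v, 0) (v, 1) = c' (u, 0) (u, 1) * c' (u, 1) (v, 1) := by
      simpa only [g0, g1] using (hlift c' hc'.1).product_square huv e01
    rw [v01, v01, mul_one, one_mul] at this
    exact this.symm
  have s12 : ∀ u v, ({u, v} : Finset V) ∈ K.faces → c' (u, 2) (v, 2) = c' (u, 0) (v, 0) := by
    intro u v huv
    have : c' (u, 1) (v, 1) * c' (v, 1) (v, 2) = c' (u, 1) (u, 2) * c' (u, 2) (v, 2) := by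
      simpa only [g1, g2] using (hlift c' hc'.1).product_square huv e12
    rw [v12, v12, mul_one, one_mul, s01 u v huv] at this
    exact this.symm
  have s23 : ∀ u v, ({u, v} : Finset V) ∈ K.faces →
      c' (u, 2) (v, 2) * c' (v, 2) ((φ : Equiv.Perm V) v, 0) =
      c' (u, 2) ((φ : Equiv.Perm V) u, 0) *
        c' ((φ : Equiv.Perm V) u, 0) ((φ : Equiv.Perm V) v, 0) := fun u v huv => by
    simpa only [g2, g3] using (hlift c' hc'.1).product_square huv e23
  refine ⟨fun u v => c' (u, 0) (v, 0), fun v => c' (v, 2) ((φ : Equiv.Perm V) v, 0), ?_, ?_, ?_⟩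
  · intro u v w h
    refine hc'.1 _ _ _ (hface _ (show
      (({(u, 0), (v, 0), (w, 0)} : Finset (V × Fin 4)) ∈ _) from
        ⟨by simp, ?_, ?_, ?_⟩) |> fun h => by
          simpa only [Finset.image_insert, Finset.image_singleton, g0] using h)
    · intro x hx y hy _
      have hx2 : x.2 = 0 := by
        simp only [coe_insert, coe_singleton, Set.mem_insert_iff, Set.mem_singleton_iff] at hx
        rcases hx with rfl | rfl | rfl <;> rfl
      have hy2 : y.2 = 0 := by
        simp only [coe_insert, coe_singleton, Set.mem_insert_iff, Set.mem_singleton_iff] at hy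
        rcases hy with rfl | rfl | rfl <;> rfl
      rcases le_total x.1 y.1 with h | h
      · exact Or.inl ⟨h, (hx2.trans hy2.symm).le⟩
      · exact Or.inr ⟨h, (hy2.trans hx2.symm).le⟩
    · simpa [Finset.image_insert] using h
    · simpa [Finset.image_insert] using intervalComplex.singleton_mem 0
  · intro u v huv
    have := s23 u v huv
    rw [s12 u v huv] at this
    rw [mul_assoc, this, inv_mul_cancel_left]
  · intro a H h1 h2
    -- A gauge on the base, used identically on every level, keeps the lower vertical labels
    -- trivial.
    have hd := hc'.of_gauge fun x => a x.1
    refine hd.eq_top H fun x y hxy => ?_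
    obtain ⟨s, hs, himg⟩ := hxy
    have himg : s.image g = {x, y} := hg ▸ himg
    obtain ⟨p, hp, rfl⟩ := Finset.mem_image.1 (show x ∈ s.image g by rw [himg]; simp)
    obtain ⟨q, hq, rfl⟩ := Finset.mem_image.1 (show y ∈ s.image g by rw [himg]; simp)
    have hpq : ({p, q} : Finset (V × Fin 4)) ∈ (productComplex K intervalComplex).faces :=
      face_mono hs (pair_subset hp hq) (by simp)
    have hd' := hlift _ hd.1
    have v01' : ∀ v, gaugeBy (fun x => a x.1) c' (v, 0) (v, 1) = 1 := fun v => by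
      simp [gaugeBy, v01]
    have v12' : ∀ v, gaugeBy (fun x => a x.1) c' (v, 1) (v, 2) = 1 := fun v => by
      simp [gaugeBy, v12]
    have hup : ∀ (i : Fin 3) (v : V), gaugeBy (fun x => a x.1) c' (g (v, i.castSucc))
        (g (v, i.succ)) ∈ H := by
      intro i v
      rcases (by decide : ∀ i : Fin 3, i = 0 ∨ i = 1 ∨ i = 2) i with rfl | rfl | rfl
      · change gaugeBy (fun x => a x.1) c' (g (v, 0)) (g (v, 1)) ∈ H
        rw [g0, g1, v01']
        exact H.one_mem
      · change gaugeBy (fun x => a x.1) c' (g (v, 1)) (g (v, 2)) ∈ H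
        rw [g1, g2, v12']
        exact H.one_mem
      · change gaugeBy (fun x => a x.1) c' (g (v, 2)) (g (v, 3)) ∈ H
        rw [g2, g3]
        exact h2 v
    have hupmem : ∀ i : Fin 3, ({i.castSucc, i.succ} : Finset (Fin 4)) ∈ intervalComplex.faces :=
      fun i => ⟨by simp, i, subset_rfl⟩
    refine hd'.product_mem (fun u v huv i => ?_) (fun i j hij v => ?_) hpq
    · rcases (by decide : ∀ i : Fin 4, i = 0 ∨ i = 1 ∨ i = 2 ∨ i = 3) i with
        rfl | rfl | rfl | rfl
      · rw [g0, g0]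
        exact h1 u v huv
      · have := h1 u v huv
        rw [gaugeBy, ← s01 u v huv] at this
        rw [g1, g1]
        exact this
      · have := h1 u v huv
        rw [gaugeBy, ← s12 u v huv] at this
        rw [g2, g2]
        exact this
      · rw [g3, g3]
        exact h1 _ _ (complexAut_pair φ huv)
    · obtain ⟨-, k, hk⟩ := hij
      have hi : i ∈ ({k.castSucc, k.succ} : Finset (Fin 4)) := hk (by simp)
      have hj : j ∈ ({k.castSucc, k.succ} : Finset (Fin 4)) := hk (by simp)
      simp only [mem_insert, mem_singleton] at hi hj
      rcases hi with rfl | rfl <;> rcases hj with rfl | rfl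
      · simp only [hd.1.self]
        exact H.one_mem
      · exact hup k v
      · have := hd'.swap (mem_productComplex_vertical (K := K) (hupmem k) v)
        rw [this]
        exact H.inv_mem (hup k v)
      · simp only [hd.1.self]
        exact H.one_mem

/-! ### Triangulated circles -/

theorem IsTriangulatedCircle.card_edges {W : Type*} [DecidableEq W] [Fintype W]
    {C : AbstractSimplicialComplex W} (hC : IsTriangulatedCircle C.toPreAbstractSimplicialComplex) :
    (facesOfCard C 2).card = Fintype.card W := by
  have h := Finset.sum_card_bipartiteAbove_eq_sum_card_bipartiteBelow
    (s := (univ : Finset W)) (t := facesOfCard C 2) (fun v e => v ∈ e)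
  have h1 : ∑ v : W, (bipartiteAbove (fun v e => v ∈ e) (facesOfCard C 2) v).card =
      ∑ v : W, 2 := by
    refine Finset.sum_congr rfl fun v _ => ?_
    rw [← Set.ncard_coe_finset]
    refine Eq.trans (Set.ncard_congr (fun w _ => ({v, w} : Finset W)) ?_ ?_ ?_).symm
      (hC.degree v (C.singleton_mem v))
    · rintro w ⟨hw, hf⟩
      rw [Finset.mem_coe, Finset.mem_bipartiteAbove]
      exact ⟨mem_facesOfCard.2 ⟨hf, Finset.card_pair hw.symm⟩, by simp⟩
    · rintro w w' ⟨hw, -⟩ - heq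
      have : w ∈ ({v, w'} : Finset W) := by rw [← heq]; simp
      simpa [hw] using this
    · intro e he
      simp only [mem_coe, mem_bipartiteAbove, mem_facesOfCard] at he
      obtain ⟨⟨he, hcard⟩, hv⟩ := he
      obtain ⟨a, b, hab, rfl⟩ := Finset.card_eq_two.1 hcard
      simp only [mem_insert, mem_singleton] at hv
      rcases hv with rfl | rfl
      · exact ⟨b, ⟨hab.symm, he⟩, rfl⟩
      · exact ⟨a, ⟨hab, by rw [Finset.pair_comm]; exact he⟩, Finset.pair_comm _ _⟩
  have h2 : ∑ e ∈ facesOfCard C 2, (bipartiteBelow (fun v e => v ∈ e) univ e).card =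
      ∑ e ∈ facesOfCard C 2, 2 := by
    refine Finset.sum_congr rfl fun e he => ?_
    rw [← (mem_facesOfCard.1 he).2]
    congr 1
    ext v
    simp [bipartiteBelow]
  rw [h1, h2] at h
  simp only [sum_const, smul_eq_mul, Finset.card_univ] at h
  omega

theorem IsTriangulatedCircle.three_le_card {W : Type*} [DecidableEq W] [Fintype W]
    {C : AbstractSimplicialComplex W} (hC : IsTriangulatedCircle C.toPreAbstractSimplicialComplex) :
    3 ≤ Fintype.card W := by
  obtain ⟨v, hv⟩ := hC.nonempty
  obtain ⟨a, b, hab, h⟩ := Set.ncard_eq_two.1 (hC.degree v hv)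
  have ha : a ∈ ({a, b} : Set W) := by simp
  have hb : b ∈ ({a, b} : Set W) := by simp
  rw [← h] at ha hb
  have hcard : ({v, a, b} : Finset W).card = 3 := Finset.card_eq_three.2
    ⟨v, a, b, ha.1.symm, hb.1.symm, hab, rfl⟩
  rw [← hcard]
  exact Finset.card_le_univ _

/-- A triangulated circle is a tree with one additional edge. -/
theorem IsTriangulatedCircle.exists_tree {W : Type*} [DecidableEq W] [Fintype W]
    {C : AbstractSimplicialComplex W} (hC : IsTriangulatedCircle C.toPreAbstractSimplicialComplex) :
    ∃ (root : W) (lev : W → ℕ) (par : W → W) (p q : W),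
      (∀ x, x ≠ root → ({par x, x} : Finset W) ∈ C.faces ∧ lev (par x) < lev x) ∧
      ({p, q} : Finset W) ∈ C.faces ∧
      ∀ x y, x ≠ y → ({x, y} : Finset W) ∈ C.faces →
        (y ≠ root ∧ par y = x) ∨ (x ≠ root ∧ par x = y) ∨ (x = p ∧ y = q) ∨ (x = q ∧ y = p) := by
  obtain ⟨root, hroot⟩ := hC.nonempty
  let r : W → W → Prop := fun a b => a ≠ b ∧ ({a, b} : Finset W) ∈ C.faces
  have hconn : ∀ x, Relation.ReflTransGen r root x := by
    intro x
    induction hC.connected root x hroot (C.singleton_mem x) with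
    | refl => exact Relation.ReflTransGen.refl
    | @tail a b _ hab ih =>
      by_cases h : a = b
      · exact h ▸ ih
      · exact ih.tail ⟨h, hab⟩
  obtain ⟨lev, par, hpar⟩ := exists_parent hconn
  obtain ⟨T, hTE, hTcard, hT⟩ := exists_treeEdges (E := facesOfCard C 2) hpar
    fun x y h => mem_facesOfCard.2 ⟨h.2, Finset.card_pair h.1⟩
  have hcard : (facesOfCard C 2 \ T).card = 1 := by
    rw [Finset.card_sdiff_of_subset hTE, hC.card_edges]
    omega
  obtain ⟨e, he⟩ := Finset.card_eq_one.1 hcard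
  have heE : e ∈ facesOfCard C 2 \ T := by rw [he]; simp
  obtain ⟨heC, hecard⟩ := mem_facesOfCard.1 (Finset.mem_sdiff.1 heE).1
  obtain ⟨p, q, hpq, rfl⟩ := Finset.card_eq_two.1 hecard
  refine ⟨root, lev, par, p, q, fun x hx => ⟨(hpar x hx).1.2, (hpar x hx).2⟩, heC,
    fun x y hxy hxyC => ?_⟩
  by_cases hTm : ({x, y} : Finset W) ∈ T
  · rcases hT x y hxy hTm with h | h
    exacts [Or.inl h, Or.inr (Or.inl h)]
  · have hm : ({x, y} : Finset W) ∈ facesOfCard C 2 \ T :=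
      Finset.mem_sdiff.2 ⟨mem_facesOfCard.2 ⟨hxyC, Finset.card_pair hxy⟩, hTm⟩
    rw [he, Finset.mem_singleton] at hm
    have hx : x ∈ ({p, q} : Finset W) := by rw [← hm]; simp
    have hy : y ∈ ({p, q} : Finset W) := by rw [← hm]; simp
    simp only [mem_insert, mem_singleton] at hx hy
    right; right
    rcases hx with rfl | rfl <;> rcases hy with rfl | rfl
    exacts [absurd rfl hxy, Or.inl ⟨rfl, rfl⟩, Or.inr ⟨rfl, rfl⟩, absurd rfl hxy]

/-- The circle is a spanning tree and one more edge `p q`. After gauging the vertical labels to be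
trivial along the tree, all slices agree, and the labels over `p q` are the elements `t v` for the
identity gluing. -/
theorem IsFullCocycle.exists_holonomy_of_productComplex {V W G : Type*} [LinearOrder V]
    [LinearOrder W] [Fintype W] [Group G] {K : AbstractSimplicialComplex V}
    {C : AbstractSimplicialComplex W} (hC : IsTriangulatedCircle C.toPreAbstractSimplicialComplex)
    {c : V × W → V × W → G} (hc : IsFullCocycle (productComplex K C) c) :
    ∃ (b : V → V → G) (t : V → G), IsHolonomy K 1 b t := by
  obtain ⟨root, lev, par, p, q, hpar, hpq, hedge⟩ := hC.exists_tree
  have hgauge : ∀ v : V, ∃ a : W → G, a root = 1 ∧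
      ∀ x, x ≠ root → (a (par x))⁻¹ * c (v, par x) (v, x) * a x = 1 := fun v =>
    exists_tree_gauge (fun x y => c (v, x) (v, y)) (fun x hx => (hpar x hx).2) 1
  choose A _ hA using hgauge
  have hc' := hc.of_gauge fun x => A x.1 x.2
  set c' := gaugeBy (fun x : V × W => A x.1 x.2) c with hc'def
  have hvert : ∀ v x, x ≠ root → c' (v, par x) (v, x) = 1 := fun v x hx => hA v x hx
  have hslice : ∀ u v, ({u, v} : Finset V) ∈ K.faces → ∀ x,
      c' (u, x) (v, x) = c' (u, root) (v, root) := by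
    intro u v huv x
    induction hn : lev x using Nat.strong_induction_on generalizing x with
    | _ n ih =>
      by_cases hx : x = root
      · rw [hx]
      · obtain ⟨h1, h2⟩ := hpar x hx
        have := hc'.1.product_square huv h1
        rw [hvert v x hx, hvert u x hx, mul_one, one_mul] at this
        rw [← this]
        exact ih _ (hn ▸ h2) _ rfl
  refine ⟨fun u v => c' (u, root) (v, root), fun v => c' (v, p) (v, q), ?_, ?_, ?_⟩
  · intro u v w h
    refine hc'.1 _ _ _ ⟨by simp, ?_, ?_, ?_⟩
    · intro x hx y hy _
      have hx2 : x.2 = root := by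
        simp only [coe_insert, coe_singleton, Set.mem_insert_iff, Set.mem_singleton_iff] at hx
        rcases hx with rfl | rfl | rfl <;> rfl
      have hy2 : y.2 = root := by
        simp only [coe_insert, coe_singleton, Set.mem_insert_iff, Set.mem_singleton_iff] at hy
        rcases hy with rfl | rfl | rfl <;> rfl
      rcases le_total x.1 y.1 with h | h
      · exact Or.inl ⟨h, (hx2.trans hy2.symm).le⟩
      · exact Or.inr ⟨h, (hy2.trans hx2.symm).le⟩
    · simpa [Finset.image_insert] using h
    · simpa [Finset.image_insert] using C.singleton_mem root
  · intro u v huv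
    have := hc'.1.product_square huv hpq
    rw [hslice u v huv p, hslice u v huv q] at this
    change c' (u, root) (v, root) = _
    rw [mul_assoc, this, inv_mul_cancel_left]
  · intro a H h1 h2
    have hd := hc'.of_gauge fun x => a x.1
    refine hd.eq_top H fun x y hxy => ?_
    have hvert' : ∀ v x, x ≠ root → gaugeBy (fun x => a x.1) c' (v, par x) (v, x) = 1 := by
      intro v x hx
      simp [gaugeBy, hvert v x hx]
    refine hd.1.product_mem (fun u v huv i => ?_) (fun i j hij v => ?_) hxy
    · have := h1 u v huv
      rw [gaugeBy, ← hslice u v huv i] at this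
      exact this
    · by_cases h : i = j
      · rw [h, hd.1.self]
        exact H.one_mem
      have hji : ({j, i} : Finset W) ∈ C.faces := by rwa [Finset.pair_comm]
      rcases hedge i j h hij with ⟨h3, rfl⟩ | ⟨h3, rfl⟩ | ⟨rfl, rfl⟩ | ⟨rfl, rfl⟩
      · rw [hvert' v j h3]
        exact H.one_mem
      · rw [hd.1.swap (mem_productComplex_vertical hji v), hvert' v i h3, inv_one]
        exact H.one_mem
      · exact h2 v
      · rw [hd.1.swap (mem_productComplex_vertical hji v)]
        exact H.inv_mem (h2 v)

/-! ### Surfaces with at most seven vertices -/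

theorem closure_commute {G : Type*} [Group G] {S : Set G} (hS : ∀ x ∈ S, ∀ y ∈ S, x * y = y * x) :
    ∀ x ∈ Subgroup.closure S, ∀ y ∈ Subgroup.closure S, x * y = y * x := by
  have h1 : ∀ x ∈ S, ∀ y ∈ Subgroup.closure S, Commute x y := by
    intro x hx y hy
    induction hy using Subgroup.closure_induction with
    | mem y hy => exact hS x hx y hy
    | one => exact Commute.one_right x
    | mul y z _ _ h1 h2 => exact h1.mul_right h2
    | inv y _ h => exact h.inv_right
  intro x hx y hy
  have : Commute x y := by
    induction hx using Subgroup.closure_induction with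
    | mem x hx => exact h1 x hx y hy
    | one => exact Commute.one_left y
    | mul x z _ _ h1 h2 => exact h1.mul_left h2
    | inv x _ h => exact h.inv_left
  exact this

theorem zpowers_commute {G : Type*} [Group G] (z : G) :
    ∀ x ∈ Subgroup.zpowers z, ∀ y ∈ Subgroup.zpowers z, x * y = y * x := by
  rintro _ ⟨m, rfl⟩ _ ⟨n, rfl⟩
  simp only [← zpow_add, add_comm]

/-- A cocycle on a surface with at most seven vertices is cyclic up to a gauge, or the surface is
Möbius' torus. -/
theorem IsTriangulatedSurface.exists_reduction {V : Type*} [DecidableEq V] [Fintype V] [Nonempty V]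
    {K : AbstractSimplicialComplex V} (hK : IsTriangulatedSurface K) (hV : Fintype.card V ≤ 7)
    {G : Type*} [Group G] {c : V → V → G} (hc : IsCocycle K c) :
    ∃ a : V → G, (∃ x, HasReducedValues K (gaugeBy a c) (Subgroup.zpowers x)) ∨
      ∃ (e : Fin 7 ≃ V) (u q : G), (∀ x y : V, ({x, y} : Finset V) ∈ K.faces) ∧
        IsTorusLabelling K e ∧ IsTorusCocycle e (gaugeBy a c) u q ∧
        HasReducedValues K (gaugeBy a c) (Subgroup.closure {u, q}) := by
  rcases hK.euler_or_complete hV with h | ⟨h7, hcomplete⟩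
  · obtain ⟨a, x, h⟩ := hK.exists_reduced_zpowers (hK.edgeConnected hV) h hc
    exact ⟨a, Or.inl ⟨x, h⟩⟩
  · obtain ⟨e, he⟩ := hK.exists_torusLabelling h7 hcomplete
    obtain ⟨a, u, q, h⟩ := he.exists_gauge hc
    exact ⟨a, Or.inr ⟨e, u, q, hcomplete, he, h, h.hasReducedValues hcomplete (hc.of_gauge a)⟩⟩

theorem IsTorusCocycle.closure_commute {V G : Type*} [Group G] {e : Fin 7 ≃ V} {c : V → V → G}
    {u q : G} (h : IsTorusCocycle e c u q) :
    ∀ x ∈ Subgroup.closure {u, q}, ∀ y ∈ Subgroup.closure {u, q}, x * y = y * x := by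
  refine _root_.closure_commute ?_
  rintro x (rfl | rfl) y (rfl | rfl)
  exacts [rfl, h.comm, h.comm.symm, rfl]

/-- The group of a full cocycle on a surface with at most seven vertices is commutative. -/
theorem IsFullCocycle.commute_of_card_le {V : Type*} [DecidableEq V] [Fintype V] [Nonempty V]
    {K : AbstractSimplicialComplex V} (hK : IsTriangulatedSurface K) (hV : Fintype.card V ≤ 7)
    {G : Type*} [Group G] {c : V → V → G} (hc : IsFullCocycle K c) (x y : G) : x * y = y * x := by
  obtain ⟨a, ⟨z, h⟩ | ⟨e, u, q, -, -, h1, h⟩⟩ := hK.exists_reduction hV hc.1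
  · have := hc.2 _ a h.1
    exact zpowers_commute z x (this ▸ Subgroup.mem_top x) y (this ▸ Subgroup.mem_top y)
  · have := hc.2 _ a h.1
    exact h1.closure_commute x (this ▸ Subgroup.mem_top x) y (this ▸ Subgroup.mem_top y)

/-- Reduction of holonomy data: if the values of `b` can be taken in a commutative group, they
generate a commutative group `N` such that the total group is an extension by a cyclic group. -/
theorem IsHolonomy.exists_extension {V G : Type*} [DecidableEq V] [Nonempty V] [Group G]
    {K : AbstractSimplicialComplex V} {φ : complexAut K} {b : V → V → G} {t : V → G}
    (h : IsHolonomy K φ b t) {N₀ : Subgroup G} (hb : HasReducedValues K b N₀) :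
    ∃ (N : Subgroup G) (t₀ : G) (n : V → G), N ≤ N₀ ∧
      (∀ u v, ({u, v} : Finset V) ∈ K.faces → b u v ∈ N) ∧ (∀ v, n v ∈ N) ∧
      (∀ u v, ({u, v} : Finset V) ∈ K.faces → t₀⁻¹ * b u v * t₀ =
        n u * b ((φ : Equiv.Perm V) u) ((φ : Equiv.Perm V) v) * (n v)⁻¹) ∧
      (∀ x ∈ N, t₀⁻¹ * x * t₀ ∈ N) ∧ Subgroup.closure ((N : Set G) ∪ {t₀}) = ⊤ := by
  obtain ⟨v₀⟩ := (inferInstance : Nonempty V)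
  let S : Set G := {g | ∃ u v, ({u, v} : Finset V) ∈ K.faces ∧ g = b u v}
  let N := Subgroup.closure S
  have hmem : ∀ u v, ({u, v} : Finset V) ∈ K.faces → b u v ∈ N := fun u v huv =>
    Subgroup.subset_closure ⟨u, v, huv, rfl⟩
  -- Along an edge `x y` with `b x y = 1` the intertwining relation reads `(t x)⁻¹ t y = b (φ x) (φ
  -- y)`, which lies in `N`. Such edges join all vertices.
  have hn : ∀ v, (t v₀)⁻¹ * t v ∈ N := by
    intro v
    induction hb.2 v₀ v with
    | refl => rw [inv_mul_cancel]; exact N.one_mem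
    | @tail x y _ hxy ih =>
      have h1 := h.rel x y hxy.1
      rw [hxy.2, mul_one] at h1
      have h2 := hmem _ _ (complexAut_pair φ hxy.1)
      rw [h1] at h2
      have := N.mul_mem ih h2
      rwa [mul_assoc, mul_inv_cancel_left] at this
  have hrel : ∀ u v, ({u, v} : Finset V) ∈ K.faces → (t v₀)⁻¹ * b u v * t v₀ =
      ((t v₀)⁻¹ * t u) * b ((φ : Equiv.Perm V) u) ((φ : Equiv.Perm V) v) *
        ((t v₀)⁻¹ * t v)⁻¹ := by
    intro u v huv
    rw [h.rel u v huv]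
    group
  have hconj : ∀ x ∈ N, (t v₀)⁻¹ * x * t v₀ ∈ N := by
    intro x hx
    induction hx using Subgroup.closure_induction with
    | mem x hx =>
      obtain ⟨u, v, huv, rfl⟩ := hx
      rw [hrel u v huv]
      exact N.mul_mem (N.mul_mem (hn u) (hmem _ _ (complexAut_pair φ huv))) (N.inv_mem (hn v))
    | one => simp
    | mul x y _ _ hx hy =>
      have := N.mul_mem hx hy
      convert this using 1
      group
    | inv x _ hx =>
      have := N.inv_mem hx
      convert this using 1
      group
  refine ⟨N, t v₀, fun v => (t v₀)⁻¹ * t v, ?_, hmem, hn, hrel, hconj, ?_⟩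
  · rw [Subgroup.closure_le]
    rintro _ ⟨u, v, huv, rfl⟩
    exact hb.1 u v huv
  · have hN : N ≤ Subgroup.closure ((N : Set G) ∪ {t v₀}) := fun x hx =>
      Subgroup.subset_closure (Or.inl hx)
    refine h.full (fun _ => 1) _ (fun u v huv => ?_) fun v => ?_
    · simpa [gaugeBy] using hN (hmem u v huv)
    · have h1 : t v₀ ∈ Subgroup.closure ((N : Set G) ∪ {t v₀}) :=
        Subgroup.subset_closure (Or.inr rfl)
      have := Subgroup.mul_mem _ h1 (hN (hn v))
      simpa using this

/-- A cyclic `N` contributes one dimension and `t` another, so the translations cannot span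
three-space. -/
theorem FlatRep.not_holonomy_of_zpowers {G : Type*} [Group G] (R : FlatRep G) {V : Type*}
    [DecidableEq V] [Nonempty V] {K : AbstractSimplicialComplex V} {φ : complexAut K}
    {b : V → V → G} {t : V → G} (h : IsHolonomy K φ b t) {x : G}
    (hb : HasReducedValues K b (Subgroup.zpowers x)) : False := by
  obtain ⟨N, t₀, n, hN, -, -, -, hconj, hgen⟩ := h.exists_extension hb
  refine R.det_ne_zero (fun a ha b hb => zpowers_commute x a (hN ha) b (hN hb)) hconj hgen
    (w₁ := R.T x) (w₂ := 0) (fun g hg => ?_) ?_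
  · obtain ⟨k, rfl⟩ := hN hg
    exact ⟨k, 0, fun i => by rw [R.T_zpow]; simp⟩
  · exact Matrix.det_eq_zero_of_row_eq_zero 1 fun _ => rfl

/-- The sum of the translation parts along all edges of slope `d` of Möbius' torus. -/
def FlatRep.slopeSum {G : Type*} [Group G] (R : FlatRep G) {V : Type*} (e : Fin 7 ≃ V)
    (c : V → V → G) (d : Fin 7) (i : Fin 3) : ℝ := ∑ j, R.T (c (e j) (e (j + d))) i

/-! ### Sums of translation parts over the edges of a given slope -/

section Torus

variable {G : Type*} [Group G] (R : FlatRep G) {V : Type*}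
  {e : Fin 7 ≃ V} {c : V → V → G} {u q : G}

theorem FlatRep.slopeSum_one (h : IsTorusCocycle e c u q) (i : Fin 3) :
    R.slopeSum e c 1 i = R.T u i := by
  simp only [slopeSum, h.one, Fin.sum_univ_seven, Fin.reduceEq, if_false, if_true, R.T_one]
  ring

theorem FlatRep.slopeSum_two (h : IsTorusCocycle e c u q) (i : Fin 3) :
    R.slopeSum e c 2 i = 7 * R.T q i + 2 * R.T u i := by
  simp only [slopeSum, h.two, Fin.sum_univ_seven, Fin.reduceEq, if_false, if_true, or_false,
    or_true, R.T_mul h.comm.symm]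
  ring

/-- Each edge of slope 3 is the third side of a triangle with sides of slopes 1 and 2; the relation
is summed over all rotations. -/
theorem FlatRep.slopeSum_three (h : IsTorusCocycle e c u q)
    (hcomm : ∀ x ∈ Subgroup.closure {u, q}, ∀ y ∈ Subgroup.closure {u, q}, x * y = y * x)
    (hmem : ∀ x y, c x y ∈ Subgroup.closure {u, q}) (i : Fin 3) :
    R.slopeSum e c 3 i = R.slopeSum e c 1 i + R.slopeSum e c 2 i := by
  simp only [slopeSum, h.three]
  rw [← Equiv.sum_comp (Equiv.addRight (1 : Fin 7)) fun j => R.T (c (e j) (e (j + 2))) i,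
    ← Finset.sum_add_distrib]
  refine Finset.sum_congr rfl fun j _ => ?_
  rw [R.T_mul (hcomm _ (hmem _ _) _ (hmem _ _))]
  rfl

theorem FlatRep.slopeSum_neg [DecidableEq V] {K : AbstractSimplicialComplex V}
    (hcomplete : ∀ u v : V, ({u, v} : Finset V) ∈ K.faces)
    (hc : IsCocycle K c) (d : Fin 7) (i : Fin 3) :
    R.slopeSum e c (-d) i = -R.slopeSum e c d i := by
  simp only [slopeSum]
  rw [← Equiv.sum_comp (Equiv.addRight d) fun j => R.T (c (e j) (e (j + -d))) i,
    ← Finset.sum_neg_distrib]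
  refine Finset.sum_congr rfl fun j _ => ?_
  simp only [Equiv.coe_addRight, add_neg_cancel_right]
  rw [hc.swap (hcomplete (e j) _), R.T_inv]

/-- An affine automorphism maps the edges of slope `d` to those of slope `α d`. The correction terms
`T (n v)` enter with opposite signs at the two ends of each edge and cancel in the sum over all
rotations; this is why slope sums are used. -/
theorem FlatRep.slopeSum_affine [DecidableEq V] {K : AbstractSimplicialComplex V}
    {N : Subgroup G} (hcomm : ∀ a ∈ N, ∀ b ∈ N, a * b = b * a)
    (hcomplete : ∀ u v : V, ({u, v} : Finset V) ∈ K.faces) {φ : complexAut K} {α β : Fin 7}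
    (hα : α ≠ 0) (hφ : ∀ i, (φ : Equiv.Perm V) (e i) = e (α * i + β)) {t : G} {n : V → G}
    (hcN : ∀ u v, c u v ∈ N) (hn : ∀ v, n v ∈ N)
    (hrel : ∀ u v, ({u, v} : Finset V) ∈ K.faces → t⁻¹ * c u v * t =
        n u * c ((φ : Equiv.Perm V) u) ((φ : Equiv.Perm V) v) * (n v)⁻¹) (d : Fin 7) (i : Fin 3) :
    R.s t i * R.slopeSum e c d i = R.slopeSum e c (α * d) i := by
  have h1 : ∀ j, R.s t i * R.T (c (e j) (e (j + d))) i = R.T (n (e j)) i +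
      R.T (c (e (α * j + β)) (e (α * j + β + α * d))) i - R.T (n (e (j + d))) i := by
    intro j
    have hj : α * (j + d) + β = α * j + β + α * d := by
      have : ∀ α β j d : Fin 7, α * (j + d) + β = α * j + β + α * d := by decide +kernel
      exact this α β j d
    rw [← R.T_conj, hrel _ _ (hcomplete _ _), hφ, hφ, hj,
      R.T_mul (hcomm _ (N.mul_mem (hn _) (hcN _ _)) _ (N.inv_mem (hn _))),
      R.T_mul (hcomm _ (hn _) _ (hcN _ _)), R.T_inv]
    ring
  have hbij : Function.Bijective fun j : Fin 7 => α * j + β := by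
    rw [← Finite.injective_iff_bijective]
    have : ∀ α : Fin 7, α ≠ 0 → ∀ β x y : Fin 7, α * x + β = α * y + β → x = y := by
      decide +kernel
    exact fun x y => this α hα β x y
  simp only [slopeSum, Finset.mul_sum, h1]
  rw [Finset.sum_sub_distrib, Finset.sum_add_distrib]
  have e1 : ∑ j, R.T (n (e (j + d))) i = ∑ j, R.T (n (e j)) i :=
    Equiv.sum_comp (Equiv.addRight d) fun j => R.T (n (e j)) i
  have e2 : ∑ j, R.T (c (e (α * j + β)) (e (α * j + β + α * d))) i =
      ∑ j, R.T (c (e j) (e (j + α * d))) i :=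
    Equiv.sum_comp (Equiv.ofBijective _ hbij) fun j => R.T (c (e j) (e (j + α * d))) i
  rw [e1, e2]
  ring

end Torus

/-- The vectors `ω 1` and `ω 2` span everything that `N` contributes, and the linear part of `t₀`
permutes the `ω d` by the multiplier `α`. The relations among the `ω d` leave no admissible
multiplier. -/
theorem FlatRep.not_holonomy_of_torus {G : Type*} [Group G] (R : FlatRep G) {V : Type*}
    [DecidableEq V] [Nonempty V] {K : AbstractSimplicialComplex V} {φ : complexAut K}
    {b : V → V → G} {t : V → G} (h : IsHolonomy K φ b t) {e : Fin 7 ≃ V} {u q : G}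
    (hcomplete : ∀ x y : V, ({x, y} : Finset V) ∈ K.faces) (he : IsTorusLabelling K e)
    (hT : IsTorusCocycle e b u q) (hb : HasReducedValues K b (Subgroup.closure {u, q})) :
    False := by
  obtain ⟨N, t₀, n, hN, hbN, hn, hrel, hconj, hgen⟩ := h.exists_extension hb
  have hcl := hT.closure_commute
  have hcomm : ∀ x ∈ N, ∀ y ∈ N, x * y = y * x := fun x hx y hy => hcl x (hN hx) y (hN hy)
  obtain ⟨α, β, hα, hφ⟩ := he.exists_affine φ
  set ω := R.slopeSum e b with hω
  have w1 : ∀ i, ω 1 i = R.T u i := R.slopeSum_one hT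
  have w2 : ∀ i, ω 2 i = 7 * R.T q i + 2 * R.T u i := R.slopeSum_two hT
  have w3 : ∀ i, ω 3 i = ω 1 i + ω 2 i := R.slopeSum_three hT hcl fun x y => hb.1 x y (hcomplete x y)
  have w4 : ∀ i, ω 4 i = -ω 3 i := R.slopeSum_neg hcomplete h.cocycle 3
  have w5 : ∀ i, ω 5 i = -ω 2 i := R.slopeSum_neg hcomplete h.cocycle 2
  have w6 : ∀ i, ω 6 i = -ω 1 i := R.slopeSum_neg hcomplete h.cocycle 1
  have hs : ∀ d i, R.s t₀ i * ω d i = ω (α * d) i :=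
    R.slopeSum_affine hcomm hcomplete hα hφ (fun x y => hbN x y (hcomplete x y)) hn hrel
  have hss : ∀ d i, ω d i = ω (α * (α * d)) i := by
    intro d i
    rw [← hs, ← hs, ← mul_assoc, R.sq_s, one_mul]
  have hspan : ∀ x ∈ N, ∃ a b : ℝ, ∀ i, R.T x i = a * ω 1 i + b * ω 2 i := by
    intro x hx
    have key : ∀ x ∈ Subgroup.closure {u, q},
        ∃ a b : ℝ, ∀ i, R.T x i = a * R.T u i + b * R.T q i := by
      intro x hx
      induction hx using Subgroup.closure_induction with
      | mem x hx =>
        rcases hx with rfl | rfl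
        exacts [⟨1, 0, fun i => by ring⟩, ⟨0, 1, fun i => by ring⟩]
      | one => exact ⟨0, 0, fun i => by rw [R.T_one]; ring⟩
      | mul x y hx hy h1 h2 =>
        obtain ⟨a, b, h1⟩ := h1
        obtain ⟨a', b', h2⟩ := h2
        refine ⟨a + a', b + b', fun i => ?_⟩
        rw [R.T_mul (hcl x hx y hy), h1, h2]
        ring
      | inv x _ h =>
        obtain ⟨a, b, h⟩ := h
        refine ⟨-a, -b, fun i => ?_⟩
        rw [R.T_inv, h]
        ring
    obtain ⟨a, b, hab⟩ := key x (hN hx)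
    refine ⟨a - 2 * b / 7, b / 7, fun i => ?_⟩
    rw [hab, w1, w2]
    ring
  have hw : ∀ x ∈ N, ∀ i, R.s x i * ω 1 i = ω 1 i ∧ R.s x i * ω 2 i = ω 2 i := by
    have : ∀ d, ∀ x ∈ N, ∀ i, R.s x i * ω d i = ω d i := by
      intro d x hx i
      simp only [hω, FlatRep.slopeSum, Finset.mul_sum]
      exact Finset.sum_congr rfl fun j _ =>
        R.s_mul_T_of_commute (hcomm _ hx _ (hbN _ _ (hcomplete _ _))) i
    exact fun x hx i => ⟨this 1 x hx i, this 2 x hx i⟩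
  have hdep : ∀ k : ℝ, (∀ i, ω 2 i = k * ω 1 i) → False := by
    intro k hk
    refine R.det_ne_zero hcomm hconj hgen hspan ?_
    rw [Matrix.det_fin_three]
    simp only [Matrix.of_apply, Matrix.cons_val_zero, Matrix.cons_val_one, Matrix.cons_val, hk]
    ring
  have hcases : α = 1 ∨ α = 2 ∨ α = 3 ∨ α = 4 ∨ α = 5 ∨ α = 6 := by
    have : ∀ α : Fin 7, α ≠ 0 → α = 1 ∨ α = 2 ∨ α = 3 ∨ α = 4 ∨ α = 5 ∨ α = 6 := by decide
    exact this α hα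
  -- The squares of 2 and 5 are 4 modulo 7, so `ω 1 = ω 4 = -(ω 1 + ω 2)`. The squares of 3 and 4
  -- are 2, so `ω 1 = ω 2`. For the multipliers 1 and 6 the action is by the scalar 1 or -1.
  rcases hcases with rfl | rfl | rfl | rfl | rfl | rfl
  · exact R.not_scalar hcomm hconj hgen hspan hw (one_mul 1)
      (fun i => by rw [one_mul]; exact hs 1 i) (fun i => by rw [one_mul]; exact hs 2 i)
  · refine hdep (-2) fun i => ?_
    have h1 : ω 1 i = ω 4 i := hss 1 i
    linarith [w3 i, w4 i]
  · refine hdep 1 fun i => ?_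
    have h1 : ω 1 i = ω 2 i := hss 1 i
    linarith
  · refine hdep 1 fun i => ?_
    have h1 : ω 1 i = ω 2 i := hss 1 i
    linarith
  · refine hdep (-2) fun i => ?_
    have h1 : ω 1 i = ω 4 i := hss 1 i
    linarith [w3 i, w4 i]
  · refine R.not_scalar hcomm hconj hgen hspan hw (ε := -1) (by norm_num)
      (fun i => ?_) (fun i => ?_)
    · have h1 : R.s t₀ i * ω 1 i = ω 6 i := hs 1 i
      rw [h1, w6]
      ring
    · have h1 : R.s t₀ i * ω 2 i = ω 5 i := hs 2 i
      rw [h1, w5]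
      ring

/-- The group of a non-orientable flat manifold is not the group of a bundle over the circle whose
fibre is a surface with at most seven vertices. -/
theorem FlatRep.not_holonomy {G : Type*} [Group G] (R : FlatRep G) {V : Type*}
    [DecidableEq V] [Fintype V] [Nonempty V] {K : AbstractSimplicialComplex V}
    (hK : IsTriangulatedSurface K) (hV : Fintype.card V ≤ 7) {φ : complexAut K}
    {b : V → V → G} {t : V → G} (h : IsHolonomy K φ b t) : False := by
  obtain ⟨a, ⟨x, hx⟩ | ⟨e, u, q, hcomplete, he, h1, h2⟩⟩ := hK.exists_reduction hV h.cocycle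
  · exact R.not_holonomy_of_zpowers (h.of_gauge a) hx
  · exact R.not_holonomy_of_torus (h.of_gauge a) hcomplete he h1 h2

/-! ### The groups of the flat manifolds -/

/-- If the linear part is `+1` in the displaced coordinate, the square doubles the translation
there, which must vanish. If it is `-1`, a point with coordinate `t i / 2` is not displaced at all.
-/
theorem HasDisplacement.eq_one_of_mul_self {n : ℕ}
    {Γ : Subgroup (EuclideanSpace ℝ (Fin n) ≃ᵢ EuclideanSpace ℝ (Fin n))} (hΓ : HasDisplacement Γ)
    {s : Fin n → ℤˣ} {t : Fin n → ℝ} (hg : signedMotion s t ∈ Γ)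
    (h : signedMotion s t * signedMotion s t = 1) : signedMotion s t = 1 := by
  rcases hΓ _ hg with h1 | ⟨i, hi⟩
  · exact h1
  exfalso
  rcases Int.units_eq_one_or (s i) with hs | hs
  · have h0 := hi 0
    have := congrArg (fun g => g (0 : EuclideanSpace ℝ (Fin n)) i) h
    rw [signedMotion_mul] at this
    change _ = (0 : ℝ) at this
    simp only [signedMotion_apply, hs, PiLp.zero_apply, mul_zero] at this h0
    simp only [Units.val_one, Int.cast_one, one_mul, zero_add, sub_zero] at this h0
    have h2 : t i = 0 := by linarith
    rw [h2, abs_zero] at h0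
    norm_num at h0
  · have := hi (WithLp.toLp 2 fun j => t j / 2)
    simp only [signedMotion_apply, hs] at this
    norm_num at this
    have h2 : -(t i / 2) + t i - t i / 2 = 0 := by ring
    rw [h2, abs_zero] at this
    norm_num at this

/-- The tautological representation of a group of motions with diagonal linear parts. -/
theorem nonempty_flatRep_of_form
    {Γ : Subgroup (EuclideanSpace ℝ (Fin 3) ≃ᵢ EuclideanSpace ℝ (Fin 3))}
    (hform : ∀ g : Γ, ∃ (s : Fin 3 → ℤˣ) (t : Fin 3 → ℝ), g.1 = signedMotion s t)
    (hΓ : HasDisplacement Γ)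
    (hlattice : ∀ i, ∃ g ∈ Γ, ∃ (s : Fin 3 → ℤˣ) (t : Fin 3 → ℝ),
      g * g * (g * g) = signedMotion s t ∧ t i ≠ 0 ∧ ∀ j, j ≠ i → t j = 0)
    (hrev : ∃ (s : Fin 3 → ℤˣ) (t : Fin 3 → ℝ), signedMotion s t ∈ Γ ∧
      ∏ i, ((s i : ℤ) : ℝ) = -1) : Nonempty (FlatRep Γ) := by
  choose S T hST using hform
  have hmul : ∀ g h : Γ, S (g * h) = S g * S h ∧
      T (g * h) = fun i => ((S g i : ℤ) : ℝ) * T h i + T g i := by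
    intro g h
    refine signedMotion_inj ?_
    rw [← hST, ← signedMotion_mul, ← hST, ← hST]
    rfl
  refine ⟨{ s := fun g i => ((S g i : ℤ) : ℝ), t := T, mul_s := ?_, mul_t := ?_, sq_s := ?_,
            faithful := ?_, two_torsion := ?_, lattice := ?_, reversing := ?_ }⟩
  · intro g h i
    rw [(hmul g h).1]
    simp
  · intro g h i
    rw [(hmul g h).2]
  · exact fun g i => units_cast_mul_self _
  · intro g hs ht
    refine Subtype.ext ((hST g).trans ?_)
    rw [show S g = 1 from funext fun i => Units.ext (show (S g i : ℤ) = 1 by exact_mod_cast hs i),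
      show T g = 0 from funext ht, signedMotion_one]
    rfl
  · intro g h
    have h2 : g.1 * g.1 = 1 := congrArg Subtype.val h
    have hg := g.2
    refine Subtype.ext ?_
    rw [hST g] at h2 hg ⊢
    exact hΓ.eq_one_of_mul_self hg h2
  · intro a ha
    funext i
    obtain ⟨g, hg, s, t, h, hi, hj⟩ := hlattice i
    have h1 := ha ⟨g, hg⟩
    have h2 := signedMotion_inj ((hST (⟨g, hg⟩ * ⟨g, hg⟩ * (⟨g, hg⟩ * ⟨g, hg⟩))).symm.trans h)
    rw [h2.2, Finset.sum_eq_single i (fun j _ hji => by rw [hj j hji, zero_mul])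
      (fun h => absurd (mem_univ i) h)] at h1
    exact (mul_eq_zero.1 h1).resolve_left hi
  · obtain ⟨s, t, hg, h⟩ := hrev
    refine ⟨⟨_, hg⟩, ?_⟩
    rw [← (signedMotion_inj (hST ⟨_, hg⟩)).1]
    exact h

/-- Three elements whose fourth powers are supported on the three axes witness the full rank
required by `FlatRep.lattice`. -/
theorem exists_fourth_power {Γ : Subgroup (EuclideanSpace ℝ (Fin 3) ≃ᵢ EuclideanSpace ℝ (Fin 3))}
    {x y z : EuclideanSpace ℝ (Fin 3) ≃ᵢ EuclideanSpace ℝ (Fin 3)} (hx : x ∈ Γ) (hy : y ∈ Γ)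
    (hz : z ∈ Γ) {a b c : ℝ} (ha : a ≠ 0) (hb : b ≠ 0) (hc : c ≠ 0) {s₁ s₂ s₃ : Fin 3 → ℤˣ}
    (hx4 : x * x * (x * x) = signedMotion s₁ ![a, 0, 0])
    (hy4 : y * y * (y * y) = signedMotion s₂ ![0, b, 0])
    (hz4 : z * z * (z * z) = signedMotion s₃ ![0, 0, c]) (i : Fin 3) :
    ∃ g ∈ Γ, ∃ (s : Fin 3 → ℤˣ) (t : Fin 3 → ℝ),
      g * g * (g * g) = signedMotion s t ∧ t i ≠ 0 ∧ ∀ j, j ≠ i → t j = 0 := by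
  fin_cases i
  · refine ⟨x, hx, _, _, hx4, ha, fun j hj => ?_⟩
    fin_cases j <;> first | rfl | exact absurd rfl hj
  · refine ⟨y, hy, _, _, hy4, hb, fun j hj => ?_⟩
    fin_cases j <;> first | rfl | exact absurd rfl hj
  · refine ⟨z, hz, _, _, hz4, hc, fun j hj => ?_⟩
    fin_cases j <;> first | rfl | exact absurd rfl hj

theorem nonempty_flatRep (i : Fin 4) : Nonempty (FlatRep (bieberbachGroup i)) := by
  have h2 : sgn 2 = 1 := sgn_of_even (by decide)
  have h4 : sgn 4 = 1 := sgn_of_even (by decide)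
  have h8 : sgn 8 = 1 := sgn_of_even (by decide)
  fin_cases i
  · refine nonempty_flatRep_of_form ?_ (hasDisplacement_bieberbachGroup 0) ?_ ?_
    · rintro ⟨g, hg⟩
      obtain ⟨m, n, k, rfl⟩ := (mem_bieberbachGroup_zero_iff g).1 hg
      exact ⟨_, _, rfl⟩
    · refine exists_fourth_power ((mem_bieberbachGroup_zero_iff _).2 ⟨1, 0, 0, rfl⟩)
        ((mem_bieberbachGroup_zero_iff _).2 ⟨0, 1, 0, rfl⟩)
        ((mem_bieberbachGroup_zero_iff _).2 ⟨0, 0, 1, rfl⟩) (a := 2) (b := 4) (c := 4)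
        (by norm_num) (by norm_num) (by norm_num)
        (s₁ := ![1, 1, 1]) (s₂ := ![1, 1, 1]) (s₃ := ![1, 1, 1]) ?_ ?_ ?_
      all_goals
        simp only [form₁_mul]
        norm_num [form₁, sgn_one, sgn_zero, h2, h4, h8]
    · refine ⟨_, _, (mem_bieberbachGroup_zero_iff _).2 ⟨1, 0, 0, rfl⟩, ?_⟩
      simp [Fin.prod_univ_three, sgn_one]
  · refine nonempty_flatRep_of_form ?_ (hasDisplacement_bieberbachGroup 1) ?_ ?_
    · rintro ⟨g, hg⟩
      obtain ⟨m, n, k, -, rfl⟩ := (mem_bieberbachGroup_one_iff g).1 hg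
      exact ⟨_, _, rfl⟩
    · refine exists_fourth_power ((mem_bieberbachGroup_one_iff _).2 ⟨1, 0, 0, rfl, rfl⟩)
        ((mem_bieberbachGroup_one_iff _).2 ⟨0, 2, 0, rfl, rfl⟩)
        ((mem_bieberbachGroup_one_iff _).2 ⟨0, 0, 2, rfl, rfl⟩) (a := 2) (b := 4) (c := 8)
        (by norm_num) (by norm_num) (by norm_num)
        (s₁ := ![1, 1, 1]) (s₂ := ![1, 1, 1]) (s₃ := ![1, 1, 1]) ?_ ?_ ?_
      all_goals
        simp only [form₂_mul]
        norm_num [form₂, sgn_one, sgn_zero, h2, h4, h8]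
    · refine ⟨_, _, (mem_bieberbachGroup_one_iff _).2 ⟨1, 0, 0, rfl, rfl⟩, ?_⟩
      simp [Fin.prod_univ_three, sgn_one]
  · refine nonempty_flatRep_of_form ?_ (hasDisplacement_bieberbachGroup 2) ?_ ?_
    · rintro ⟨g, hg⟩
      obtain ⟨m, n, k, rfl⟩ := (mem_bieberbachGroup_two_iff g).1 hg
      exact ⟨_, _, rfl⟩
    · refine exists_fourth_power ((mem_bieberbachGroup_two_iff _).2 ⟨1, 0, 0, rfl⟩)
        ((mem_bieberbachGroup_two_iff _).2 ⟨0, 1, 0, rfl⟩)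
        ((mem_bieberbachGroup_two_iff _).2 ⟨0, 0, 1, rfl⟩) (a := 2) (b := 2) (c := 4)
        (by norm_num) (by norm_num) (by norm_num)
        (s₁ := ![1, 1, 1]) (s₂ := ![1, 1, 1]) (s₃ := ![1, 1, 1]) ?_ ?_ ?_
      all_goals
        simp only [form₃_mul]
        norm_num [form₃, sgn_one, sgn_zero, h2, h4, h8]
    · refine ⟨_, _, (mem_bieberbachGroup_two_iff _).2 ⟨0, 1, 0, rfl⟩, ?_⟩
      simp [Fin.prod_univ_three, sgn_one, sgn_zero]
  · refine nonempty_flatRep_of_form ?_ (hasDisplacement_bieberbachGroup 3) ?_ ?_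
    · rintro ⟨g, hg⟩
      obtain ⟨m, n, k, -, rfl⟩ := (mem_bieberbachGroup_three_iff g).1 hg
      exact ⟨_, _, rfl⟩
    · refine exists_fourth_power ((mem_bieberbachGroup_three_iff _).2 ⟨1, 0, 0, rfl, rfl⟩)
        ((mem_bieberbachGroup_three_iff _).2 ⟨0, 2, 0, rfl, rfl⟩)
        ((mem_bieberbachGroup_three_iff _).2 ⟨0, 0, 2, rfl, rfl⟩) (a := 2) (b := 4) (c := 4)
        (by norm_num) (by norm_num) (by norm_num)
        (s₁ := ![1, 1, 1]) (s₂ := ![1, 1, 1]) (s₃ := ![1, 1, 1]) ?_ ?_ ?_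
      all_goals
        simp only [form₄_mul]
        norm_num [form₄, sgn_one, sgn_zero, h2, h4, h8]
    · refine ⟨_, _, (mem_bieberbachGroup_three_iff _).2 ⟨0, 1, 1, rfl, rfl⟩, ?_⟩
      simp [Fin.prod_univ_three, sgn_one, sgn_zero]

theorem exists_not_commute_kleinGroup : ∃ x y : kleinGroup, x * y ≠ y * x := by
  refine ⟨⟨kleinForm 1 0, (mem_kleinGroup_iff _).2 ⟨_, _, rfl⟩⟩,
    ⟨kleinForm 0 1, (mem_kleinGroup_iff _).2 ⟨_, _, rfl⟩⟩, fun h => ?_⟩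
  have h1 := congrArg Subtype.val h
  simp only [Subgroup.coe_mul, kleinForm_mul] at h1
  have h2 := congrFun (signedMotion_inj h1).2 1
  norm_num [sgn_one, sgn_zero] at h2

/-! ### Minimality -/

theorem eight_le_card_of_kleinBottle {V : Type*} [DecidableEq V] [Fintype V]
    {K : AbstractSimplicialComplex V} (hK : IsTriangulatedSurface K)
    (h : geomRealization K ≃ₜ KleinBottle) : 8 ≤ Fintype.card V := by
  by_contra hV
  obtain ⟨hne, c, hc⟩ := exists_isFullCocycle (hasDisplacement_kleinGroup.isQuotientCoveringMap) h
  obtain ⟨x, y, hxy⟩ := exists_not_commute_kleinGroup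
  exact hxy (hc.commute_of_card_le hK (by omega) x y)

theorem eight_le_card_of_twistedProduct {V : Type*} [LinearOrder V] [Fintype V]
    {K : AbstractSimplicialComplex V} (hK : IsTriangulatedSurface K) {φ : complexAut K} {i : Fin 4}
    (h : geomRealization (twistedProduct K φ) ≃ₜ FlatB i) : 8 ≤ Fintype.card V := by
  by_contra hV
  obtain ⟨hne, c, hc⟩ :=
    exists_isFullCocycle ((hasDisplacement_bieberbachGroup i).isQuotientCoveringMap) h
  obtain ⟨R⟩ := nonempty_flatRep i
  obtain ⟨b, t, hbt⟩ := hc.exists_holonomy_of_twistedProduct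
  have : Nonempty V := hne.map Prod.fst
  exact R.not_holonomy hK (by omega) hbt

theorem eight_le_card_of_productComplex {V W : Type*} [LinearOrder V] [Fintype V] [LinearOrder W]
    [Fintype W] {K : AbstractSimplicialComplex V} {C : AbstractSimplicialComplex W}
    (hK : IsTriangulatedSurface K) (hC : IsTriangulatedCircle C.toPreAbstractSimplicialComplex)
    {i : Fin 4} (h : geomRealization (productComplex K C) ≃ₜ FlatB i) : 8 ≤ Fintype.card V := by
  by_contra hV
  obtain ⟨hne, c, hc⟩ :=
    exists_isFullCocycle ((hasDisplacement_bieberbachGroup i).isQuotientCoveringMap) h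
  obtain ⟨R⟩ := nonempty_flatRep i
  obtain ⟨b, t, hbt⟩ := hc.exists_holonomy_of_productComplex hC
  have : Nonempty V := hne.map Prod.fst
  exact R.not_holonomy hK (by omega) hbt

/-! ### Homeomorphisms between quotients of compact spaces -/

/-- Both spaces are quotients of one compact space by the same relation, and a continuous bijection
from a compact to a Hausdorff space is a homeomorphism. -/
theorem nonempty_homeomorph_of_fibres {X Y Z : Type*} [TopologicalSpace X] [CompactSpace X]
    [TopologicalSpace Y] [T2Space Y] [TopologicalSpace Z] [T2Space Z] {q : X → Y} {r : X → Z}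
    (hq : Continuous q) (hr : Continuous r) (hq' : Function.Surjective q)
    (hr' : Function.Surjective r) (h : ∀ x x', q x = q x' ↔ r x = r x') : Nonempty (Y ≃ₜ Z) := by
  have hqq : Topology.IsQuotientMap q := hq.isClosedMap.isQuotientMap hq hq'
  have : CompactSpace Y := ⟨by
    rw [← hq'.range_eq]
    exact isCompact_range hq⟩
  choose g hg using hq'
  have hfac : (r ∘ g) ∘ q = r := funext fun x => (h _ _).1 (hg (q x))
  have hcont : Continuous (r ∘ g) := by
    rw [hqq.continuous_iff, hfac]
    exact hr
  have hbij : Function.Bijective (r ∘ g) := by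
    refine ⟨fun y y' hy => ?_, fun z => ?_⟩
    · rw [← hg y, ← hg y']
      exact (h _ _).2 hy
    · obtain ⟨x, rfl⟩ := hr' z
      exact ⟨q x, congrFun hfac x⟩
  exact ⟨Continuous.homeoOfEquivCompactToT2 (f := Equiv.ofBijective _ hbij) hcont⟩

/-! ### The realization of a twisted product -/

section Staircase

variable {V : Type*} [LinearOrder V] [Fintype V]

/-- The part of the mass at `v` lying below the threshold `θ`, when the masses `a` are stacked in
increasing order. -/
def lowPart (a : V → ℝ) (θ : ℝ) (v : V) : ℝ :=
  min (∑ w ∈ univ.filter (· ≤ v), a w) θ - min (∑ w ∈ univ.filter (· < v), a w) θ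

theorem sum_filter_le (a : V → ℝ) (v : V) :
    ∑ w ∈ univ.filter (· ≤ v), a w = ∑ w ∈ univ.filter (· < v), a w + a v := by
  have : univ.filter (· ≤ v) = insert v (univ.filter (· < v)) := by
    ext w
    simp [le_iff_eq_or_lt]
  rw [this, Finset.sum_insert (by simp), add_comm]

theorem lowPart_of_sum_le {a : V → ℝ} (ha : ∀ v, 0 ≤ a v) {θ : ℝ} {v : V}
    (h : ∑ w ∈ univ.filter (· ≤ v), a w ≤ θ) : lowPart a θ v = a v := by
  have h1 := sum_filter_le a v
  rw [lowPart, min_eq_left h, min_eq_left (by linarith [ha v])]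
  linarith

theorem lowPart_of_le_sum {a : V → ℝ} (ha : ∀ v, 0 ≤ a v) {θ : ℝ} {v : V}
    (h : θ ≤ ∑ w ∈ univ.filter (· < v), a w) : lowPart a θ v = 0 := by
  have h1 := sum_filter_le a v
  rw [lowPart, min_eq_right h, min_eq_right (by linarith [ha v]), sub_self]

theorem lowPart_mono {a : V → ℝ} (ha : ∀ v, 0 ≤ a v) {θ θ' : ℝ} (h : θ ≤ θ') (v : V) :
    lowPart a θ v ≤ lowPart a θ' v := by
  have h1 := sum_filter_le a v
  have h2 := ha v
  simp only [lowPart]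
  rcases min_cases (∑ w ∈ univ.filter (· ≤ v), a w) θ with ⟨e1, _⟩ | ⟨e1, _⟩ <;>
  rcases min_cases (∑ w ∈ univ.filter (· < v), a w) θ with ⟨e2, _⟩ | ⟨e2, _⟩ <;>
  rcases min_cases (∑ w ∈ univ.filter (· ≤ v), a w) θ' with ⟨e3, _⟩ | ⟨e3, _⟩ <;>
  rcases min_cases (∑ w ∈ univ.filter (· < v), a w) θ' with ⟨e4, _⟩ | ⟨e4, _⟩ <;>
  rw [e1, e2, e3, e4] <;> linarith

theorem lowPart_zero {a : V → ℝ} (ha : ∀ v, 0 ≤ a v) (v : V) : lowPart a 0 v = 0 :=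
  lowPart_of_le_sum ha (Finset.sum_nonneg fun w _ => ha w)

theorem lowPart_one {a : V → ℝ} (ha : ∀ v, 0 ≤ a v) (hs : ∑ v, a v = 1) (v : V) :
    lowPart a 1 v = a v :=
  lowPart_of_sum_le ha (hs ▸ Finset.sum_le_sum_of_subset_of_nonneg (Finset.filter_subset _ _)
    fun w _ _ => ha w)

/-- A splitting of the masses along a staircase is the splitting by a threshold. -/
theorem lowPart_eq_of_staircase {low high : V → ℝ} (hl : ∀ v, 0 ≤ low v) (hh : ∀ v, 0 ≤ high v)
    (hchain : ∀ v w, low v ≠ 0 → high w ≠ 0 → v ≤ w) (v : V) :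
    lowPart (fun w => low w + high w) (∑ w, low w) v = low v := by
  -- On a down-set the accumulated mass, cut off at the total low mass, is the low mass of the set:
  -- once some high mass has occurred in it, all the low mass lies in it.
  have key : ∀ D : Finset V, (∀ x ∈ D, ∀ y, y ≤ x → y ∈ D) →
      min (∑ w ∈ D, (low w + high w)) (∑ w, low w) = ∑ w ∈ D, low w := by
    intro D hD
    have hle : ∑ w ∈ D, low w ≤ ∑ w, low w :=
      Finset.sum_le_sum_of_subset_of_nonneg (Finset.subset_univ _) fun w _ _ => hl w
    rw [Finset.sum_add_distrib]
    have hh' : 0 ≤ ∑ w ∈ D, high w := Finset.sum_nonneg fun w _ => hh w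
    by_cases h : ∃ w ∈ D, high w ≠ 0
    · obtain ⟨w, hw, hne⟩ := h
      have : ∑ w ∈ D, low w = ∑ w, low w := by
        refine Finset.sum_subset (Finset.subset_univ _) fun x _ hx => ?_
        by_contra hx0
        exact hx (hD w hw x (hchain x w hx0 hne))
      rw [this]
      exact min_eq_right (by linarith)
    · push Not at h
      rw [Finset.sum_eq_zero h, add_zero]
      exact min_eq_left hle
  have hs := sum_filter_le low v
  rw [lowPart, key _ (fun x hx y hy => ?_), key _ (fun x hx y hy => ?_)]
  · linarith
  · simp only [mem_filter, mem_univ, true_and] at hx ⊢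
    exact hy.trans_lt hx
  · simp only [mem_filter, mem_univ, true_and] at hx ⊢
    exact hy.trans hx

theorem continuous_lowPart (v : V) :
    Continuous fun x : (V → ℝ) × ℝ => lowPart x.1 x.2 v := by
  unfold lowPart
  fun_prop

/-- The function `max 0 (min 1 t)`. -/
def clamp (t : ℝ) : ℝ := max 0 (min 1 t)

theorem clamp_of_nonpos {t : ℝ} (h : t ≤ 0) : clamp t = 0 := by
  rw [clamp, min_eq_right (by linarith), max_eq_left h]

theorem clamp_of_one_le {t : ℝ} (h : 1 ≤ t) : clamp t = 1 := by
  rw [clamp, min_eq_left h, max_eq_right zero_le_one]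

theorem clamp_of_mem {t : ℝ} (h0 : 0 ≤ t) (h1 : t ≤ 1) : clamp t = t := by
  rw [clamp, min_eq_right h1, max_eq_right h0]

theorem clamp_mono {t t' : ℝ} (h : t ≤ t') : clamp t ≤ clamp t' :=
  max_le_max le_rfl (min_le_min le_rfl h)

theorem continuous_clamp : Continuous clamp := by
  unfold clamp
  fun_prop

/-- The barycentric coordinates, with respect to the staircase triangulation of `V × {0, …, 3}`, of
the point at height `y` over the point with barycentric coordinates `a`. -/
def prismCoord (a : V → ℝ) (y : ℝ) (p : V × Fin 4) : ℝ :=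
  lowPart a (clamp ((p.2 : ℕ) + 1 - y)) p.1 - lowPart a (clamp ((p.2 : ℕ) - y)) p.1

theorem prismCoord_nonneg {a : V → ℝ} (ha : ∀ v, 0 ≤ a v) (y : ℝ) (p : V × Fin 4) :
    0 ≤ prismCoord a y p :=
  sub_nonneg.2 (lowPart_mono ha (clamp_mono (by linarith)) _)

theorem prismCoord_sum {a : V → ℝ} (ha : ∀ v, 0 ≤ a v) (hs : ∑ v, a v = 1) {y : ℝ} (h0 : 0 ≤ y)
    (h3 : y ≤ 3) (v : V) : ∑ j, prismCoord a y (v, j) = a v := by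
  have e0 : clamp (((0 : Fin 4) : ℕ) - y) = 0 := clamp_of_nonpos (by simpa using h0)
  have e4 : clamp (((3 : Fin 4) : ℕ) + 1 - y) = 1 := clamp_of_one_le (by
    have : ((3 : Fin 4) : ℕ) = 3 := rfl
    rw [this]
    push_cast
    linarith)
  have e1 : ((0 : Fin 4) : ℕ) + 1 - y = ((1 : Fin 4) : ℕ) - y := by simp
  have e2 : ((1 : Fin 4) : ℕ) + 1 - y = ((2 : Fin 4) : ℕ) - y := by
    have : ((2 : Fin 4) : ℕ) = 2 := rfl
    rw [this]
    norm_num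
  have e3 : ((2 : Fin 4) : ℕ) + 1 - y = ((3 : Fin 4) : ℕ) - y := by
    have : ((2 : Fin 4) : ℕ) = 2 := rfl
    rw [this]
    have : ((3 : Fin 4) : ℕ) = 3 := rfl
    rw [this]
    norm_num
  rw [Fin.sum_univ_four]
  simp only [prismCoord]
  rw [e0, e4, e1, e2, e3, lowPart_zero ha, lowPart_one ha hs]
  ring

/-- When the masses are stacked, `p.1` occupies the interval between the partial sums over `w < p.1`
and `w ≤ p.1`, and the level `p.2` the interval between the two clamped thresholds. The coordinate
is the length of the intersection. -/
theorem prismCoord_ne_zero {a : V → ℝ} (ha : ∀ v, 0 ≤ a v) {y : ℝ} {p : V × Fin 4}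
    (h : prismCoord a y p ≠ 0) :
    ∑ w ∈ univ.filter (· < p.1), a w < clamp ((p.2 : ℕ) + 1 - y) ∧
      clamp ((p.2 : ℕ) - y) < ∑ w ∈ univ.filter (· ≤ p.1), a w ∧ a p.1 ≠ 0 ∧
      y < (p.2 : ℕ) + 1 ∧ ((p.2 : ℕ) : ℝ) < y + 1 := by
  have hm : clamp ((p.2 : ℕ) - y) ≤ clamp ((p.2 : ℕ) + 1 - y) := clamp_mono (by linarith)
  refine ⟨?_, ?_, ?_, ?_, ?_⟩
  · by_contra hle
    push Not at hle
    refine h ?_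
    rw [prismCoord, lowPart_of_le_sum ha hle, lowPart_of_le_sum ha (hm.trans hle), sub_self]
  · by_contra hle
    push Not at hle
    refine h ?_
    rw [prismCoord, lowPart_of_sum_le ha hle, lowPart_of_sum_le ha (hle.trans hm), sub_self]
  · intro h0
    refine h ?_
    have := sum_filter_le a p.1
    rw [h0, add_zero] at this
    simp only [prismCoord, lowPart, this]
    ring
  · by_contra hle
    push Not at hle
    refine h ?_
    rw [prismCoord, clamp_of_nonpos (t := (p.2 : ℕ) + 1 - y) (by linarith),
      clamp_of_nonpos (t := (p.2 : ℕ) - y) (by linarith), sub_self]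
  · by_contra hle
    push Not at hle
    refine h ?_
    rw [prismCoord, clamp_of_one_le (t := (p.2 : ℕ) + 1 - y) (by linarith),
      clamp_of_one_le (t := (p.2 : ℕ) - y) (by linarith), sub_self]

/-- The vertices with nonzero coordinates form a face of the staircase triangulation. -/
theorem prismCoord_support {K : AbstractSimplicialComplex V} {a : V → ℝ}
    (ha : a ∈ geomRealization K) {y : ℝ} (h0 : 0 ≤ y) (h3 : y ≤ 3) :
    univ.filter (fun p => prismCoord a y p ≠ 0) ∈ (productComplex K intervalComplex).faces := by
  obtain ⟨hnn, hsum, s, hs, hsupp⟩ := ha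
  have hne : (univ.filter fun p => prismCoord a y p ≠ 0).Nonempty := by
    by_contra hem
    rw [Finset.not_nonempty_iff_eq_empty, Finset.filter_eq_empty_iff] at hem
    have : ∑ v, a v = 0 := Finset.sum_eq_zero fun v _ => by
      rw [← prismCoord_sum hnn hsum h0 h3 v]
      exact Finset.sum_eq_zero fun j _ => not_not.1 (hem (mem_univ (v, j)))
    linarith
  refine ⟨hne, ?_, ?_, hne.image _, ?_⟩
  · have key : ∀ p q : V × Fin 4, prismCoord a y p ≠ 0 → prismCoord a y q ≠ 0 → p.1 < q.1 →
        p.2 ≤ q.2 := by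
      intro p q hp hq hlt
      obtain ⟨-, p2, -⟩ := prismCoord_ne_zero hnn hp
      obtain ⟨q1, -⟩ := prismCoord_ne_zero hnn hq
      by_contra hj
      push Not at hj
      have hj' : ((q.2 : ℕ) : ℝ) + 1 ≤ ((p.2 : ℕ) : ℝ) := by exact_mod_cast hj
      have h1 : clamp ((q.2 : ℕ) + 1 - y) ≤ clamp ((p.2 : ℕ) - y) := clamp_mono (by linarith)
      have h2 : ∑ w ∈ univ.filter (· ≤ p.1), a w ≤ ∑ w ∈ univ.filter (· < q.1), a w :=
        Finset.sum_le_sum_of_subset_of_nonneg (fun w hw => by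
          simp only [mem_filter, mem_univ, true_and] at hw ⊢
          exact hw.trans_lt hlt) fun w _ _ => hnn w
      linarith
    intro p hp q hq _
    simp only [coe_filter, mem_univ, true_and, Set.mem_ofPred_eq] at hp hq
    rcases lt_trichotomy p.1 q.1 with h | h | h
    · exact Or.inl ⟨h.le, key p q hp hq h⟩
    · rcases le_total p.2 q.2 with h' | h'
      · exact Or.inl ⟨h.le, h'⟩
      · exact Or.inr ⟨h.ge, h'⟩
    · exact Or.inr ⟨h.le, key q p hq hp h⟩
  · refine face_mono hs ?_ (hne.image _)
    intro v hv
    obtain ⟨p, hp, rfl⟩ := Finset.mem_image.1 hv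
    by_contra hvs
    exact (prismCoord_ne_zero hnn (Finset.mem_filter.1 hp).2).2.2.1 (hsupp _ hvs)
  · have hbound : ∀ j ∈ (univ.filter fun p => prismCoord a y p ≠ 0).image Prod.snd,
        y < (j : ℕ) + 1 ∧ ((j : ℕ) : ℝ) < y + 1 := by
      intro j hj
      obtain ⟨p, hp, rfl⟩ := Finset.mem_image.1 hj
      exact (prismCoord_ne_zero hnn (Finset.mem_filter.1 hp).2).2.2.2
    have hlev : ∀ i : Fin 3, ((i : ℕ) : ℝ) ≤ y → y ≤ (i : ℕ) + 1 →
        (univ.filter fun p => prismCoord a y p ≠ 0).image Prod.snd ⊆ {i.castSucc, i.succ} := by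
      intro i h1 h2 j hj
      obtain ⟨b1, b2⟩ := hbound j hj
      have c1 : ((i : ℕ) : ℝ) < (j : ℕ) + 1 := by linarith
      have c2 : ((j : ℕ) : ℝ) < (i : ℕ) + 1 + 1 := by linarith
      have c1' : (i : ℕ) < (j : ℕ) + 1 := by exact_mod_cast c1
      have c2' : (j : ℕ) < (i : ℕ) + 1 + 1 := by exact_mod_cast c2
      simp only [mem_insert, mem_singleton, Fin.ext_iff, Fin.val_castSucc, Fin.val_succ]
      omega
    rcases le_total y 1 with h1 | h1
    · exact ⟨0, hlev 0 (by simpa using h0) (by simpa using h1)⟩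
    rcases le_total y 2 with h2 | h2
    · exact ⟨1, hlev 1 (by simpa using h1) (by norm_num; linarith)⟩
    · exact ⟨2, hlev 2 (by simpa using h2) (by norm_num; linarith)⟩

end Staircase

/-! ### Coordinates on the mapping torus -/

section Bundle

variable {V : Type*} [LinearOrder V] [Fintype V]

/-- The sum telescopes along the order. The claim is made for all finite subsets, so that a new
maximum can be added without changing the earlier terms. -/
theorem sum_lowPart_eq_min (a : V → ℝ) {θ : ℝ} (hθ : 0 ≤ θ) :
    ∑ v, lowPart a θ v = min (∑ v, a v) θ := by
  have key : ∀ D : Finset V, ∑ v ∈ D, (min (∑ w ∈ D.filter (· ≤ v), a w) θ -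
      min (∑ w ∈ D.filter (· < v), a w) θ) = min (∑ v ∈ D, a v) θ := by
    intro D
    refine Finset.induction_on_max D (by simp [hθ]) fun x D hx ih => ?_
    · have hxD : x ∉ D := fun h => lt_irrefl _ (hx x h)
      rw [Finset.sum_insert hxD]
      have e1 : (insert x D).filter (· ≤ x) = insert x D := by
        rw [Finset.filter_true_of_mem]
        intro w hw
        rcases Finset.mem_insert.1 hw with rfl | h
        exacts [le_rfl, (hx w h).le]
      have e2 : (insert x D).filter (· < x) = D := by
        rw [Finset.filter_insert, if_neg (lt_irrefl x), Finset.filter_true_of_mem hx]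
      have e3 : ∀ v ∈ D, (insert x D).filter (· ≤ v) = D.filter (· ≤ v) := fun v hv => by
        rw [Finset.filter_insert, if_neg (not_le.2 (hx v hv))]
      have e4 : ∀ v ∈ D, (insert x D).filter (· < v) = D.filter (· < v) := fun v hv => by
        rw [Finset.filter_insert, if_neg (not_lt.2 (hx v hv).le)]
      have e5 : ∑ v ∈ D, (min (∑ w ∈ (insert x D).filter (· ≤ v), a w) θ -
          min (∑ w ∈ (insert x D).filter (· < v), a w) θ) = min (∑ v ∈ D, a v) θ := by
        rw [← ih]
        exact Finset.sum_congr rfl fun v hv => by rw [e3 v hv, e4 v hv]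
      rw [e1, e2, e5, Finset.sum_insert hxD]
      ring
  exact key univ

theorem sum_lowPart {a : V → ℝ} (hs : ∑ v, a v = 1) {θ : ℝ} (h0 : 0 ≤ θ) (h1 : θ ≤ 1) :
    ∑ v, lowPart a θ v = θ := by
  rw [sum_lowPart_eq_min a h0, hs, min_eq_right h1]

/-- The barycentric coordinates in the twisted product of the point at height `y ∈ [0, 3]` over the
point with barycentric coordinates `a`. -/
def bundleCoord (φ : Equiv.Perm V) (a : V → ℝ) (y : ℝ) (p : V × Fin 3) : ℝ :=
  prismCoord a y (p.1, p.2.castSucc) + if p.2 = 0 then prismCoord a y (φ.symm p.1, 3) else 0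

theorem bundleCoord_zero (φ : Equiv.Perm V) (a : V → ℝ) (y : ℝ) (v : V) :
    bundleCoord φ a y (φ v, 0) = lowPart a (clamp (1 - y)) (φ v) - lowPart a (clamp (-y)) (φ v) +
      (lowPart a (clamp (4 - y)) v - lowPart a (clamp (3 - y)) v) := by
  have h3 : ((3 : Fin 4) : ℕ) = 3 := rfl
  simp only [bundleCoord, prismCoord, h3, if_true, Fin.castSucc_zero, Fin.val_zero, Nat.cast_zero,
    zero_add, zero_sub, Equiv.symm_apply_apply]
  norm_num

theorem bundleCoord_one (φ : Equiv.Perm V) (a : V → ℝ) (y : ℝ) (v : V) :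
    bundleCoord φ a y (v, 1) = lowPart a (clamp (2 - y)) v - lowPart a (clamp (1 - y)) v := by
  have h1 : ((Fin.castSucc (1 : Fin 3)) : ℕ) = 1 := rfl
  simp only [bundleCoord, prismCoord, h1, Fin.reduceEq, if_false]
  norm_num

theorem bundleCoord_two (φ : Equiv.Perm V) (a : V → ℝ) (y : ℝ) (v : V) :
    bundleCoord φ a y (v, 2) = lowPart a (clamp (3 - y)) v - lowPart a (clamp (2 - y)) v := by
  have h1 : ((Fin.castSucc (2 : Fin 3)) : ℕ) = 2 := rfl
  simp only [bundleCoord, prismCoord, h1, Fin.reduceEq, if_false]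
  norm_num

theorem continuous_bundleCoord (φ : Equiv.Perm V) :
    Continuous fun x : (V → ℝ) × ℝ => bundleCoord φ x.1 x.2 := by
  have hp : ∀ p : V × Fin 4, Continuous fun x : (V → ℝ) × ℝ => prismCoord x.1 x.2 p := by
    intro p
    have h : ∀ t : ℝ, Continuous fun x : (V → ℝ) × ℝ => lowPart x.1 (clamp (t - x.2)) p.1 :=
      fun t => (continuous_lowPart p.1).comp
        (continuous_fst.prodMk (continuous_clamp.comp (continuous_const.sub continuous_snd)))
    exact (h _).sub (h _)
  refine continuous_pi fun p => ?_
  unfold bundleCoord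
  by_cases h : p.2 = 0
  · simp only [h, if_true]
    exact (hp _).add (hp _)
  · simp only [h, if_false]
    exact (hp _).add continuous_const

/-- Between two consecutive levels exactly one threshold is active: the stacked mass below it sits
on the lower level, the rest on the upper one. -/
theorem bundleCoord_slab_zero (φ : Equiv.Perm V) {a : V → ℝ} (ha : ∀ v, 0 ≤ a v)
    (hs : ∑ v, a v = 1) {y : ℝ} (h0 : 0 ≤ y) (h1 : y ≤ 1) :
    (∀ v, bundleCoord φ a y (v, 0) = lowPart a (1 - y) v) ∧
      (∀ v, bundleCoord φ a y (v, 1) = a v - lowPart a (1 - y) v) ∧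
      ∀ v, bundleCoord φ a y (v, 2) = 0 := by
  have c0 : clamp (-y) = 0 := clamp_of_nonpos (by linarith)
  have c1 : clamp (1 - y) = 1 - y := clamp_of_mem (by linarith) (by linarith)
  have c2 : clamp (2 - y) = 1 := clamp_of_one_le (by linarith)
  have c3 : clamp (3 - y) = 1 := clamp_of_one_le (by linarith)
  have c4 : clamp (4 - y) = 1 := clamp_of_one_le (by linarith)
  refine ⟨fun v => ?_, fun v => ?_, fun v => ?_⟩
  · obtain ⟨u, rfl⟩ := φ.surjective v
    rw [bundleCoord_zero, c0, c1, c3, c4, lowPart_zero ha]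
    ring
  · rw [bundleCoord_one, c1, c2, lowPart_one ha hs]
  · rw [bundleCoord_two, c2, c3, sub_self]

theorem bundleCoord_slab_one (φ : Equiv.Perm V) {a : V → ℝ} (ha : ∀ v, 0 ≤ a v)
    (hs : ∑ v, a v = 1) {y : ℝ} (h0 : 1 ≤ y) (h1 : y ≤ 2) :
    (∀ v, bundleCoord φ a y (v, 0) = 0) ∧
      (∀ v, bundleCoord φ a y (v, 1) = lowPart a (2 - y) v) ∧
      ∀ v, bundleCoord φ a y (v, 2) = a v - lowPart a (2 - y) v := by
  have c0 : clamp (-y) = 0 := clamp_of_nonpos (by linarith)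
  have c1 : clamp (1 - y) = 0 := clamp_of_nonpos (by linarith)
  have c2 : clamp (2 - y) = 2 - y := clamp_of_mem (by linarith) (by linarith)
  have c3 : clamp (3 - y) = 1 := clamp_of_one_le (by linarith)
  have c4 : clamp (4 - y) = 1 := clamp_of_one_le (by linarith)
  refine ⟨fun v => ?_, fun v => ?_, fun v => ?_⟩
  · obtain ⟨u, rfl⟩ := φ.surjective v
    rw [bundleCoord_zero, c0, c1, c3, c4]
    ring
  · rw [bundleCoord_one, c1, c2, lowPart_zero ha, sub_zero]
  · rw [bundleCoord_two, c2, c3, lowPart_one ha hs]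

theorem bundleCoord_slab_two (φ : Equiv.Perm V) {a : V → ℝ} (ha : ∀ v, 0 ≤ a v)
    (hs : ∑ v, a v = 1) {y : ℝ} (h0 : 2 ≤ y) (h1 : y ≤ 3) :
    (∀ v, bundleCoord φ a y (φ v, 0) = a v - lowPart a (3 - y) v) ∧
      (∀ v, bundleCoord φ a y (v, 1) = 0) ∧
      ∀ v, bundleCoord φ a y (v, 2) = lowPart a (3 - y) v := by
  have c0 : clamp (-y) = 0 := clamp_of_nonpos (by linarith)
  have c1 : clamp (1 - y) = 0 := clamp_of_nonpos (by linarith)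
  have c2 : clamp (2 - y) = 0 := clamp_of_nonpos (by linarith)
  have c3 : clamp (3 - y) = 3 - y := clamp_of_mem (by linarith) (by linarith)
  have c4 : clamp (4 - y) = 1 := clamp_of_one_le (by linarith)
  refine ⟨fun v => ?_, fun v => ?_, fun v => ?_⟩
  · rw [bundleCoord_zero, c0, c1, c3, c4, lowPart_one ha hs]
    ring
  · rw [bundleCoord_one, c1, c2, sub_self]
  · rw [bundleCoord_two, c2, c3, lowPart_zero ha, sub_zero]

theorem bundleCoord_mem {K : AbstractSimplicialComplex V} (φ : complexAut K) {a : V → ℝ}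
    (ha : a ∈ geomRealization K) {y : ℝ} (h0 : 0 ≤ y) (h3 : y ≤ 3) :
    bundleCoord φ a y ∈ geomRealization (twistedProduct K φ) := by
  have hface := prismCoord_support ha h0 h3
  obtain ⟨hnn, hsum, -⟩ := ha
  refine ⟨fun p => ?_, ?_, _, ⟨_, hface, rfl⟩, fun p hp => ?_⟩
  · refine add_nonneg (prismCoord_nonneg hnn _ _) ?_
    split_ifs
    exacts [prismCoord_nonneg hnn _ _, le_rfl]
  · rw [Fintype.sum_prod_type]
    have h : ∀ v, ∑ k, bundleCoord (φ : Equiv.Perm V) a y (v, k) = a v - prismCoord a y (v, 3) +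
        prismCoord a y ((φ : Equiv.Perm V).symm v, 3) := by
      intro v
      have := prismCoord_sum hnn hsum h0 h3 v
      rw [Fin.sum_univ_four] at this
      rw [Fin.sum_univ_three, ← this]
      have e0 : Fin.castSucc (0 : Fin 3) = 0 := rfl
      have e1 : Fin.castSucc (1 : Fin 3) = 1 := rfl
      have e2 : Fin.castSucc (2 : Fin 3) = 2 := rfl
      simp only [bundleCoord, e0, e1, e2, if_true, Fin.reduceEq, if_false]
      ring
    rw [Finset.sum_congr rfl fun v _ => h v, Finset.sum_add_distrib, Finset.sum_sub_distrib, hsum,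
      Equiv.sum_comp ((φ : Equiv.Perm V).symm) fun v => prismCoord a y (v, 3)]
    ring
  · have h1 : prismCoord a y (p.1, p.2.castSucc) = 0 := by
      by_contra hne
      exact hp (Finset.mem_image.2 ⟨_, Finset.mem_filter.2 ⟨mem_univ _, hne⟩,
        gluingMap_of_lt _ _ _⟩)
    rw [bundleCoord, h1, zero_add]
    split_ifs with hk
    · by_contra hne
      refine hp (Finset.mem_image.2 ⟨_, Finset.mem_filter.2 ⟨mem_univ _, hne⟩, ?_⟩)
      rw [gluingMap_three, Equiv.apply_symm_apply, ← hk]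
    · rfl

/-- The differences are the total masses on levels 1 and 2. As `y` runs from 0 to 3, the pair goes
from `(0, 0)` via `(1, 0)` and `(0, 1)` back to `(0, 0)` along a triangle, so only the two end
heights coincide. -/
theorem eq_or_of_clamp_eq {y y' : ℝ} (h0 : 0 ≤ y) (h3 : y ≤ 3) (h0' : 0 ≤ y') (h3' : y' ≤ 3)
    (e1 : clamp (2 - y) - clamp (1 - y) = clamp (2 - y') - clamp (1 - y'))
    (e2 : clamp (3 - y) - clamp (2 - y) = clamp (3 - y') - clamp (2 - y')) :
    y = y' ∨ (y = 3 ∧ y' = 0) ∨ (y = 0 ∧ y' = 3) := by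
  have hslab : ∀ {y : ℝ}, 0 ≤ y → y ≤ 3 →
      (y ≤ 1 ∧ clamp (1 - y) = 1 - y ∧ clamp (2 - y) = 1 ∧ clamp (3 - y) = 1) ∨
      (1 ≤ y ∧ y ≤ 2 ∧ clamp (1 - y) = 0 ∧ clamp (2 - y) = 2 - y ∧ clamp (3 - y) = 1) ∨
      (2 ≤ y ∧ clamp (1 - y) = 0 ∧ clamp (2 - y) = 0 ∧ clamp (3 - y) = 3 - y) := by
    intro y h0 h3
    rcases le_total y 1 with h1 | h1
    · exact Or.inl ⟨h1, clamp_of_mem (by linarith) (by linarith), clamp_of_one_le (by linarith),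
        clamp_of_one_le (by linarith)⟩
    rcases le_total y 2 with h2 | h2
    · exact Or.inr (Or.inl ⟨h1, h2, clamp_of_nonpos (by linarith),
        clamp_of_mem (by linarith) (by linarith), clamp_of_one_le (by linarith)⟩)
    · exact Or.inr (Or.inr ⟨h2, clamp_of_nonpos (by linarith), clamp_of_nonpos (by linarith),
        clamp_of_mem (by linarith) (by linarith)⟩)
  rcases hslab h0 h3 with ⟨h, c1, c2, c3⟩ | ⟨h, h', c1, c2, c3⟩ | ⟨h, c1, c2, c3⟩ <;>
  rcases hslab h0' h3' with ⟨k, d1, d2, d3⟩ | ⟨k, k', d1, d2, d3⟩ | ⟨k, d1, d2, d3⟩ <;>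
  rw [c1, c2, d1, d2] at e1 <;> rw [c2, c3, d2, d3] at e2 <;>
  first
  | exact Or.inl (by linarith)
  | exact Or.inr (Or.inl ⟨by linarith, by linarith⟩)
  | exact Or.inr (Or.inr ⟨by linarith, by linarith⟩)

theorem bundleCoord_eq_of_glue (φ : Equiv.Perm V) {a a' : V → ℝ} (ha : ∀ v, 0 ≤ a v)
    (hs : ∑ v, a v = 1) (ha' : ∀ v, 0 ≤ a' v) (hs' : ∑ v, a' v = 1) :
    bundleCoord φ a 3 = bundleCoord φ a' 0 ↔ ∀ v, a' (φ v) = a v := by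
  obtain ⟨p0, p1, p2⟩ := bundleCoord_slab_two φ ha hs (y := 3) (by norm_num) le_rfl
  obtain ⟨q0, q1, q2⟩ := bundleCoord_slab_zero φ ha' hs' (y := 0) le_rfl (by norm_num)
  simp only [sub_self, lowPart_zero ha, sub_zero] at p0 p2
  simp only [sub_zero, lowPart_one ha' hs', sub_self] at q0 q1
  constructor
  · intro h v
    rw [← p0, ← q0, h]
  · intro h
    funext ⟨v, k⟩
    rcases (by decide : ∀ k : Fin 3, k = 0 ∨ k = 1 ∨ k = 2) k with rfl | rfl | rfl
    · obtain ⟨u, rfl⟩ := φ.surjective v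
      rw [p0, q0, h]
    · rw [p1, q1]
    · rw [p2, q2]

theorem eq_of_bundleCoord_eq (φ : Equiv.Perm V) {a a' : V → ℝ} (ha : ∀ v, 0 ≤ a v)
    (hs : ∑ v, a v = 1) (ha' : ∀ v, 0 ≤ a' v) (hs' : ∑ v, a' v = 1) {y : ℝ} (h0 : 0 ≤ y)
    (h3 : y ≤ 3) (h : bundleCoord φ a y = bundleCoord φ a' y) : a = a' := by
  funext v
  rcases le_total y 1 with h1 | h1
  · obtain ⟨p0, p1, -⟩ := bundleCoord_slab_zero φ ha hs h0 h1
    obtain ⟨q0, q1, -⟩ := bundleCoord_slab_zero φ ha' hs' h0 h1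
    have e0 := p0 v
    have e1 := p1 v
    rw [h] at e0 e1
    linarith [q0 v, q1 v]
  rcases le_total y 2 with h2 | h2
  · obtain ⟨-, p0, p1⟩ := bundleCoord_slab_one φ ha hs h1 h2
    obtain ⟨-, q0, q1⟩ := bundleCoord_slab_one φ ha' hs' h1 h2
    have e0 := p0 v
    have e1 := p1 v
    rw [h] at e0 e1
    linarith [q0 v, q1 v]
  · obtain ⟨p0, -, p1⟩ := bundleCoord_slab_two φ ha hs h2 h3
    obtain ⟨q0, -, q1⟩ := bundleCoord_slab_two φ ha' hs' h2 h3
    have e0 := p0 v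
    have e1 := p1 v
    rw [h] at e0 e1
    linarith [q0 v, q1 v]

/-- The level masses determine the height up to the identification of 3 with 0; at a fixed height,
adding the two levels of the slab recovers the point of the base. -/
theorem bundleCoord_eq_iff (φ : Equiv.Perm V) {a a' : V → ℝ} (ha : ∀ v, 0 ≤ a v)
    (hs : ∑ v, a v = 1) (ha' : ∀ v, 0 ≤ a' v) (hs' : ∑ v, a' v = 1) {y y' : ℝ} (h0 : 0 ≤ y)
    (h3 : y ≤ 3) (h0' : 0 ≤ y') (h3' : y' ≤ 3) :
    bundleCoord φ a y = bundleCoord φ a' y' ↔ (y = y' ∧ a = a') ∨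
      (y = 3 ∧ y' = 0 ∧ ∀ v, a' (φ v) = a v) ∨ (y = 0 ∧ y' = 3 ∧ ∀ v, a (φ v) = a' v) := by
  constructor
  · intro h
    have hone : ∀ {a : V → ℝ} {y : ℝ}, ∑ v, a v = 1 →
        ∑ v, bundleCoord φ a y (v, 1) = clamp (2 - y) - clamp (1 - y) ∧
        ∑ v, bundleCoord φ a y (v, 2) = clamp (3 - y) - clamp (2 - y) := by
      intro a y hs
      have h : ∀ t, ∑ v, lowPart a (clamp t) v = clamp t := fun t =>
        sum_lowPart hs (le_max_left _ _) (max_le zero_le_one (min_le_left _ _))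
      constructor
      · rw [Finset.sum_congr rfl fun v _ => bundleCoord_one φ a y v, Finset.sum_sub_distrib, h, h]
      · rw [Finset.sum_congr rfl fun v _ => bundleCoord_two φ a y v, Finset.sum_sub_distrib, h, h]
    obtain ⟨e1, e2⟩ := hone (y := y) hs
    obtain ⟨e1', e2'⟩ := hone (y := y') hs'
    rw [h] at e1 e2
    rcases eq_or_of_clamp_eq h0 h3 h0' h3' (e1.symm.trans e1') (e2.symm.trans e2') with
      rfl | ⟨rfl, rfl⟩ | ⟨rfl, rfl⟩
    · exact Or.inl ⟨rfl, eq_of_bundleCoord_eq φ ha hs ha' hs' h0 h3 h⟩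
    · exact Or.inr (Or.inl ⟨rfl, rfl, (bundleCoord_eq_of_glue φ ha hs ha' hs').1 h⟩)
    · exact Or.inr (Or.inr ⟨rfl, rfl, (bundleCoord_eq_of_glue φ ha' hs' ha hs).1 h.symm⟩)
  · rintro (⟨rfl, rfl⟩ | ⟨rfl, rfl, h⟩ | ⟨rfl, rfl, h⟩)
    · rfl
    · exact (bundleCoord_eq_of_glue φ ha hs ha' hs').2 h
    · exact ((bundleCoord_eq_of_glue φ ha' hs' ha hs).2 h).symm

/-- The gluing identifies levels 0 and 3 only, which never bound the same slab; this is what an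
interval with three edges provides. -/
theorem gluingMap_injOn_slab {V : Type*} (φ : Equiv.Perm V) (i : Fin 3) {p q : V × Fin 4}
    (hp : p.2 ∈ ({i.castSucc, i.succ} : Finset (Fin 4)))
    (hq : q.2 ∈ ({i.castSucc, i.succ} : Finset (Fin 4))) (h : gluingMap φ p = gluingMap φ q) :
    p = q := by
  obtain ⟨v, j⟩ := p
  obtain ⟨w, k⟩ := q
  simp only at hp hq
  have hv : ∀ {j k : Fin 3}, gluingMap φ (v, j.castSucc) = gluingMap φ (w, k.castSucc) →
      (v, j.castSucc) = (w, k.castSucc) := by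
    intro j k h
    rw [gluingMap_of_lt, gluingMap_of_lt, Prod.mk.injEq] at h
    rw [h.1, h.2]
  rcases (by decide : ∀ j : Fin 4, j = 3 ∨ ∃ j' : Fin 3, j = j'.castSucc) j with rfl | ⟨j, rfl⟩ <;>
  rcases (by decide : ∀ j : Fin 4, j = 3 ∨ ∃ j' : Fin 3, j = j'.castSucc) k with rfl | ⟨k, rfl⟩
  · rw [gluingMap_three, gluingMap_three, Prod.mk.injEq] at h
    rw [φ.injective h.1]
  · rw [gluingMap_three, gluingMap_of_lt, Prod.mk.injEq] at h
    exact absurd h.2 (by clear h hv; revert i k; decide)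
  · rw [gluingMap_three, gluingMap_of_lt, Prod.mk.injEq] at h
    exact absurd h.2 (by clear h hv; revert i j; decide)
  · exact hv h

/-- The face carrying the point lies over one edge of the interval. Adding its bottom and top masses
gives the base point, the total bottom mass gives the height, and the chain condition says that the
splitting is by a threshold. -/
theorem exists_bundleCoord_eq {K : AbstractSimplicialComplex V} (φ : complexAut K)
    {μ : V × Fin 3 → ℝ} (hμ : μ ∈ geomRealization (twistedProduct K φ)) :
    ∃ a ∈ geomRealization K, ∃ y : ℝ, 0 ≤ y ∧ y ≤ 3 ∧ bundleCoord φ a y = μ := by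
  obtain ⟨hnn, hsum, s, ⟨t, ht, hts⟩, hsupp⟩ := hμ
  have hts : t.image (gluingMap (φ : Equiv.Perm V)) = s := hts
  obtain ⟨htne, htc, htK, -, i, hi⟩ := ht
  have hlev : ∀ p ∈ t, p.2 ∈ ({i.castSucc, i.succ} : Finset (Fin 4)) := fun p hp =>
    hi (Finset.mem_image_of_mem _ hp)
  have hpre : ∀ w, μ w ≠ 0 → ∃ p ∈ t, gluingMap (φ : Equiv.Perm V) p = w := by
    intro w hw
    by_contra hno
    refine hw (hsupp w fun hws => hno ?_)
    rw [← hts] at hws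
    simpa using hws
  have hmem : ∀ p : V × Fin 4, p.2 ∈ ({i.castSucc, i.succ} : Finset (Fin 4)) →
      μ (gluingMap (φ : Equiv.Perm V) p) ≠ 0 → p ∈ t := by
    intro p hp h
    obtain ⟨p', hp', he⟩ := hpre _ h
    rwa [← gluingMap_injOn_slab (φ : Equiv.Perm V) i (hlev p' hp') hp he]
  let low : V → ℝ := fun v => μ (gluingMap (φ : Equiv.Perm V) (v, i.castSucc))
  let high : V → ℝ := fun v => μ (gluingMap (φ : Equiv.Perm V) (v, i.succ))
  have hchain : ∀ v w, low v ≠ 0 → high w ≠ 0 → v ≤ w := by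
    intro v w hv hw
    have h1 := hmem (v, i.castSucc) (by simp) hv
    have h2 := hmem (w, i.succ) (by simp) hw
    rcases htc.total h1 h2 with h | h
    · exact h.1
    · exact absurd h.2 (not_le.2 Fin.castSucc_lt_succ)
  have hlow : ∀ v, 0 ≤ low v := fun v => hnn _
  have hhigh : ∀ v, 0 ≤ high v := fun v => hnn _
  have hsum3 : ∑ v, μ (v, 0) + ∑ v, μ (v, 1) + ∑ v, μ (v, 2) = 1 := by
    rw [← hsum, Fintype.sum_prod_type, ← Finset.sum_add_distrib, ← Finset.sum_add_distrib]
    exact Finset.sum_congr rfl fun v _ => (Fin.sum_univ_three fun k => μ (v, k)).symm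
  have hzero : ∀ v k, (∀ p : V × Fin 4, p.2 ∈ ({i.castSucc, i.succ} : Finset (Fin 4)) →
      (gluingMap (φ : Equiv.Perm V) p).2 ≠ k) → μ (v, k) = 0 := by
    intro v k h
    by_contra hne
    obtain ⟨p, hp, he⟩ := hpre _ hne
    exact h p (hlev p hp) (by rw [he])
  have g0 : ∀ v, gluingMap (φ : Equiv.Perm V) (v, 0) = (v, 0) := fun v => gluingMap_of_lt _ v 0
  have g1 : ∀ v, gluingMap (φ : Equiv.Perm V) (v, 1) = (v, 1) := fun v => gluingMap_of_lt _ v 1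
  have g2 : ∀ v, gluingMap (φ : Equiv.Perm V) (v, 2) = (v, 2) := fun v => gluingMap_of_lt _ v 2
  have g3 : ∀ v, gluingMap (φ : Equiv.Perm V) (v, 3) = ((φ : Equiv.Perm V) v, 0) := fun v =>
    gluingMap_three _ v
  have hθ0 : 0 ≤ ∑ v, low v := Finset.sum_nonneg fun v _ => hlow v
  have hsplit := fun v => lowPart_eq_of_staircase hlow hhigh hchain v
  have hmass : (∑ v, (low v + high v) = 1) → (fun v => low v + high v) ∈ geomRealization K ∧
      ∑ v, low v ≤ 1 := by
    intro h
    refine ⟨⟨fun v => add_nonneg (hlow v) (hhigh v), h, _, htK, fun v hv => ?_⟩, ?_⟩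
    · have h1 : low v = 0 := by
        by_contra hne
        exact hv (Finset.mem_image.2 ⟨_, hmem (v, i.castSucc) (by simp) hne, rfl⟩)
      have h2 : high v = 0 := by
        by_contra hne
        exact hv (Finset.mem_image.2 ⟨_, hmem (v, i.succ) (by simp) hne, rfl⟩)
      change low v + high v = 0
      rw [h1, h2, add_zero]
    · rw [← h, Finset.sum_add_distrib]
      linarith [Finset.sum_nonneg fun v (_ : v ∈ univ) => hhigh v]
  have hann : ∀ v, 0 ≤ low v + high v := fun v => add_nonneg (hlow v) (hhigh v)
  rcases (by decide : ∀ i : Fin 3, i = 0 ∨ i = 1 ∨ i = 2) i with rfl | rfl | rfl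
  · have hl : ∀ v, low v = μ (v, 0) := fun v => congrArg μ (g0 v)
    have hh : ∀ v, high v = μ (v, 1) := fun v => congrArg μ (g1 v)
    have hz : ∀ v, μ (v, 2) = 0 := fun v => hzero v 2 (by
      rintro ⟨w, j⟩ hj
      simp only [mem_insert, mem_singleton] at hj
      rcases hj with rfl | rfl
      · exact fun h => absurd ((congrArg Prod.snd (g0 w)).symm.trans h)
          (show (0 : Fin 3) ≠ 2 by decide)
      · exact fun h => absurd ((congrArg Prod.snd (g1 w)).symm.trans h)
          (show (1 : Fin 3) ≠ 2 by decide))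
    have htot : ∑ v, (low v + high v) = 1 := by
      simp only [hz, Finset.sum_const_zero, add_zero] at hsum3
      simp only [hl, hh, Finset.sum_add_distrib, hsum3]
    obtain ⟨hK, hθ1⟩ := hmass htot
    refine ⟨_, hK, 1 - ∑ v, low v, by linarith, by linarith, ?_⟩
    obtain ⟨p0, p1, p2⟩ := bundleCoord_slab_zero (φ : Equiv.Perm V) hann htot
      (y := 1 - ∑ v, low v) (by linarith) (by linarith)
    rw [sub_sub_cancel] at p0 p1
    funext ⟨v, k⟩
    rcases (by decide : ∀ k : Fin 3, k = 0 ∨ k = 1 ∨ k = 2) k with rfl | rfl | rfl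
    · rw [p0, hsplit, hl]
    · rw [p1, hsplit, add_sub_cancel_left, hh]
    · rw [p2, hz]
  · have hl : ∀ v, low v = μ (v, 1) := fun v => congrArg μ (g1 v)
    have hh : ∀ v, high v = μ (v, 2) := fun v => congrArg μ (g2 v)
    have hz : ∀ v, μ (v, 0) = 0 := fun v => hzero v 0 (by
      rintro ⟨w, j⟩ hj
      simp only [mem_insert, mem_singleton] at hj
      rcases hj with rfl | rfl
      · exact fun h => absurd ((congrArg Prod.snd (g1 w)).symm.trans h)
          (show (1 : Fin 3) ≠ 0 by decide)
      · exact fun h => absurd ((congrArg Prod.snd (g2 w)).symm.trans h)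
          (show (2 : Fin 3) ≠ 0 by decide))
    have htot : ∑ v, (low v + high v) = 1 := by
      simp only [hz, Finset.sum_const_zero, zero_add] at hsum3
      simp only [hl, hh, Finset.sum_add_distrib, hsum3]
    obtain ⟨hK, hθ1⟩ := hmass htot
    refine ⟨_, hK, 2 - ∑ v, low v, by linarith, by linarith, ?_⟩
    obtain ⟨p0, p1, p2⟩ := bundleCoord_slab_one (φ : Equiv.Perm V) hann htot
      (y := 2 - ∑ v, low v) (by linarith) (by linarith)
    rw [sub_sub_cancel] at p1 p2
    funext ⟨v, k⟩
    rcases (by decide : ∀ k : Fin 3, k = 0 ∨ k = 1 ∨ k = 2) k with rfl | rfl | rfl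
    · rw [p0, hz]
    · rw [p1, hsplit, hl]
    · rw [p2, hsplit, add_sub_cancel_left, hh]
  · have hl : ∀ v, low v = μ (v, 2) := fun v => congrArg μ (g2 v)
    have hh : ∀ v, high v = μ ((φ : Equiv.Perm V) v, 0) := fun v => congrArg μ (g3 v)
    have hz : ∀ v, μ (v, 1) = 0 := fun v => hzero v 1 (by
      rintro ⟨w, j⟩ hj
      simp only [mem_insert, mem_singleton] at hj
      rcases hj with rfl | rfl
      · exact fun h => absurd ((congrArg Prod.snd (g2 w)).symm.trans h)
          (show (2 : Fin 3) ≠ 1 by decide)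
      · exact fun h => absurd ((congrArg Prod.snd (g3 w)).symm.trans h)
          (show (0 : Fin 3) ≠ 1 by decide))
    have htot : ∑ v, (low v + high v) = 1 := by
      simp only [hz, Finset.sum_const_zero, add_zero] at hsum3
      simp only [hl, hh, Finset.sum_add_distrib]
      rw [Equiv.sum_comp (φ : Equiv.Perm V) fun v => μ (v, 0), add_comm, hsum3]
    obtain ⟨hK, hθ1⟩ := hmass htot
    refine ⟨_, hK, 3 - ∑ v, low v, by linarith, by linarith, ?_⟩
    obtain ⟨p0, p1, p2⟩ := bundleCoord_slab_two (φ : Equiv.Perm V) hann htot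
      (y := 3 - ∑ v, low v) (by linarith) (by linarith)
    rw [sub_sub_cancel] at p0 p2
    funext ⟨v, k⟩
    rcases (by decide : ∀ k : Fin 3, k = 0 ∨ k = 1 ∨ k = 2) k with rfl | rfl | rfl
    · obtain ⟨u, rfl⟩ := (φ : Equiv.Perm V).surjective v
      rw [p0, hsplit, add_sub_cancel_left, hh]
    · rw [p1, hz]
    · rw [p2, hsplit, hl]

/-- A criterion for a space to be homeomorphic to a twisted product triangulation. -/
theorem nonempty_homeomorph_twistedProduct {K : AbstractSimplicialComplex V} (φ : complexAut K)
    {X Z : Type*} [TopologicalSpace X] [CompactSpace X] [TopologicalSpace Z] [T2Space Z]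
    {q : X → V → ℝ} (hq : Continuous q) (hq' : Set.range q = geomRealization K)
    {r : X × Set.Icc (0 : ℝ) 3 → Z} (hr : Continuous r) (hr' : Function.Surjective r)
    (h : ∀ (x x' : X) (y y' : Set.Icc (0 : ℝ) 3), r (x, y) = r (x', y') ↔
      (y.1 = y'.1 ∧ q x = q x') ∨
      (y.1 = 3 ∧ y'.1 = 0 ∧ ∀ v, q x' ((φ : Equiv.Perm V) v) = q x v) ∨
      (y.1 = 0 ∧ y'.1 = 3 ∧ ∀ v, q x ((φ : Equiv.Perm V) v) = q x' v)) :
    Nonempty (geomRealization (twistedProduct K φ) ≃ₜ Z) := by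
  have hqK : ∀ x, q x ∈ geomRealization K := fun x => hq' ▸ Set.mem_range_self x
  refine nonempty_homeomorph_of_fibres
    (q := fun x : X × Set.Icc (0 : ℝ) 3 => (⟨bundleCoord φ (q x.1) x.2,
      bundleCoord_mem φ (hqK x.1) x.2.2.1 x.2.2.2⟩ : geomRealization (twistedProduct K φ)))
    (r := r) ?_ hr ?_ hr' ?_
  · refine Continuous.subtype_mk ?_ _
    exact (continuous_bundleCoord (φ : Equiv.Perm V)).comp
      ((hq.comp continuous_fst).prodMk (continuous_subtype_val.comp continuous_snd))
  · rintro ⟨μ, hμ⟩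
    obtain ⟨a, ha, y, h0, h3, he⟩ := exists_bundleCoord_eq φ hμ
    rw [← hq'] at ha
    obtain ⟨x, rfl⟩ := ha
    exact ⟨(x, ⟨y, h0, h3⟩), Subtype.ext he⟩
  · rintro ⟨x, y⟩ ⟨x', y'⟩
    exact Subtype.ext_iff.trans ((bundleCoord_eq_iff (φ : Equiv.Perm V) (hqK x).1 (hqK x).2.1
      (hqK x').1 (hqK x').2.1 y.2.1 y.2.2 y'.2.1 y'.2.2).trans (h x x' y y').symm)

end Bundle

/-! ### The triangulated square grid covering the Klein bottle -/

section SquareCoord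

variable {V : Type*} [DecidableEq V]

/-- The barycentric coordinates of the point `(α, β)` of the unit square whose corners carry the
labels `l₀₀, l₁₀, l₀₁, l₁₁`, when the square is cut along the main diagonal. -/
def squareCoord (l₀₀ l₁₀ l₀₁ l₁₁ : V) (α β : ℝ) (j : V) : ℝ :=
  (1 - α - β + min α β) * (if l₀₀ = j then 1 else 0) + (α - min α β) * (if l₁₀ = j then 1 else 0) +
    (β - min α β) * (if l₀₁ = j then 1 else 0) + min α β * (if l₁₁ = j then 1 else 0)

theorem squareCoord_swap (l₀₀ l₁₀ l₀₁ l₁₁ : V) (α β : ℝ) :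
    squareCoord l₀₀ l₀₁ l₁₀ l₁₁ β α = squareCoord l₀₀ l₁₀ l₀₁ l₁₁ α β := by
  funext j
  rw [squareCoord, squareCoord, min_comm β α]
  ring

theorem squareCoord_rotate (l₀₀ l₁₀ l₀₁ l₁₁ : V) (α β : ℝ) :
    squareCoord l₁₁ l₀₁ l₁₀ l₀₀ (1 - α) (1 - β) = squareCoord l₀₀ l₁₀ l₀₁ l₁₁ α β := by
  funext j
  have h : min (1 - α) (1 - β) = 1 - α - β + min α β := by
    rcases le_total α β with h | h
    · rw [min_eq_left h, min_eq_right (by linarith)]; ring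
    · rw [min_eq_right h, min_eq_left (by linarith)]; ring
  rw [squareCoord, squareCoord, h]
  ring

theorem squareCoord_perm (π : Equiv.Perm V) (l₀₀ l₁₀ l₀₁ l₁₁ : V) (α β : ℝ) (j : V) :
    squareCoord (π l₀₀) (π l₁₀) (π l₀₁) (π l₁₁) α β (π j) = squareCoord l₀₀ l₁₀ l₀₁ l₁₁ α β j := by
  simp [squareCoord]

theorem squareCoord_left (l₀₀ l₁₀ l₀₁ l₁₁ : V) {β : ℝ} (h : 0 ≤ β) (j : V) :
    squareCoord l₀₀ l₁₀ l₀₁ l₁₁ 0 β j =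
      (1 - β) * (if l₀₀ = j then 1 else 0) + β * (if l₀₁ = j then 1 else 0) := by
  rw [squareCoord, min_eq_left h]
  ring

theorem squareCoord_right (l₀₀ l₁₀ l₀₁ l₁₁ : V) {β : ℝ} (h : β ≤ 1) (j : V) :
    squareCoord l₀₀ l₁₀ l₀₁ l₁₁ 1 β j =
      (1 - β) * (if l₁₀ = j then 1 else 0) + β * (if l₁₁ = j then 1 else 0) := by
  rw [squareCoord, min_eq_right h]
  ring

end SquareCoord

/-- The labels of the points of `ℤ²`: this is the vertex map of the universal cover of `²8₂₀`. -/
def gridLabel (a b : ZMod 8) : Fin 8 :=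
  if a.val % 2 = 0 then (![0, 6, 5, 3, 1, 6, 4, 3] : Fin 8 → Fin 8) (b - a : ZMod 8)
  else (![7, 1, 2, 4, 7, 0, 2, 5] : Fin 8 → Fin 8) (b - a + 1 : ZMod 8)

/-- Whether the unit square with lower left corner `(a, b)` is cut along the main diagonal. -/
def gridDiag (a b : ZMod 8) : Bool := a.val % 2 == 1 && b.val % 2 == 1

/-- This and the glide below express invariance under the two generators of the Klein bottle group,
which in the coordinates of `planeCoord` act by `(u, w) ↦ (u + 2, w + 2)` and `(u, w) ↦ (1 - w, -u -
3)`. Everything has period 8, so it can be checked on `ZMod 8`. -/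
theorem gridLabel_translate : ∀ a b, gridLabel (a + 2) (b + 2) = gridLabel a b := by
  decide +kernel

theorem gridDiag_translate : ∀ a b, gridDiag (a + 2) (b + 2) = gridDiag a b := by decide +kernel

theorem gridLabel_glide : ∀ a b, gridLabel (1 - b) (-a - 3) = gridLabel a b := by decide +kernel

/-- The glide reverses both coordinate directions, so the lower left corner of the image square
comes from the opposite corner; hence the offset by one from the formula for labels. -/
theorem gridDiag_glide : ∀ a b, gridDiag (-b) (-a - 4) = gridDiag a b := by decide +kernel

/-- The automorphism induced by the translation by `(2, 0)`. -/
def shiftPerm : Equiv.Perm (Fin 8) where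
  toFun := ![4, 5, 7, 6, 1, 0, 3, 2]
  invFun := ![5, 4, 7, 6, 0, 1, 3, 2]
  left_inv := by decide
  right_inv := by decide

/-- The automorphism induced by the reflection in the main diagonal. -/
def swapPerm : Equiv.Perm (Fin 8) where
  toFun := ![0, 1, 3, 2, 5, 4, 7, 6]
  invFun := ![0, 1, 3, 2, 5, 4, 7, 6]
  left_inv := by decide
  right_inv := by decide

theorem gridLabel_shift : ∀ a b, gridLabel (a + 2) b = shiftPerm (gridLabel a b) := by
  decide +kernel

theorem gridDiag_shift : ∀ a b, gridDiag (a + 2) b = gridDiag a b := by decide +kernel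

theorem gridLabel_swap : ∀ a b, gridLabel b a = swapPerm (gridLabel a b) := by decide +kernel

theorem gridDiag_swap : ∀ a b, gridDiag b a = gridDiag a b := by decide +kernel

/-- The barycentric coordinates of the point `(a + α, b + β)`, where `0 ≤ α, β ≤ 1`. -/
def cellCoord (a b : ZMod 8) (α β : ℝ) : Fin 8 → ℝ :=
  if gridDiag a b then
    squareCoord (gridLabel a b) (gridLabel (a + 1) b) (gridLabel a (b + 1))
      (gridLabel (a + 1) (b + 1)) α β
  else
    squareCoord (gridLabel a (b + 1)) (gridLabel (a + 1) (b + 1)) (gridLabel a b)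
      (gridLabel (a + 1) b) α (1 - β)

theorem cellCoord_left (a b : ZMod 8) {β : ℝ} (h0 : 0 ≤ β) (h1 : β ≤ 1) (j : Fin 8) :
    cellCoord a b 0 β j = (1 - β) * (if gridLabel a b = j then 1 else 0) +
      β * (if gridLabel a (b + 1) = j then 1 else 0) := by
  by_cases h : gridDiag a b = true
  · rw [cellCoord, if_pos h, squareCoord_left _ _ _ _ h0]
  · rw [cellCoord, if_neg h, squareCoord_left _ _ _ _ (by linarith)]
    ring

theorem cellCoord_right (a b : ZMod 8) {β : ℝ} (h0 : 0 ≤ β) (h1 : β ≤ 1) (j : Fin 8) :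
    cellCoord a b 1 β j = (1 - β) * (if gridLabel (a + 1) b = j then 1 else 0) +
      β * (if gridLabel (a + 1) (b + 1) = j then 1 else 0) := by
  by_cases h : gridDiag a b = true
  · rw [cellCoord, if_pos h, squareCoord_right _ _ _ _ h1]
  · rw [cellCoord, if_neg h, squareCoord_right _ _ _ _ (by linarith)]
    ring

theorem cellCoord_bottom (a b : ZMod 8) {α : ℝ} (h0 : 0 ≤ α) (h1 : α ≤ 1) (j : Fin 8) :
    cellCoord a b α 0 j = (1 - α) * (if gridLabel a b = j then 1 else 0) +
      α * (if gridLabel (a + 1) b = j then 1 else 0) := by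
  by_cases h : gridDiag a b = true
  · rw [cellCoord, if_pos h, ← squareCoord_swap, squareCoord_left _ _ _ _ h0]
  · rw [cellCoord, if_neg h, ← squareCoord_swap, sub_zero, squareCoord_right _ _ _ _ h1]

theorem cellCoord_top (a b : ZMod 8) {α : ℝ} (h0 : 0 ≤ α) (h1 : α ≤ 1) (j : Fin 8) :
    cellCoord a b α 1 j = (1 - α) * (if gridLabel a (b + 1) = j then 1 else 0) +
      α * (if gridLabel (a + 1) (b + 1) = j then 1 else 0) := by
  by_cases h : gridDiag a b = true
  · rw [cellCoord, if_pos h, ← squareCoord_swap, squareCoord_right _ _ _ _ h1]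
  · rw [cellCoord, if_neg h, ← squareCoord_swap, sub_self, squareCoord_left _ _ _ _ h0]

/-- The map from the plane to the realization of `²8₂₀`. -/
noncomputable def gridCoord (u w : ℝ) : Fin 8 → ℝ :=
  cellCoord (⌊u⌋ : ℤ) (⌊w⌋ : ℤ) (Int.fract u) (Int.fract w)

/-- The cell formulas of adjacent squares agree on the common edge, where they interpolate between
the two end labels. So the formula of a cell remains valid on its closure. -/
theorem gridCoord_cell (a b : ℤ) {α β : ℝ} (hα0 : 0 ≤ α) (hα1 : α ≤ 1) (hβ0 : 0 ≤ β)
    (hβ1 : β ≤ 1) : gridCoord (a + α) (b + β) = cellCoord a b α β := by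
  have key : ∀ (a : ℤ) {α : ℝ}, 0 ≤ α → α < 1 → ⌊(a : ℝ) + α⌋ = a ∧ Int.fract ((a : ℝ) + α) = α := by
    intro a α h0 h1
    have h : ⌊α⌋ = 0 := Int.floor_eq_zero_iff.2 ⟨h0, h1⟩
    refine ⟨by rw [Int.floor_intCast_add, h, add_zero], ?_⟩
    rw [Int.fract_intCast_add, Int.fract_eq_self.2 ⟨h0, h1⟩]
  have key₁ : ∀ a : ℤ, ⌊(a : ℝ) + 1⌋ = a + 1 ∧ Int.fract ((a : ℝ) + 1) = 0 := by
    intro a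
    exact ⟨by rw [Int.floor_add_one, Int.floor_intCast], by rw [Int.fract_add_one, Int.fract_intCast]⟩
  funext j
  unfold gridCoord
  rcases hα1.lt_or_eq with hα | rfl <;> rcases hβ1.lt_or_eq with hβ | rfl
  · rw [(key a hα0 hα).1, (key a hα0 hα).2, (key b hβ0 hβ).1, (key b hβ0 hβ).2]
  · rw [(key a hα0 hα).1, (key a hα0 hα).2, (key₁ b).1, (key₁ b).2, cellCoord_top _ _ hα0 hα1,
      cellCoord_bottom _ _ hα0 hα1]
    push_cast
    rfl
  · rw [(key b hβ0 hβ).1, (key b hβ0 hβ).2, (key₁ a).1, (key₁ a).2, cellCoord_right _ _ hβ0 hβ1,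
      cellCoord_left _ _ hβ0 hβ1]
    push_cast
    rfl
  · rw [(key₁ a).1, (key₁ a).2, (key₁ b).1, (key₁ b).2, cellCoord_right _ _ hβ0 hβ1,
      cellCoord_left _ _ le_rfl zero_le_one]
    push_cast
    ring

theorem exists_cell (u : ℝ) : ∃ (a : ℤ) (α : ℝ), 0 ≤ α ∧ α ≤ 1 ∧ u = a + α :=
  ⟨⌊u⌋, Int.fract u, Int.fract_nonneg u, (Int.fract_lt_one u).le, (Int.floor_add_fract u).symm⟩

theorem gridCoord_translate (u w : ℝ) : gridCoord (u + 2) (w + 2) = gridCoord u w := by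
  obtain ⟨a, α, h0, h1, rfl⟩ := exists_cell u
  obtain ⟨b, β, h0', h1', rfl⟩ := exists_cell w
  rw [show (a : ℝ) + α + 2 = ((a + 2 : ℤ) : ℝ) + α by push_cast; ring,
    show (b : ℝ) + β + 2 = ((b + 2 : ℤ) : ℝ) + β by push_cast; ring,
    gridCoord_cell _ _ h0 h1 h0' h1', gridCoord_cell _ _ h0 h1 h0' h1']
  unfold cellCoord
  push_cast
  simp only [gridDiag_translate, gridLabel_translate, add_right_comm _ (2 : ZMod 8) 1]

theorem gridCoord_shift (u w : ℝ) (j : Fin 8) :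
    gridCoord (u + 2) w (shiftPerm j) = gridCoord u w j := by
  obtain ⟨a, α, h0, h1, rfl⟩ := exists_cell u
  obtain ⟨b, β, h0', h1', rfl⟩ := exists_cell w
  rw [show (a : ℝ) + α + 2 = ((a + 2 : ℤ) : ℝ) + α by push_cast; ring,
    gridCoord_cell _ _ h0 h1 h0' h1', gridCoord_cell _ _ h0 h1 h0' h1']
  unfold cellCoord
  push_cast
  simp only [gridDiag_shift, gridLabel_shift, add_right_comm _ (2 : ZMod 8) 1]
  split_ifs <;> exact squareCoord_perm _ _ _ _ _ _ _ _

theorem gridCoord_swap (u w : ℝ) (j : Fin 8) :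
    gridCoord w u (swapPerm j) = gridCoord u w j := by
  obtain ⟨a, α, h0, h1, rfl⟩ := exists_cell u
  obtain ⟨b, β, h0', h1', rfl⟩ := exists_cell w
  rw [gridCoord_cell _ _ h0 h1 h0' h1', gridCoord_cell _ _ h0' h1' h0 h1]
  unfold cellCoord
  rw [gridDiag_swap a b, gridLabel_swap a b, gridLabel_swap (a + 1) b, gridLabel_swap a (b + 1),
    gridLabel_swap (a + 1) (b + 1)]
  split_ifs
  · rw [squareCoord_perm, squareCoord_swap]
  · rw [squareCoord_perm, ← squareCoord_rotate, squareCoord_swap, sub_sub_cancel]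

theorem gridCoord_glide (u w : ℝ) : gridCoord (1 - w) (-u - 3) = gridCoord u w := by
  obtain ⟨a, α, h0, h1, rfl⟩ := exists_cell u
  obtain ⟨b, β, h0', h1', rfl⟩ := exists_cell w
  rw [show 1 - ((b : ℝ) + β) = ((-b : ℤ) : ℝ) + (1 - β) by push_cast; ring,
    show -((a : ℝ) + α) - 3 = ((-a - 4 : ℤ) : ℝ) + (1 - α) by push_cast; ring,
    gridCoord_cell _ _ h0 h1 h0' h1',
    gridCoord_cell _ _ (by linarith) (by linarith) (by linarith) (by linarith)]
  unfold cellCoord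
  push_cast
  have e1 := gridLabel_glide a b
  have e2 := gridLabel_glide (a + 1) b
  have e3 := gridLabel_glide a (b + 1)
  have e4 := gridLabel_glide (a + 1) (b + 1)
  rw [gridDiag_glide a b, ← e1, ← e2, ← e3, ← e4,
    show (-b + 1 : ZMod 8) = 1 - b by ring, show (-a - 4 + 1 : ZMod 8) = -a - 3 by ring,
    show (1 - (b + 1) : ZMod 8) = -b by ring, show (-(a + 1) - 3 : ZMod 8) = -a - 4 by ring]
  split_ifs
  · rw [← squareCoord_swap, squareCoord_rotate]
  · rw [sub_sub_cancel, ← squareCoord_swap, ← squareCoord_rotate, sub_sub_cancel]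

/-- The vertices of the two triangles of a unit square, relative to its lower left corner. -/
def triangleOffset : Bool → Bool → Fin 3 → ℤ × ℤ
  | true, false => ![(0, 0), (1, 0), (1, 1)]
  | true, true => ![(0, 0), (0, 1), (1, 1)]
  | false, false => ![(1, 0), (0, 0), (0, 1)]
  | false, true => ![(1, 0), (1, 1), (0, 1)]

/-- On each of the two triangles of a square the map is affine, and it sends the corners to the
vertices given by their labels. -/
theorem gridCoord_triangle (a b : ℤ) (t : Bool) {β : Fin 3 → ℝ} (h0 : ∀ k, 0 ≤ β k)
    (h1 : ∑ k, β k = 1) (j : Fin 8) :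
    gridCoord (∑ k, β k * (a + (triangleOffset (gridDiag a b) t k).1 : ℤ))
        (∑ k, β k * (b + (triangleOffset (gridDiag a b) t k).2 : ℤ)) j =
      ∑ k, β k * (if gridLabel ((a + (triangleOffset (gridDiag a b) t k).1 : ℤ) : ZMod 8)
        ((b + (triangleOffset (gridDiag a b) t k).2 : ℤ) : ZMod 8) = j then 1 else 0) := by
  have e : ∀ (c : ℤ) (o : Fin 3 → ℤ), ∑ k, β k * ((c + o k : ℤ) : ℝ) = c + ∑ k, β k * o k := by
    intro c o
    push_cast
    simp only [mul_add, Finset.sum_add_distrib, ← Finset.sum_mul, h1, one_mul]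
  rw [e a fun k => (triangleOffset (gridDiag a b) t k).1,
    e b fun k => (triangleOffset (gridDiag a b) t k).2]
  have b0 := h0 0
  have b1 := h0 1
  have b2 := h0 2
  rw [Fin.sum_univ_three] at h1
  obtain ⟨d, hd⟩ : ∃ d, d = gridDiag a b := ⟨_, rfl⟩
  rw [← hd]
  simp only [Fin.sum_univ_three]
  cases d <;> cases t <;>
    simp only [triangleOffset, Matrix.cons_val_zero, Matrix.cons_val_one, Matrix.cons_val,
      Int.cast_zero, Int.cast_one, mul_zero, mul_one, add_zero, zero_add, Int.cast_add] <;>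
    rw [gridCoord_cell _ _ (by linarith) (by linarith) (by linarith) (by linarith)] <;>
    unfold cellCoord squareCoord <;> rw [← hd]
  · rw [if_neg Bool.false_ne_true, min_eq_left (by linarith)]
    rw [show β 0 = 1 - β 1 - β 2 by linarith]; ring
  · rw [if_neg Bool.false_ne_true, min_eq_right (by linarith)]
    rw [show β 0 = 1 - β 1 - β 2 by linarith]; ring
  · rw [if_pos rfl, min_eq_right (by linarith)]
    rw [show β 0 = 1 - β 1 - β 2 by linarith]; ring
  · rw [if_pos rfl, min_eq_left (by linarith)]
    rw [show β 0 = 1 - β 1 - β 2 by linarith]; ring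

theorem exists_triangle (a b : ℤ) (d : Bool) {α β : ℝ} (hα0 : 0 ≤ α) (hα1 : α ≤ 1) (hβ0 : 0 ≤ β)
    (hβ1 : β ≤ 1) : ∃ (t : Bool) (c : Fin 3 → ℝ), (∀ k, 0 ≤ c k) ∧ ∑ k, c k = 1 ∧
      ∑ k, c k * (a + (triangleOffset d t k).1 : ℤ) = a + α ∧
      ∑ k, c k * (b + (triangleOffset d t k).2 : ℤ) = b + β := by
  have key : ∀ (t : Bool) (x y z : ℝ), 0 ≤ x → 0 ≤ y → 0 ≤ z → x + y + z = 1 →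
      x * (a + (triangleOffset d t 0).1 : ℤ) + y * (a + (triangleOffset d t 1).1 : ℤ) +
        z * (a + (triangleOffset d t 2).1 : ℤ) = a + α →
      x * (b + (triangleOffset d t 0).2 : ℤ) + y * (b + (triangleOffset d t 1).2 : ℤ) +
        z * (b + (triangleOffset d t 2).2 : ℤ) = b + β →
      ∃ (t : Bool) (c : Fin 3 → ℝ), (∀ k, 0 ≤ c k) ∧ ∑ k, c k = 1 ∧
        ∑ k, c k * (a + (triangleOffset d t k).1 : ℤ) = a + α ∧
        ∑ k, c k * (b + (triangleOffset d t k).2 : ℤ) = b + β := by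
    intro t x y z hx hy hz hs h1 h2
    refine ⟨t, ![x, y, z], fun k => ?_, ?_, ?_, ?_⟩
    · rcases (by decide : ∀ k : Fin 3, k = 0 ∨ k = 1 ∨ k = 2) k with rfl | rfl | rfl
      exacts [hx, hy, hz]
    all_goals rw [Fin.sum_univ_three]; assumption
  cases d
  · rcases le_total (α + β) 1 with h | h
    · refine key false α (1 - α - β) β hα0 (by linarith) hβ0 (by ring) ?_ ?_ <;>
        simp [triangleOffset] <;> ring
    · refine key true (1 - β) (α + β - 1) (1 - α) (by linarith) (by linarith) (by linarith)
        (by ring) ?_ ?_ <;> simp [triangleOffset] <;> ring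
  · rcases le_total β α with h | h
    · refine key false (1 - α) (α - β) β (by linarith) (by linarith) hβ0 (by ring) ?_ ?_ <;>
        simp [triangleOffset] <;> ring
    · refine key true (1 - β) (β - α) α (by linarith) (by linarith) hα0 (by ring) ?_ ?_ <;>
        simp [triangleOffset] <;> ring

/-! ### The eight-vertex complex is a closed surface -/

section KleinComplex

theorem mem_kleinBottle8_faces {s : Finset (Fin 8)} : s ∈ kleinBottle8.faces ↔ s.Nonempty ∧ ∃ t ∈ ({
    {0, 1, 2}, {0, 1, 3}, {0, 2, 4}, {0, 3, 5}, {0, 4, 6}, {0, 5, 7}, {0, 6, 7}, {1, 2, 5},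
    {1, 3, 4}, {1, 4, 7}, {1, 5, 6}, {1, 6, 7}, {2, 3, 4}, {2, 3, 5}, {4, 5, 6}, {4, 5, 7}} :
      Finset (Finset (Fin 8))), s ⊆ t := Iff.rfl

instance decidableMemKleinBottle8 : DecidablePred (· ∈ kleinBottle8.faces) := fun _ =>
  decidable_of_iff _ mem_kleinBottle8_faces.symm

instance decidableMemLink (v : Fin 8) : DecidablePred (· ∈ (vertexLink kleinBottle8 v).faces) :=
  fun s => inferInstanceAs (Decidable (s.Nonempty ∧ v ∉ s ∧ insert v s ∈ kleinBottle8.faces))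

theorem isTriangulatedSurface_kleinBottle8 : IsTriangulatedSurface kleinBottle8 := by
  intro v
  -- Vertex 0 is adjacent to all other vertices, so it lies in every other link, and 1 lies in the
  -- link of 0. Three steps, some possibly stationary, reach this base vertex even in the longest
  -- link, a heptagon.
  have hbase : ∀ v w : Fin 8, {w} ∈ (vertexLink kleinBottle8 v).faces → ∃ a b : Fin 8,
      {w, a} ∈ (vertexLink kleinBottle8 v).faces ∧ {a, b} ∈ (vertexLink kleinBottle8 v).faces ∧
      {b, if v = 0 then 1 else 0} ∈ (vertexLink kleinBottle8 v).faces := by decide +kernel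
  refine ⟨?_, ?_, ?_, ?_⟩
  · revert v
    decide +kernel
  · rintro s ⟨-, hv, -, t, ht, hst⟩
    have h3 : t.card = 3 := by
      clear hst hv
      revert t
      decide +kernel
    have := Finset.card_le_card hst
    rw [Finset.card_insert_of_notMem hv] at this
    omega
  · intro w hw
    have h : {x | x ≠ w ∧ ({w, x} : Finset (Fin 8)) ∈ (vertexLink kleinBottle8 v).faces} =
        (univ.filter fun x => x ≠ w ∧ ({w, x} : Finset (Fin 8)) ∈
          (vertexLink kleinBottle8 v).faces : Finset (Fin 8)) := by
      ext x
      simp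
    rw [h, Set.ncard_coe_finset]
    clear h hbase
    revert v w
    decide +kernel
  · have toBase : ∀ w, {w} ∈ (vertexLink kleinBottle8 v).faces → Relation.ReflTransGen
        (fun a b => ({a, b} : Finset (Fin 8)) ∈ (vertexLink kleinBottle8 v).faces) w
        (if v = 0 then 1 else 0) := by
      intro w hw
      obtain ⟨a, b, h1, h2, h3⟩ := hbase v w hw
      refine .head (b := a) ?_ (.head (b := b) ?_ (.single ?_))
      exacts [h1, h2, h3]
    intro w w' hw hw'
    have : Std.Symm fun a b => ({a, b} : Finset (Fin 8)) ∈ (vertexLink kleinBottle8 v).faces :=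
      ⟨fun a b h => by rwa [Finset.pair_comm]⟩
    exact (toBase w hw).trans (Std.Symm.symm _ _ (toBase w' hw'))

end KleinComplex

/-! ### The realization of the complex as the orbit space of the plane -/

section KleinPlane

/-- The map from the plane to the realization of `²8₂₀`, in the coordinates in which the Klein
bottle group acts. -/
noncomputable def planeCoord (x z : ℝ) : Fin 8 → ℝ :=
  gridCoord (2 * x + 2 * z - 1 / 2) (2 * z - 2 * x - 1 / 2)

theorem planeCoord_add_one (x z : ℝ) : planeCoord x (z + 1) = planeCoord x z := by
  rw [planeCoord, planeCoord, ← gridCoord_translate (2 * x + 2 * z - 1 / 2) (2 * z - 2 * x - 1 / 2)]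
  congr 1 <;> ring

theorem planeCoord_glide (x z : ℝ) : planeCoord (x + 1) (-z) = planeCoord x z := by
  rw [planeCoord, planeCoord, ← gridCoord_glide (2 * x + 2 * z - 1 / 2) (2 * z - 2 * x - 1 / 2)]
  congr 1 <;> ring

theorem planeCoord_reflect (x z : ℝ) (j : Fin 8) :
    planeCoord (-x) z (swapPerm j) = planeCoord x z j := by
  rw [planeCoord, planeCoord, ← gridCoord_swap (2 * x + 2 * z - 1 / 2) (2 * z - 2 * x - 1 / 2)]
  congr 2 <;> ring

theorem planeCoord_shift (x z : ℝ) (j : Fin 8) :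
    planeCoord (x + 1 / 2) (z + 1 / 2) (shiftPerm j) = planeCoord x z j := by
  rw [planeCoord, planeCoord, ← gridCoord_shift (2 * x + 2 * z - 1 / 2) (2 * z - 2 * x - 1 / 2)]
  congr 2 <;> ring

theorem planeCoord_klein (m n : ℤ) (x z : ℝ) :
    planeCoord (x + m) ((sgn m : ℤ) * z + n) = planeCoord x z := by
  have hn : ∀ (n : ℤ) (x z : ℝ), planeCoord x (z + n) = planeCoord x z := by
    intro n x z
    induction n with
    | zero => simp
    | succ k ih => rw [← ih, ← planeCoord_add_one x (z + ((k : ℤ) : ℝ))]; push_cast; rw [add_assoc]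
    | pred k ih => rw [← ih, ← planeCoord_add_one x (z + ((-(k : ℤ) - 1 : ℤ) : ℝ))]; push_cast; congr 1; ring
  have hs : ∀ m : ℤ, (((sgn (m + 1) : ℤˣ) : ℤ) : ℝ) = -((sgn m : ℤ) : ℝ) := by
    intro m
    rw [sgn_add, sgn_one]
    simp
  rw [hn]
  induction m with
  | zero => simp [sgn_zero]
  | succ k ih =>
    rw [← ih, ← planeCoord_glide (x + ((k : ℤ) : ℝ)), hs]
    push_cast
    rw [add_assoc, neg_mul]
  | pred k ih =>
    rw [← ih, ← planeCoord_glide (x + ((-(k : ℤ) - 1 : ℤ) : ℝ))]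
    have := hs (-(k : ℤ) - 1)
    rw [sub_add_cancel] at this
    rw [this]
    push_cast
    congr 1 <;> ring

/-- The lower left corners of eight unit squares which form a fundamental domain. -/
def cellCorner : Fin 8 → ℤ × ℤ :=
  ![(-1, -1), (0, 0), (0, -1), (1, 0), (0, -2), (1, -1), (1, -2), (2, -1)]

theorem exists_cellCorner {a b : ℤ} (h1 : 0 ≤ a - b) (h2 : a - b < 4) (h3 : 0 ≤ a + b + 2)
    (h4 : a + b + 2 < 4) : ∃ i, cellCorner i = (a, b) := by
  have ha : -1 ≤ a := by omega
  have ha' : a ≤ 2 := by omega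
  have hb : -2 ≤ b := by omega
  have hb' : b ≤ 0 := by omega
  interval_cases a <;> interval_cases b <;> first | omega | decide

/-- The vertices of the sixteen triangles of the fundamental domain, as points of `ℤ²`. -/
def triangleVertex (s : Fin 8 × Bool) (k : Fin 3) : ℤ × ℤ :=
  ((cellCorner s.1).1 +
      (triangleOffset (gridDiag (cellCorner s.1).1 (cellCorner s.1).2) s.2 k).1,
    (cellCorner s.1).2 +
      (triangleOffset (gridDiag (cellCorner s.1).1 (cellCorner s.1).2) s.2 k).2)

/-- The labels of the vertices of the sixteen triangles of the fundamental domain. -/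
def triangleLabel (s : Fin 8 × Bool) (k : Fin 3) : Fin 8 :=
  gridLabel (triangleVertex s k).1 (triangleVertex s k).2

theorem triangleLabel_injective : ∀ s, Function.Injective (triangleLabel s) := by decide +kernel

theorem triangleLabel_image_mem : ∀ s, univ.image (triangleLabel s) ∈ kleinBottle8.faces := by
  decide +kernel

theorem exists_triangleLabel : ∀ t ∈ ({
    {0, 1, 2}, {0, 1, 3}, {0, 2, 4}, {0, 3, 5}, {0, 4, 6}, {0, 5, 7}, {0, 6, 7}, {1, 2, 5},
    {1, 3, 4}, {1, 4, 7}, {1, 5, 6}, {1, 6, 7}, {2, 3, 4}, {2, 3, 5}, {4, 5, 6}, {4, 5, 7}} :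
      Finset (Finset (Fin 8))), ∃ s, univ.image (triangleLabel s) = t := by decide +kernel

/-- The finite check behind injectivity: for any two triangles of the fundamental domain, a single
element of the Klein bottle group carries all their common labels from one to the other. The vertex
`(a, b)` has plane coordinates `x = (a - b)/4` and `z = (a + b + 1)/4`; the group parameters are `m
- 1` and `n - 1`. -/
theorem triangle_match : ∀ s s', ∃ (m : Fin 3) (n : Fin 4), ∀ k l,
    triangleLabel s k = triangleLabel s' l →
      (triangleVertex s' l).1 - (triangleVertex s' l).2 =
        (triangleVertex s k).1 - (triangleVertex s k).2 + 4 * ((m : ℤ) - 1) ∧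
      (triangleVertex s' l).1 + (triangleVertex s' l).2 + 1 =
        (if m = 1 then 1 else -1) * ((triangleVertex s k).1 + (triangleVertex s k).2 + 1) +
          4 * ((n : ℤ) - 1) := by decide +kernel

/-- The disjoint union of the sixteen triangles of the fundamental domain. -/
abbrev TriangleSum : Type := (Fin 8 × Bool) × stdSimplex ℝ (Fin 3)

/-- The map from the disjoint union of the triangles to the realization of `²8₂₀`. -/
def sumCoord (p : TriangleSum) (j : Fin 8) : ℝ :=
  ∑ k, p.2 k * (if triangleLabel p.1 k = j then 1 else 0)

/-- The first coordinate of the map from the disjoint union of the triangles to the plane. -/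
noncomputable def sumX (p : TriangleSum) : ℝ :=
  ∑ k, p.2 k *
    ((((triangleVertex p.1 k).1 - (triangleVertex p.1 k).2 : ℤ) : ℝ) / 4)

/-- The second coordinate of the map from the disjoint union of the triangles to the plane. -/
noncomputable def sumZ (p : TriangleSum) : ℝ :=
  ∑ k, p.2 k *
    ((((triangleVertex p.1 k).1 + (triangleVertex p.1 k).2 + 1 : ℤ) : ℝ) / 4)

theorem sum_weights (p : TriangleSum) : ∑ k, p.2 k = 1 := p.2.2.2

theorem continuous_sum_triangle (f : Fin 8 × Bool → Fin 3 → ℝ) :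
    Continuous fun p : TriangleSum => ∑ k, p.2 k * f p.1 k := by
  refine continuous_finsetSum _ fun k _ => Continuous.mul ?_ ?_
  · exact (continuous_apply k).comp (continuous_subtype_val.comp continuous_snd)
  · exact (continuous_of_discreteTopology (f := fun s => f s k)).comp continuous_fst

theorem continuous_sumCoord : Continuous sumCoord :=
  continuous_pi fun j => continuous_sum_triangle fun s k => if triangleLabel s k = j then 1 else 0

theorem continuous_sumX : Continuous sumX :=
  continuous_sum_triangle fun s k =>
    (((triangleVertex s k).1 - (triangleVertex s k).2 : ℤ) : ℝ) / 4

theorem continuous_sumZ : Continuous sumZ :=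
  continuous_sum_triangle fun s k =>
    (((triangleVertex s k).1 + (triangleVertex s k).2 + 1 : ℤ) : ℝ) / 4

theorem sum_add_sum_eq {a b c : Fin 3 → ℝ} (h : ∑ k, c k = 1) :
    2 * ∑ k, c k * ((a k - b k) / 4) + 2 * ∑ k, c k * ((a k + b k + 1) / 4) - 1 / 2 =
      ∑ k, c k * a k ∧
    2 * ∑ k, c k * ((a k + b k + 1) / 4) - 2 * ∑ k, c k * ((a k - b k) / 4) - 1 / 2 =
      ∑ k, c k * b k := by
  rw [Fin.sum_univ_three] at h
  simp only [Fin.sum_univ_three]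
  constructor <;> linear_combination (1 / 2) * h

theorem sumX_sumZ (p : TriangleSum) :
    2 * sumX p + 2 * sumZ p - 1 / 2 =
        ∑ k, p.2 k * ((triangleVertex p.1 k).1 : ℤ) ∧
      2 * sumZ p - 2 * sumX p - 1 / 2 =
        ∑ k, p.2 k * ((triangleVertex p.1 k).2 : ℤ) := by
  have := sum_add_sum_eq (a := fun k => ((triangleVertex p.1 k).1 : ℝ))
    (b := fun k => ((triangleVertex p.1 k).2 : ℝ)) p.2.2.2
  simp only [sumX, sumZ, Int.cast_sub, Int.cast_add, Int.cast_one]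
  exact this

theorem planeCoord_sum (p : TriangleSum) : planeCoord (sumX p) (sumZ p) = sumCoord p := by
  funext j
  rw [planeCoord, (sumX_sumZ p).1, (sumX_sumZ p).2]
  exact gridCoord_triangle (cellCorner p.1.1).1 (cellCorner p.1.1).2 p.1.2 p.2.2.1 p.2.2.2 j

theorem exists_sum_eq_of_cell {a b : ℤ} (h1 : 0 ≤ a - b) (h2 : a - b < 4) (h3 : 0 ≤ a + b + 2)
    (h4 : a + b + 2 < 4) {α β : ℝ} (hα0 : 0 ≤ α) (hα1 : α ≤ 1) (hβ0 : 0 ≤ β) (hβ1 : β ≤ 1)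
    {x z : ℝ} (hx : 2 * x + 2 * z - 1 / 2 = a + α) (hz : 2 * z - 2 * x - 1 / 2 = b + β) :
    ∃ p, sumX p = x ∧ sumZ p = z := by
  obtain ⟨i, hi⟩ := exists_cellCorner h1 h2 h3 h4
  obtain ⟨t, c, hc, hs, e1, e2⟩ := exists_triangle a b
    (gridDiag (cellCorner i).1 (cellCorner i).2) hα0 hα1 hβ0 hβ1
  have h := sumX_sumZ ((i, t), ⟨c, hc, hs⟩)
  simp only [triangleVertex, hi] at h
  simp only [hi] at e1 e2
  have h1 := h.1.trans e1
  have h2 := h.2.trans e2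
  exact ⟨((i, t), ⟨c, hc, hs⟩), by linarith, by linarith⟩

/-- The unit square of the point is moved into the fundamental domain, first in the direction of `x`
by a power of the glide, then in the direction of `z` by a translation. -/
theorem exists_sum_eq (x z : ℝ) :
    ∃ (m n : ℤ) (p : TriangleSum), sumX p = x + m ∧ sumZ p = (sgn m : ℤ) * z + n := by
  obtain ⟨a, α, hα0, hα1, hu⟩ := exists_cell (2 * x + 2 * z - 1 / 2)
  obtain ⟨b, β, hβ0, hβ1, hw⟩ := exists_cell (2 * z - 2 * x - 1 / 2)
  rcases Int.even_or_odd (-((a - b) / 4)) with h | h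
  · refine ⟨-((a - b) / 4), -((a + b + 2) / 4), ?_⟩
    rw [sgn_of_even h]
    refine exists_sum_eq_of_cell (a := a + 2 * -((a - b) / 4) + 2 * -((a + b + 2) / 4))
      (b := b - 2 * -((a - b) / 4) + 2 * -((a + b + 2) / 4)) (by omega) (by omega) (by omega)
      (by omega) hα0 hα1 hβ0 hβ1 ?_ ?_ <;> push_cast <;> linarith
  -- An odd power of the glide reverses `z`, that is, it exchanges the two grid directions and
  -- reverses both. So the local coordinates become `1 - β` and `1 - α`.
  · refine ⟨-((a - b) / 4), -((-(a + b + 2)) / 4), ?_⟩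
    have hs : sgn (-((a - b) / 4)) = -1 := Int.negOnePow_odd _ h
    rw [hs]
    refine exists_sum_eq_of_cell
      (a := -b - 2 + 2 * -((a - b) / 4) + 2 * -((-(a + b + 2)) / 4))
      (b := -a - 2 - 2 * -((a - b) / 4) + 2 * -((-(a + b + 2)) / 4)) (by omega) (by omega)
      (by omega) (by omega) (α := 1 - β) (β := 1 - α) (by linarith) (by linarith) (by linarith)
      (by linarith) ?_ ?_ <;> push_cast <;> linarith

theorem exists_common_extension {ι κ A B : Type*} [Inhabited B] {a : ι → A} {b : κ → A}
    (ha : Function.Injective a) (hb : Function.Injective b) {x : ι → B} {y : κ → B}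
    (h : ∀ k l, a k = b l → x k = y l) :
    ∃ f : A → B, (∀ k, f (a k) = x k) ∧ ∀ l, f (b l) = y l := by
  classical
  refine ⟨Function.extend a x (Function.extend b y fun _ => default), fun k => ha.extend_apply _ _ _,
    fun l => ?_⟩
  by_cases hl : ∃ k, a k = b l
  · obtain ⟨k, hk⟩ := hl
    rw [← hk, ha.extend_apply, h k l hk]
  · rw [Function.extend_apply' _ _ _ hl, hb.extend_apply]

theorem sum_mul_label (p : TriangleSum) (f : Fin 8 → ℝ) :
    ∑ k, p.2 k * f (triangleLabel p.1 k) = ∑ j, f j * sumCoord p j := by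
  simp only [sumCoord, Finset.mul_sum]
  rw [Finset.sum_comm]
  refine Finset.sum_congr rfl fun k _ => ?_
  rw [Finset.sum_eq_single (triangleLabel p.1 k)]
  · rw [if_pos rfl]; ring
  · intro j _ hj
    rw [if_neg (Ne.symm hj)]; ring
  · simp

/-- Vertex values on two triangles that agree on common labels come from one function on all eight
labels, and its affine extension depends on the barycentric coordinates only. -/
theorem sum_eq_of_match {p p' : TriangleSum} (h : sumCoord p = sumCoord p') {x y : Fin 3 → ℝ}
    (hxy : ∀ k l, triangleLabel p.1 k = triangleLabel p'.1 l → x k = y l) :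
    ∑ k, p.2 k * x k = ∑ k, p'.2 k * y k := by
  obtain ⟨f, hf, hf'⟩ := exists_common_extension (triangleLabel_injective p.1)
    (triangleLabel_injective p'.1) hxy
  simp only [← hf, ← hf']
  rw [sum_mul_label, sum_mul_label, h]

theorem sumCoord_eq_imp {p p' : TriangleSum} (h : sumCoord p = sumCoord p') :
    ∃ m n : ℤ, sumX p' = sumX p + m ∧ sumZ p' = (sgn m : ℤ) * sumZ p + n := by
  obtain ⟨m, n, hmn⟩ := triangle_match p.1 p'.1
  have hsm : ((sgn ((m : ℤ) - 1) : ℤˣ) : ℤ) = if m = 1 then 1 else -1 := by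
    clear hmn
    revert m
    decide +kernel
  refine ⟨(m : ℤ) - 1, (n : ℤ) - 1, ?_, ?_⟩
  · have := sum_eq_of_match h (x := fun k =>
      (((triangleVertex p.1 k).1 - (triangleVertex p.1 k).2 : ℤ) : ℝ) / 4 + (((m : ℤ) - 1 : ℤ) : ℝ))
      (y := fun k => (((triangleVertex p'.1 k).1 - (triangleVertex p'.1 k).2 : ℤ) : ℝ) / 4) ?_
    · simp only [mul_add, Finset.sum_add_distrib, ← Finset.sum_mul, sum_weights, one_mul] at this
      exact this.symm
    · intro k l hkl
      have := (hmn k l hkl).1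
      rw [this]
      push_cast
      ring
  · have := sum_eq_of_match h (x := fun k =>
      (((triangleVertex p.1 k).1 + (triangleVertex p.1 k).2 + 1 : ℤ) : ℝ) / 4 *
        ((sgn ((m : ℤ) - 1) : ℤˣ) : ℤ) + (((n : ℤ) - 1 : ℤ) : ℝ))
      (y := fun k => (((triangleVertex p'.1 k).1 + (triangleVertex p'.1 k).2 + 1 : ℤ) : ℝ) / 4) ?_
    · simp only [mul_add, Finset.sum_add_distrib, ← mul_assoc, ← Finset.sum_mul, sum_weights, one_mul]
        at this
      rw [mul_comm (((sgn ((m : ℤ) - 1) : ℤˣ) : ℤ) : ℝ) (sumZ p)]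
      exact this.symm
    · intro k l hkl
      have := (hmn k l hkl).2
      rw [this, hsm]
      push_cast
      ring

/-- Both points are moved into the fundamental domain, where equality of coordinates is settled by
the matching of triangles; the three group elements are then composed. -/
theorem planeCoord_eq_iff {x z x' z' : ℝ} : planeCoord x z = planeCoord x' z' ↔
    ∃ m n : ℤ, x' = x + m ∧ z' = (sgn m : ℤ) * z + n := by
  constructor
  · intro h
    obtain ⟨m, n, p, hx, hz⟩ := exists_sum_eq x z
    obtain ⟨m', n', p', hx', hz'⟩ := exists_sum_eq x' z'
    obtain ⟨k, l, hk, hl⟩ := sumCoord_eq_imp (p := p) (p' := p') (by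
      rw [← planeCoord_sum, ← planeCoord_sum, hx, hz, hx', hz', planeCoord_klein,
        planeCoord_klein, h])
    refine ⟨m + k - m', (sgn m' : ℤ) * ((sgn k : ℤ) * n + l - n'), ?_, ?_⟩
    · push_cast
      linarith
    · have h1 : sgn (m + k - m') = sgn m * sgn k * sgn m' := by
        rw [sub_eq_add_neg, sgn_add, sgn_add, sgn_neg]
      have h2 := units_cast_mul_self (sgn m')
      rw [h1]
      push_cast
      rw [hz, hz'] at hl
      linear_combination (-z') * h2 + ((sgn m' : ℤ) : ℝ) * hl
  · rintro ⟨m, n, rfl, rfl⟩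
    rw [planeCoord_klein]

/-- The sixteen labelled triangles map onto the sixteen facets, and a point of a facet is its own
list of barycentric coordinates. -/
theorem range_sumCoord : Set.range sumCoord = geomRealization kleinBottle8 := by
  ext a
  constructor
  · rintro ⟨p, rfl⟩
    refine ⟨fun j => Finset.sum_nonneg fun k _ => mul_nonneg (p.2.2.1 k) (by split_ifs <;> simp),
      ?_, univ.image (triangleLabel p.1), triangleLabel_image_mem p.1, fun j hj => ?_⟩
    · have := sum_mul_label p fun _ => 1
      simp only [mul_one, one_mul] at this
      rw [← this, sum_weights]
    · refine Finset.sum_eq_zero fun k _ => ?_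
      rw [if_neg, mul_zero]
      rintro rfl
      exact hj (Finset.mem_image_of_mem _ (Finset.mem_univ _))
  · rintro ⟨h0, h1, s, ⟨-, t, ht, hst⟩, hs⟩
    obtain ⟨i, rfl⟩ := exists_triangleLabel t ht
    have hsum : ∀ f : Fin 8 → ℝ, (∀ j, j ∉ univ.image (triangleLabel i) → f j = 0) →
        ∑ k, f (triangleLabel i k) = ∑ j, f j := by
      intro f hf
      rw [← Finset.sum_subset (Finset.subset_univ (univ.image (triangleLabel i)))
        fun j _ hj => hf j hj, Finset.sum_image fun x _ y _ h => triangleLabel_injective i h]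
    have ha : ∀ j, j ∉ univ.image (triangleLabel i) → a j = 0 := fun j hj => hs j fun h => hj (hst h)
    refine ⟨(i, ⟨fun k => a (triangleLabel i k), fun k => h0 _, ?_⟩), ?_⟩
    · rw [hsum a ha, h1]
    · funext j
      have := hsum (fun j' => a j' * if j' = j then 1 else 0) fun j' hj' => by
        rw [ha j' hj', zero_mul]
      refine this.trans ?_
      rw [Finset.sum_eq_single j]
      · rw [if_pos rfl, mul_one]
      · intro b _ hb
        rw [if_neg hb, mul_zero]
      · simp

theorem kleinForm_apply (m n : ℤ) (x z : ℝ) :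
    kleinForm m n !₂[x, z] = !₂[x + m, (sgn m : ℤ) * z + n] := by
  ext i
  rw [kleinForm, signedMotion_apply]
  fin_cases i <;> simp

theorem nonempty_homeomorph_kleinBottle8 : Nonempty (geomRealization kleinBottle8 ≃ₜ KleinBottle) := by
  have : T2Space KleinBottle := hasDisplacement_kleinGroup.t2Space
  have hmem : ∀ p, sumCoord p ∈ geomRealization kleinBottle8 := fun p => by
    rw [← range_sumCoord]
    exact ⟨p, rfl⟩
  have hcont : Continuous fun p : TriangleSum => (!₂[sumX p, sumZ p] : EuclideanSpace ℝ (Fin 2)) := by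
    refine (PiLp.continuous_toLp 2 _).comp (continuous_pi fun i => ?_)
    rcases (by decide : ∀ k : Fin 2, k = 0 ∨ k = 1) i with rfl | rfl
    exacts [continuous_sumX, continuous_sumZ]
  refine nonempty_homeomorph_of_fibres (X := TriangleSum)
    (q := fun p => (⟨sumCoord p, hmem p⟩ : geomRealization kleinBottle8))
    (r := fun p => orbitMk kleinGroup !₂[sumX p, sumZ p])
    (continuous_sumCoord.subtype_mk _) ?_ ?_ ?_ ?_
  · exact (continuous_orbitMk _).comp hcont
  · rintro ⟨a, ha⟩
    rw [← range_sumCoord] at ha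
    obtain ⟨p, rfl⟩ := ha
    exact ⟨p, rfl⟩
  · intro y
    obtain ⟨e, rfl⟩ := Quotient.exists_rep y
    obtain ⟨m, n, p, hx, hz⟩ := exists_sum_eq (e 0) (e 1)
    refine ⟨p, (orbitMk_eq_iff.2 ⟨kleinForm m n, (mem_kleinGroup_iff _).2 ⟨m, n, rfl⟩, ?_⟩).symm⟩
    have : e = !₂[e 0, e 1] := by
      ext i
      fin_cases i <;> rfl
    rw [this, kleinForm_apply, hx, hz]
  · intro p p'
    rw [Subtype.mk_eq_mk, ← planeCoord_sum, ← planeCoord_sum, planeCoord_eq_iff, orbitMk_eq_iff]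
    constructor
    · rintro ⟨m, n, hx, hz⟩
      exact ⟨kleinForm m n, (mem_kleinGroup_iff _).2 ⟨m, n, rfl⟩, by rw [kleinForm_apply, hx, hz]⟩
    · rintro ⟨g, hg, h⟩
      obtain ⟨m, n, rfl⟩ := (mem_kleinGroup_iff g).1 hg
      rw [kleinForm_apply] at h
      exact ⟨m, n, (congrArg (fun e : EuclideanSpace ℝ (Fin 2) => e 0) h).symm,
        (congrArg (fun e : EuclideanSpace ℝ (Fin 2) => e 1) h).symm⟩

end KleinPlane

/-! ### The four flat manifolds as mapping tori of the Klein bottle -/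

section KleinBundles

/-- The automorphism `shiftPerm` of `²8₂₀`. -/
def shiftAut : complexAut kleinBottle8 :=
  ⟨shiftPerm, (by decide +kernel :
    ∀ s : Finset (Fin 8), s.image shiftPerm ∈ kleinBottle8.faces ↔ s ∈ kleinBottle8.faces)⟩

/-- The automorphism `swapPerm` of `²8₂₀`. -/
def swapAut : complexAut kleinBottle8 :=
  ⟨swapPerm, (by decide +kernel :
    ∀ s : Finset (Fin 8), s.image swapPerm ∈ kleinBottle8.faces ↔ s ∈ kleinBottle8.faces)⟩

/-- `Ψ` gives coordinates on three-space in which `y` modulo 3 is the circle direction. The elements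
preserving `y` act on `(x, z)` as the Klein bottle group, and those going from height 3 to height 0
act through the lift `(S, T)` of `φ` to the plane. -/
theorem nonempty_homeomorph_flatQuotient
    {Γ : Subgroup (EuclideanSpace ℝ (Fin 3) ≃ᵢ EuclideanSpace ℝ (Fin 3))}
    (hΓ : HasDisplacement Γ) (φ : complexAut kleinBottle8)
    {Ψ : ℝ → ℝ → ℝ → EuclideanSpace ℝ (Fin 3)}
    (hΨ : Continuous fun p : ℝ × ℝ × ℝ => Ψ p.1 p.2.1 p.2.2)
    (hsurj : ∀ e, ∃ x z y, Ψ x z y = e) {S T : ℝ → ℝ → ℝ}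
    (hST : ∀ x z v, planeCoord (S x z) (T x z) ((φ : Equiv.Perm (Fin 8)) v) = planeCoord x z v)
    (hd : ∀ x z y x' z' y', (∃ g ∈ Γ, g (Ψ x z y) = Ψ x' z' y') → ∃ d : ℤ, y' = y + 3 * d)
    (h₀ : ∀ x z y x' z', (∃ g ∈ Γ, g (Ψ x z y) = Ψ x' z' y) ↔
      ∃ m n : ℤ, x' = x + m ∧ z' = (sgn m : ℤ) * z + n)
    (h₁ : ∀ x z x' z', (∃ g ∈ Γ, g (Ψ x z 3) = Ψ x' z' 0) ↔
      ∃ m n : ℤ, x' = S x z + m ∧ z' = (sgn m : ℤ) * T x z + n)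
    (hshift : ∀ x z y, ∀ d : ℤ, ∃ x' z', ∃ g ∈ Γ, g (Ψ x z y) = Ψ x' z' (y + 3 * d)) :
    Nonempty (geomRealization (twistedProduct kleinBottle8 φ) ≃ₜ FlatQuotient Γ) := by
  have : T2Space (FlatQuotient Γ) := hΓ.t2Space
  have hsymm : ∀ {e e'}, (∃ g ∈ Γ, g e = e') → ∃ g ∈ Γ, g e' = e := by
    rintro e _ ⟨g, hg, rfl⟩
    exact ⟨g⁻¹, Γ.inv_mem hg, g.symm_apply_apply e⟩
  have hST' : ∀ x z x' z', (∃ m n : ℤ, x' = S x z + m ∧ z' = (sgn m : ℤ) * T x z + n) ↔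
      ∀ v, planeCoord x' z' ((φ : Equiv.Perm (Fin 8)) v) = planeCoord x z v := by
    intro x z x' z'
    rw [← planeCoord_eq_iff]
    constructor
    · intro h v
      rw [← h, hST]
    · intro h
      funext j
      obtain ⟨v, rfl⟩ := (φ : Equiv.Perm (Fin 8)).surjective j
      rw [hST, h]
  refine nonempty_homeomorph_twistedProduct φ (X := TriangleSum) continuous_sumCoord range_sumCoord
    (r := fun p => orbitMk Γ (Ψ (sumX p.1) (sumZ p.1) (p.2 : ℝ))) ?_ ?_ ?_
  · have hc : Continuous fun p : TriangleSum × Set.Icc (0 : ℝ) 3 => (sumX p.1, sumZ p.1, (p.2 : ℝ)) :=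
      (continuous_sumX.comp continuous_fst).prodMk
        ((continuous_sumZ.comp continuous_fst).prodMk (continuous_subtype_val.comp continuous_snd))
    exact (continuous_orbitMk Γ).comp (hΨ.comp hc)
  · intro q
    obtain ⟨e, rfl⟩ := Quotient.exists_rep q
    obtain ⟨x, z, y, rfl⟩ := hsurj e
    -- First the height is brought into `[0, 3]`, then the point of the plane into the fundamental
    -- domain at this height.
    obtain ⟨x', z', g, hg, hgx⟩ := hshift x z y (-⌊y / 3⌋)
    obtain ⟨m, n, p, hx, hz⟩ := exists_sum_eq x' z'
    obtain ⟨g', hg', hgx'⟩ := (h₀ x' z' (y + 3 * (-⌊y / 3⌋ : ℤ)) _ _).2 ⟨m, n, hx, hz⟩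
    have f1 := Int.floor_le (y / 3)
    have f2 := Int.lt_floor_add_one (y / 3)
    refine ⟨(p, ⟨y + 3 * (-⌊y / 3⌋ : ℤ), ?_, ?_⟩), ?_⟩
    · push_cast; linarith
    · push_cast; linarith
    · refine (orbitMk_eq_iff.2 ⟨g' * g, Γ.mul_mem hg' hg, ?_⟩).symm
      rw [← hgx', ← hgx]
      rfl
  · rintro p p' ⟨y, hy0, hy3⟩ ⟨y', hy0', hy3'⟩
    rw [orbitMk_eq_iff]
    simp only
    rw [← planeCoord_sum p, ← planeCoord_sum p', planeCoord_eq_iff, ← hST', ← hST', ← h₁, ← h₁,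
      ← h₀ _ _ y]
    constructor
    · intro h
      obtain ⟨d, rfl⟩ := hd _ _ _ _ _ _ h
      have d1 : (-1 : ℝ) ≤ d := by linarith
      have d2 : (d : ℝ) ≤ 1 := by linarith
      have d1' : -1 ≤ d := by exact_mod_cast d1
      have d2' : d ≤ 1 := by exact_mod_cast d2
      -- Both heights lie in `[0, 3]`, so a difference of `±3` occurs only between the two ends.
      interval_cases d
      · obtain rfl : y = 3 := by push_cast at hy0'; linarith
        right; left
        norm_num at h
        exact ⟨rfl, by norm_num, h⟩
      · left
        norm_num at h
        exact ⟨by norm_num, h⟩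
      · obtain rfl : y = 0 := by push_cast at hy3'; linarith
        right; right
        norm_num at h
        exact ⟨rfl, by norm_num, hsymm h⟩
    · rintro (⟨rfl, h⟩ | ⟨rfl, rfl, h⟩ | ⟨rfl, rfl, h⟩)
      exacts [h, h, hsymm h]

theorem continuous_vec_three {X : Type*} [TopologicalSpace X] {f g h : X → ℝ} (hf : Continuous f)
    (hg : Continuous g) (hh : Continuous h) :
    Continuous fun x => (!₂[f x, g x, h x] : EuclideanSpace ℝ (Fin 3)) := by
  refine (PiLp.continuous_toLp 2 _).comp (continuous_pi fun i => ?_)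
  rcases (by decide : ∀ k : Fin 3, k = 0 ∨ k = 1 ∨ k = 2) i with rfl | rfl | rfl
  exacts [hf, hg, hh]

theorem vec_three_eq_iff {a b c a' b' c' : ℝ} :
    (!₂[a, b, c] : EuclideanSpace ℝ (Fin 3)) = !₂[a', b', c'] ↔ a = a' ∧ b = b' ∧ c = c' := by
  constructor
  · intro h
    exact ⟨congrArg (fun e : EuclideanSpace ℝ (Fin 3) => e 0) h,
      congrArg (fun e : EuclideanSpace ℝ (Fin 3) => e 1) h,
      congrArg (fun e : EuclideanSpace ℝ (Fin 3) => e 2) h⟩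
  · rintro ⟨rfl, rfl, rfl⟩
    rfl

theorem eq_vec_three (e : EuclideanSpace ℝ (Fin 3)) : e = !₂[e 0, e 1, e 2] := by
  ext i
  fin_cases i <;> rfl

theorem signedMotion_vec_three (s t u : ℤˣ) (a b c x y z : ℝ) :
    signedMotion ![s, t, u] ![a, b, c] !₂[x, y, z] =
      !₂[(s : ℤ) * x + a, (t : ℤ) * y + b, (u : ℤ) * z + c] := by
  ext i
  rw [signedMotion_apply]
  fin_cases i <;> simp

theorem bundle_zero_iff (x z y x' z' y' : ℝ) :
    (∃ g ∈ bieberbachGroup 0, g !₂[x / 2, y / 3, z] = !₂[x' / 2, y' / 3, z']) ↔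
      ∃ m n k : ℤ, x' = x + m ∧ y' = y + 3 * n ∧ z' = (sgn m : ℤ) * z + k := by
  constructor
  · rintro ⟨g, hg, h⟩
    obtain ⟨m, n, k, rfl⟩ := (mem_bieberbachGroup_zero_iff g).1 hg
    rw [form₁, signedMotion_vec_three, vec_three_eq_iff] at h
    obtain ⟨h1, h2, h3⟩ := h
    push_cast at h1 h2 h3
    exact ⟨m, n, k, by linarith, by linarith, h3.symm⟩
  · rintro ⟨m, n, k, rfl, rfl, rfl⟩
    refine ⟨form₁ m n k, (mem_bieberbachGroup_zero_iff _).2 ⟨m, n, k, rfl⟩, ?_⟩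
    rw [form₁, signedMotion_vec_three, vec_three_eq_iff]
    push_cast
    exact ⟨by ring, by ring, rfl⟩

theorem nonempty_homeomorph_bundle_zero :
    Nonempty (geomRealization (twistedProduct kleinBottle8 1) ≃ₜ FlatB 0) := by
  refine nonempty_homeomorph_flatQuotient (hasDisplacement_bieberbachGroup 0) 1
    (Ψ := fun x z y => !₂[x / 2, y / 3, z]) (S := fun x _ => x) (T := fun _ z => z)
    (continuous_vec_three (by fun_prop) (by fun_prop) (by fun_prop)) ?_ (fun x z v => rfl) ?_ ?_ ?_ ?_
  · intro e
    refine ⟨2 * e 0, e 2, 3 * e 1, ?_⟩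
    conv_rhs => rw [eq_vec_three e]
    rw [vec_three_eq_iff]
    exact ⟨by ring, by ring, rfl⟩
  all_goals simp only [bundle_zero_iff]
  · rintro x z y x' z' y' ⟨m, n, k, -, h, -⟩
    exact ⟨n, h⟩
  · intro x z y x' z'
    constructor
    · rintro ⟨m, n, k, hx, -, hz⟩
      exact ⟨m, k, hx, hz⟩
    · rintro ⟨m, k, hx, hz⟩
      exact ⟨m, 0, k, hx, by simp, hz⟩
  · intro x z x' z'
    constructor
    · rintro ⟨m, n, k, hx, -, hz⟩
      exact ⟨m, k, hx, hz⟩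
    · rintro ⟨m, k, hx, hz⟩
      exact ⟨m, -1, k, hx, by norm_num, hz⟩
  · intro x z y d
    exact ⟨x, z, 0, d, 0, by simp, rfl, by simp [sgn_zero]⟩

/-- The shear by `y / 6` adds `1/2` to `x` whenever `y` grows by 3. Without it the gluing would fix
`x` modulo 1 and would not be the translation induced by `shiftPerm`. -/
theorem bundle_one_iff (x z y x' z' y' : ℝ) :
    (∃ g ∈ bieberbachGroup 1, g !₂[(x - y / 6) / 2, y / 6, 2 * z] =
        !₂[(x' - y' / 6) / 2, y' / 6, 2 * z']) ↔
      ∃ m n k : ℤ, n % 2 = k % 2 ∧ x' = x + m + n / 2 ∧ y' = y + 3 * n ∧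
        z' = (sgn (m + k) : ℤ) * z + k / 2 := by
  constructor
  · rintro ⟨g, hg, h⟩
    obtain ⟨m, n, k, hnk, rfl⟩ := (mem_bieberbachGroup_one_iff g).1 hg
    rw [form₂, signedMotion_vec_three, vec_three_eq_iff] at h
    obtain ⟨h1, h2, h3⟩ := h
    push_cast at h1 h2 h3
    exact ⟨m, n, k, hnk, by linarith, by linarith, by linarith⟩
  · rintro ⟨m, n, k, hnk, rfl, rfl, rfl⟩
    refine ⟨form₂ m n k, (mem_bieberbachGroup_one_iff _).2 ⟨m, n, k, hnk, rfl⟩, ?_⟩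
    rw [form₂, signedMotion_vec_three, vec_three_eq_iff]
    push_cast
    exact ⟨by ring, by ring, by ring⟩

/-- The circle direction is now the first axis. The offset `1/2` in `x` makes the first generator,
composed with one glide, act as `x ↦ -x` with `z` fixed. -/
theorem bundle_two_iff (x z y x' z' y' : ℝ) :
    (∃ g ∈ bieberbachGroup 2, g !₂[y / 6, (x + 1 / 2) / 2, z] =
        !₂[y' / 6, (x' + 1 / 2) / 2, z']) ↔
      ∃ m n k : ℤ, x' = (sgn m : ℤ) * (x + 1 / 2) + n - 1 / 2 ∧ y' = y + 3 * m ∧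
        z' = (sgn (m + n) : ℤ) * z + k := by
  constructor
  · rintro ⟨g, hg, h⟩
    obtain ⟨m, n, k, rfl⟩ := (mem_bieberbachGroup_two_iff g).1 hg
    rw [form₃, signedMotion_vec_three, vec_three_eq_iff] at h
    obtain ⟨h1, h2, h3⟩ := h
    push_cast at h1 h2 h3
    exact ⟨m, n, k, by linarith, by linarith, by linarith⟩
  · rintro ⟨m, n, k, rfl, rfl, rfl⟩
    refine ⟨form₃ m n k, (mem_bieberbachGroup_two_iff _).2 ⟨m, n, k, rfl⟩, ?_⟩
    rw [form₃, signedMotion_vec_three, vec_three_eq_iff]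
    push_cast
    exact ⟨by ring, by ring, by ring⟩

/-- The offsets `1/4` centre the reflections: the slice group becomes the standard Klein bottle
group, and the gluing becomes `(x, z) ↦ (-x + 1/2, z + 1/2)` up to this group. -/
theorem bundle_three_iff (x z y x' z' y' : ℝ) :
    (∃ g ∈ bieberbachGroup 3, g !₂[y / 6, (x + 1 / 4) / 2, z + 1 / 4] =
        !₂[y' / 6, (x' + 1 / 4) / 2, z' + 1 / 4]) ↔
      ∃ m n k : ℤ, n % 2 = k % 2 ∧ x' = (sgn m : ℤ) * (x + 1 / 4) + n - 1 / 4 ∧ y' = y + 3 * m ∧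
        z' = (sgn (m + n) : ℤ) * (z + 1 / 4) + k / 2 - 1 / 4 := by
  constructor
  · rintro ⟨g, hg, h⟩
    obtain ⟨m, n, k, hnk, rfl⟩ := (mem_bieberbachGroup_three_iff g).1 hg
    rw [form₄, signedMotion_vec_three, vec_three_eq_iff] at h
    obtain ⟨h1, h2, h3⟩ := h
    push_cast at h1 h2 h3
    exact ⟨m, n, k, hnk, by linarith, by linarith, by linarith⟩
  · rintro ⟨m, n, k, hnk, rfl, rfl, rfl⟩
    refine ⟨form₄ m n k, (mem_bieberbachGroup_three_iff _).2 ⟨m, n, k, hnk, rfl⟩, ?_⟩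
    rw [form₄, signedMotion_vec_three, vec_three_eq_iff]
    push_cast
    exact ⟨by ring, by ring, by ring⟩

theorem eq_zero_of_eq_add {y : ℝ} {n : ℤ} (h : y = y + 3 * n) : n = 0 := by
  have : (n : ℝ) = 0 := by linarith
  exact_mod_cast this

theorem eq_neg_one_of_eq_add {n : ℤ} (h : (0 : ℝ) = 3 + 3 * n) : n = -1 := by
  have : (n : ℝ) = -1 := by linarith
  exact_mod_cast this

theorem nonempty_homeomorph_bundle_one :
    Nonempty (geomRealization (twistedProduct kleinBottle8 shiftAut) ≃ₜ FlatB 1) := by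
  refine nonempty_homeomorph_flatQuotient (hasDisplacement_bieberbachGroup 1) shiftAut
    (Ψ := fun x z y => !₂[(x - y / 6) / 2, y / 6, 2 * z]) (S := fun x _ => x + 1 / 2)
    (T := fun _ z => z + 1 / 2)
    (continuous_vec_three (by fun_prop) (by fun_prop) (by fun_prop)) ?_ planeCoord_shift ?_ ?_ ?_ ?_
  · intro e
    refine ⟨2 * e 0 + e 1, e 2 / 2, 6 * e 1, ?_⟩
    conv_rhs => rw [eq_vec_three e]
    rw [vec_three_eq_iff]
    exact ⟨by ring, by ring, by ring⟩
  all_goals simp only [bundle_one_iff]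
  · rintro x z y x' z' y' ⟨m, n, k, -, -, h, -⟩
    exact ⟨n, h⟩
  · intro x z y x' z'
    constructor
    · rintro ⟨m, n, k, hnk, hx, hy, hz⟩
      obtain rfl := eq_zero_of_eq_add hy
      obtain ⟨l, rfl⟩ : ∃ l, k = 2 * l := ⟨k / 2, by omega⟩
      rw [sgn_congr (show (m + 2 * l) % 2 = m % 2 by omega)] at hz
      push_cast at hx hz
      exact ⟨m, l, by linarith, by linarith⟩
    · rintro ⟨m, l, hx, hz⟩
      refine ⟨m, 0, 2 * l, by omega, by push_cast; linarith, by simp, ?_⟩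
      rw [sgn_congr (show (m + 2 * l) % 2 = m % 2 by omega)]
      push_cast
      linarith
  · intro x z x' z'
    constructor
    · rintro ⟨m, n, k, hnk, hx, hy, hz⟩
      obtain rfl := eq_neg_one_of_eq_add hy
      -- Since `n = -1`, the parity condition makes `k` odd. The half-integer left in `z` is
      -- absorbed by `z + 1/2`, up to an integer depending on the sign.
      obtain ⟨l, rfl⟩ : ∃ l, k = 2 * l + 1 := ⟨k / 2, by omega⟩
      rw [sgn_congr (show (m + (2 * l + 1)) % 2 = (m - 1) % 2 by omega)] at hz
      push_cast at hx hz
      rcases Int.units_eq_one_or (sgn (m - 1)) with h | h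
      · refine ⟨m - 1, l, by push_cast; linarith, ?_⟩
        rw [h] at hz ⊢
        push_cast at hz ⊢
        linarith
      · refine ⟨m - 1, l + 1, by push_cast; linarith, ?_⟩
        rw [h] at hz ⊢
        push_cast at hz ⊢
        linarith
    · rintro ⟨m, l, hx, hz⟩
      rcases Int.units_eq_one_or (sgn m) with h | h
      · refine ⟨m + 1, -1, 2 * l + 1, by omega, by push_cast; linarith, by norm_num, ?_⟩
        rw [sgn_congr (show (m + 1 + (2 * l + 1)) % 2 = m % 2 by omega)]
        rw [h] at hz ⊢
        push_cast at hz ⊢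
        linarith
      · refine ⟨m + 1, -1, 2 * l - 1, by omega, by push_cast; linarith, by norm_num, ?_⟩
        rw [sgn_congr (show (m + 1 + (2 * l - 1)) % 2 = m % 2 by omega)]
        rw [h] at hz ⊢
        push_cast at hz ⊢
        linarith
  · intro x z y d
    exact ⟨_, _, 0, d, d, rfl, rfl, rfl, rfl⟩

theorem nonempty_homeomorph_bundle_two :
    Nonempty (geomRealization (twistedProduct kleinBottle8 swapAut) ≃ₜ FlatB 2) := by
  refine nonempty_homeomorph_flatQuotient (hasDisplacement_bieberbachGroup 2) swapAut
    (Ψ := fun x z y => !₂[y / 6, (x + 1 / 2) / 2, z]) (S := fun x _ => -x) (T := fun _ z => z)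
    (continuous_vec_three (by fun_prop) (by fun_prop) (by fun_prop)) ?_ planeCoord_reflect
    ?_ ?_ ?_ ?_
  · intro e
    refine ⟨2 * e 1 - 1 / 2, e 2, 6 * e 0, ?_⟩
    conv_rhs => rw [eq_vec_three e]
    rw [vec_three_eq_iff]
    exact ⟨by ring, by ring, rfl⟩
  all_goals simp only [bundle_two_iff]
  · rintro x z y x' z' y' ⟨m, n, k, -, h, -⟩
    exact ⟨m, h⟩
  · intro x z y x' z'
    constructor
    · rintro ⟨m, n, k, hx, hy, hz⟩
      obtain rfl := eq_zero_of_eq_add hy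
      rw [sgn_zero] at hx
      rw [zero_add] at hz
      push_cast at hx
      exact ⟨n, k, by linarith, hz⟩
    · rintro ⟨n, k, hx, hz⟩
      refine ⟨0, n, k, ?_, by simp, by rwa [zero_add]⟩
      rw [sgn_zero]
      push_cast
      linarith
  · intro x z x' z'
    constructor
    · rintro ⟨m, n, k, hx, hy, hz⟩
      obtain rfl := eq_neg_one_of_eq_add hy
      rw [sgn_neg, sgn_one] at hx
      push_cast at hx
      exact ⟨-1 + n, k, by push_cast; linarith, hz⟩
    · rintro ⟨n, k, hx, hz⟩
      refine ⟨-1, n + 1, k, ?_, by norm_num, by rwa [show -1 + (n + 1) = n by ring]⟩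
      rw [sgn_neg, sgn_one]
      push_cast
      linarith
  · intro x z y d
    exact ⟨_, _, d, 0, 0, rfl, rfl, rfl⟩

theorem nonempty_homeomorph_bundle_three :
    Nonempty (geomRealization (twistedProduct kleinBottle8 (shiftAut * swapAut)) ≃ₜ FlatB 3) := by
  refine nonempty_homeomorph_flatQuotient (hasDisplacement_bieberbachGroup 3) (shiftAut * swapAut)
    (Ψ := fun x z y => !₂[y / 6, (x + 1 / 4) / 2, z + 1 / 4]) (S := fun x _ => -x + 1 / 2)
    (T := fun _ z => z + 1 / 2)
    (continuous_vec_three (by fun_prop) (by fun_prop) (by fun_prop)) ?_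
    (fun x z v => (planeCoord_shift (-x) z (swapPerm v)).trans (planeCoord_reflect x z v))
    ?_ ?_ ?_ ?_
  · intro e
    refine ⟨2 * e 1 - 1 / 4, e 2 - 1 / 4, 6 * e 0, ?_⟩
    conv_rhs => rw [eq_vec_three e]
    rw [vec_three_eq_iff]
    exact ⟨by ring, by ring, by ring⟩
  all_goals simp only [bundle_three_iff]
  · rintro x z y x' z' y' ⟨m, n, k, -, -, h, -⟩
    exact ⟨m, h⟩
  · intro x z y x' z'
    constructor
    · rintro ⟨m, n, k, hnk, hx, hy, hz⟩
      obtain rfl := eq_zero_of_eq_add hy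
      rw [sgn_zero] at hx
      rw [zero_add] at hz
      push_cast at hx
      refine ⟨n, k / 2, by linarith, ?_⟩
      rcases Int.even_or_odd' k with ⟨l, rfl | rfl⟩
      · rw [sgn_congr (show n % 2 = 0 % 2 by omega), sgn_zero] at hz ⊢
        rw [show 2 * l / 2 = l by omega]
        push_cast at hz ⊢
        linarith
      · rw [sgn_congr (show n % 2 = 1 % 2 by omega), sgn_one] at hz ⊢
        rw [show (2 * l + 1) / 2 = l by omega]
        push_cast at hz ⊢
        linarith
    · rintro ⟨n, l, hx, hz⟩
      rcases Int.emod_two_eq_zero_or_one n with h | h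
      · refine ⟨0, n, 2 * l, by omega, ?_, by simp, ?_⟩
        · rw [sgn_zero]
          push_cast
          linarith
        · rw [zero_add]
          rw [sgn_congr (show n % 2 = 0 % 2 by omega), sgn_zero] at hz ⊢
          push_cast at hz ⊢
          linarith
      · refine ⟨0, n, 2 * l + 1, by omega, ?_, by simp, ?_⟩
        · rw [sgn_zero]
          push_cast
          linarith
        · rw [zero_add]
          rw [sgn_congr (show n % 2 = 1 % 2 by omega), sgn_one] at hz ⊢
          push_cast at hz ⊢
          linarith
  · intro x z x' z'
    constructor
    · rintro ⟨m, n, k, hnk, hx, hy, hz⟩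
      obtain rfl := eq_neg_one_of_eq_add hy
      rw [sgn_neg, sgn_one] at hx
      push_cast at hx
      refine ⟨-1 + n, k / 2, by push_cast; linarith, ?_⟩
      rcases Int.even_or_odd' k with ⟨l, rfl | rfl⟩
      · rw [sgn_congr (show (-1 + n) % 2 = 1 % 2 by omega), sgn_one] at hz ⊢
        rw [show 2 * l / 2 = l by omega]
        push_cast at hz ⊢
        linarith
      · rw [sgn_congr (show (-1 + n) % 2 = 0 % 2 by omega), sgn_zero] at hz ⊢
        rw [show (2 * l + 1) / 2 = l by omega]
        push_cast at hz ⊢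
        linarith
    · rintro ⟨n, l, hx, hz⟩
      rcases Int.emod_two_eq_zero_or_one n with h | h
      · refine ⟨-1, n + 1, 2 * l + 1, by omega, ?_, by norm_num, ?_⟩
        · rw [sgn_neg, sgn_one]
          push_cast
          linarith
        · rw [show -1 + (n + 1) = n by ring]
          rw [sgn_congr (show n % 2 = 0 % 2 by omega), sgn_zero] at hz ⊢
          push_cast at hz ⊢
          linarith
      · refine ⟨-1, n + 1, 2 * l, by omega, ?_, by norm_num, ?_⟩
        · rw [sgn_neg, sgn_one]
          push_cast
          linarith
        · rw [show -1 + (n + 1) = n by ring]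
          rw [sgn_congr (show n % 2 = 1 % 2 by omega), sgn_one] at hz ⊢
          push_cast at hz ⊢
          linarith
  · intro x z y d
    exact ⟨_, _, d, 0, 0, rfl, rfl, rfl, rfl⟩

end KleinBundles

/-! ### The theorem -/

theorem mainTheorem7 :
    -- `²8₂₀` is a triangulation of the Klein bottle, and no triangulation has fewer vertices
    (IsTriangulatedSurface kleinBottle8 ∧
      Nonempty (geomRealization kleinBottle8 ≃ₜ KleinBottle)) ∧
    (∀ (V : Type*) [LinearOrder V] [Fintype V] (K : AbstractSimplicialComplex V),
      IsTriangulatedSurface K → Nonempty (geomRealization K ≃ₜ KleinBottle) →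
        8 ≤ numVertices K) ∧
    ∀ i : Fin 4,
      -- the twisted product triangulation with `24` vertices (untwisted for `𝓑₁`)
      (∃ φ : complexAut kleinBottle8,
        (i = 0 → φ = 1) ∧
        numVertices (twistedProduct kleinBottle8 φ) = 24 ∧
        Nonempty (geomRealization (twistedProduct kleinBottle8 φ) ≃ₜ FlatB i)) ∧
      -- no smaller twisted product triangulation of a surface over the circle
      (∀ (V : Type*) [LinearOrder V] [Fintype V] (K : AbstractSimplicialComplex V)
        (φ : complexAut K), IsTriangulatedSurface K →
        Nonempty (geomRealization (twistedProduct K φ) ≃ₜ FlatB i) →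
          24 ≤ numVertices (twistedProduct K φ)) ∧
      -- no smaller product triangulation of a surface and a circle
      (∀ (V W : Type*) [LinearOrder V] [Fintype V] [LinearOrder W] [Fintype W]
        (K : AbstractSimplicialComplex V) (C : AbstractSimplicialComplex W),
        IsTriangulatedSurface K → IsTriangulatedCircle C.toPreAbstractSimplicialComplex →
        Nonempty (geomRealization (productComplex K C) ≃ₜ FlatB i) →
          24 ≤ numVertices (productComplex K C)) := by
  refine ⟨⟨isTriangulatedSurface_kleinBottle8, nonempty_homeomorph_kleinBottle8⟩,
    fun V _ _ K hK ⟨h⟩ => eight_le_card_of_kleinBottle hK h, fun i => ⟨?_, ?_, ?_⟩⟩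
  · have hcard : ∀ φ : complexAut kleinBottle8,
        numVertices (twistedProduct kleinBottle8 φ) = 24 := fun φ => by simp [numVertices]
    rcases (by decide : ∀ i : Fin 4, i = 0 ∨ i = 1 ∨ i = 2 ∨ i = 3) i with rfl | rfl | rfl | rfl
    · exact ⟨1, fun _ => rfl, hcard _, nonempty_homeomorph_bundle_zero⟩
    · exact ⟨shiftAut, fun h => absurd h (by decide), hcard _, nonempty_homeomorph_bundle_one⟩
    · exact ⟨swapAut, fun h => absurd h (by decide), hcard _, nonempty_homeomorph_bundle_two⟩
    · exact ⟨shiftAut * swapAut, fun h => absurd h (by decide), hcard _,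
        nonempty_homeomorph_bundle_three⟩
  · rintro V _ _ K φ hK ⟨h⟩
    have := eight_le_card_of_twistedProduct hK h
    rw [numVertices, Fintype.card_prod, Fintype.card_fin]
    omega
  · rintro V W _ _ _ _ K C hK hC ⟨h⟩
    have h8 := eight_le_card_of_productComplex hK hC h
    have h3 := hC.three_le_card
    rw [numVertices, Fintype.card_prod]
    exact Nat.mul_le_mul h8 h3
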